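/- **Conventions.** Fix $h\in\mathbb C$, write $q=e^{h}$ and $q^{x}=e^{hx}$ for $x\in\mathbb C$, and put $[x]_q=\frac{q^x-q^{-x}}{q-q^{-1}}$, $[n]_q!=\prod_{k=1}^n[k]_q$, $[x;n]_q!=\prod_{k=0}^{n-1}[x-k]_q$. Choose for each $x\in\mathbb C$ a square root $\sqrt{[x]_q}$ (any choice); the square root of a product of $q$-numbers means the product of the chosen square roots. One of two cases is considered. * *Infinite dimensional case*: $q$ is not a root of unity, and $M=\infty$. * *Finite dimensional case*: $q=\epsilon=\exp(\pi i s/N)$ with $h=\pi i s/N$, $N\ge 2$, $(N,s)=1$, and $M=N$. A label $\mu$ is either a color $p\in\mathbb C$, with $\dim p=M$, or a spin $j$, $2j\in\mathbb Z_{\ge0}$, with $\dim j=2j+1$. Write $c\subset a\otimes b$ if $c=a+b-n$ for an integer $0\le n<\min(\dim a,\dim b)$ (where $c$ is a spin if $a$ and $b$ are spins and a color otherwise). A color $p$ is called regular if $[2p+m]_q\ne0$ for all $m\in\mathbb Z$; a spin $j$ is called regular if $M=\infty$ or $2j\le N-2$. *Clebsch–Gordan coefficients.* If $c=a+b-n\subset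 a\otimes b$, $z_3=z_1+z_2-n$ and $0\le z_1<\dim a$, $0\le z_2<\dim b$, $0\le z_3<\dim c$, then $$C(a,b,c;z_1,z_2,z_3)=\sqrt{[2a+2b-2n+1]_q}\,\sqrt{[n]_q![z_1]_q![z_2]_q![z_3]_q!}\;q^{(n-n^2)/2+(n-z_2)a+(n+z_1)b}\sum_{\nu=\max(0,n-z_2)}^{\min(n,z_1)}\frac{(-1)^\nu q^{-\nu(2a+2b-n+1)}}{[\nu]_q![n-\nu]_q![z_1-\nu]_q![z_2-n+\nu]_q!}\sqrt{\frac{[2a-n;z_1-\nu]_q!\,[2a-z_1;n-\nu]_q!\,[2b-n;z_2+\nu-n]_q!\,[2b-z_2;\nu]_q!}{[2a+2b-n+1;z_1+z_2+1]_q!}},$$ and $C=0$ otherwise. Put $$L^{ab,m,z}_{w_1w_2w_3}=\sum_y C(a,b,ab;w_1,w_2,y)\,C(ab,c,m;y,w_3,z),\qquad R^{bc,m,z}_{w_1w_2w_3}=\sum_y C(b,c,bc;w_2,w_3,y)\,C(a,bc,m;w_1,y,z)$$ for the coefficients of the coupled vectors $|a\,b(ab)\,c\,m\,z\rangle$ and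 $|a,b\,c(bc)\,m\,z\rangle$ in the basis $|a,w_1\rangle\otimes|b,w_2\rangle\otimes|c,w_3\rangle$. (Here $ab$, $bc$ and $m$ are names of labels.) *Racah coefficients.* $$\sqrt{[2ab+1]_q[2bc+1]_q}\;W(a,b,m,c;ab,bc)=\sum_{w_1,w_2,w_3}L^{ab,m,0}_{w_1w_2w_3}\,R^{bc,m,0}_{w_1w_2w_3}.$$ *Vertex $R$-matrix.* With $g(a,b,n;u)=(-1)^n\prod_{k=0}^{n-1}\frac{[u-a-b+k]_q}{[u+a+b-k]_q}$, $$R_{ab}(u)^{a_1a_2}_{b_1b_2}=\sum_{0\le n<\min(\dim a,\dim b)}g(a,b,n;u)\sum_z C(a,b,a+b-n;b_1,b_2,z)\,C(b,a,a+b-n;a_2,a_1,z).$$ *Colored IRF weights.* If $g_{12}\subset p_1\otimes g_0$, $g_1\subset p_2\otimes g_{12}$, $g_{21}\subset p_2\otimes g_0$ and $g_1\subset p_1\otimes g_{21}$, then $$w(g_{12},g_1,g_{21},g_0;p_1,p_2;u)=\sum_{0\le n<\min(\dim p_1,\dim p_2)}g(p_1,p_2,n;u)\,[2p+1]_q\sqrt{[2g_{12}+1]_q[2g_{21}+1]_q}\;W(p_2,p_1,g_1,g_0;p,g_{12})\,W(p_1,p_2,g_1,g_0;p,g_{21}),\quad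 p=p_1+p_2-n,$$ and $w=0$ otherwise. **Statement.** Let $p_1,p_2,p_3$ and $g_0$ be labels, each a color or a spin, such that $p_i$ $(i=1,2,3)$, $p_i+p_j$ $(i<j)$ and $g_0+\sum_{i\in S}p_i$ $(S\subseteq\{1,2,3\})$ are regular. Let $u,v\in\mathbb C$ be such that the functions $g(p_1,p_2,n;u)$, $g(p_1,p_3,n;u+v)$, $g(p_2,p_3,n;v)$ have no vanishing denominator for the values $0\le n<\min(\dim p_i,\dim p_j)$ over which the weights are summed. Then, in the infinite and in the finite dimensional case: 1. *(Racah coefficients.)* With $(a,b,c)=(p_1,p_2,g_0)$, for all labels $ab,m$ and all $z,w_1,w_2,w_3\in\mathbb Z_{\ge0}$, $$L^{ab,m,z}_{w_1w_2w_3}=\sum_{bc}\sqrt{[2ab+1]_q[2bc+1]_q}\;W(a,b,m,c;ab,bc)\,R^{bc,m,z}_{w_1w_2w_3}.$$ 2. *(Vertex–IRF transformation.)* For all labels $g_{12},g_1$ and all $z,z_1,z_2,z_0\in\mathbb Z_{\ge0}$, $$\sum_{w_1,w_2}R_{p_2p_1}(u)^{z_2z_1}_{w_2w_1}\,\langle w_2,w_1,z_0|p_2,p_1g_0(g_{12})\,g_1\,z\rangle=\sum_{g_{21}}w(g_{12},g_1,g_{21},g_0;p_1,p_2;u)\,\langle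 z_1,z_2,z_0|p_1,p_2g_0(g_{21})\,g_1\,z\rangle,$$ where $\langle w_1,w_2,w_3|a,b\,c(bc)\,m\,z\rangle=R^{bc,m,z}_{w_1w_2w_3}$ is taken with the indicated labels. 3. *(IRF Yang–Baxter relation.)* For all labels $g_1,g_2,g_3,g_1',g_2'$, $$\sum_g w(g_1,g_2,g,g_0;p_1,p_2;u)\,w(g_2,g_3,g_2',g;p_1,p_3;u+v)\,w(g,g_2',g_1',g_0;p_2,p_3;v)=\sum_g w(g_2,g_3,g,g_1;p_2,p_3;v)\,w(g_1,g,g_1',g_0;p_1,p_3;u+v)\,w(g,g_3,g_2',g_1';p_1,p_2;u).$$ All sums have only finitely many non-zero terms. -/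

import Mathlib

namespace ColoredIRF

/-- The data on which all formulas depend: `q = exp h` (so that `q ^ x = exp (h * x)` for complex
`x`), the dimension `M` of the color representations (`⊤` for the infinite dimensional ones, `N` for
the finite dimensional ones), and a choice `rt x` of a square root of `[x]_q` for every `x`. The
square root of a product of `q`-numbers is always the product of the chosen square roots. -/
structure Setup where
  h : ℂ
  M : ℕ∞
  rt : ℂ → ℂ

/-- Labels of representations of `U_q(sl(2))`: `color p` is the color representation with complex
parameter `p`, and `spin k` is the spin `j` representation with `2 j = k`. -/
inductive ColorRep where
  | color (p : ℂ)
  | spin (k : ℕ)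

namespace ColorRep

/-- The parameter `μ` of a representation (`p` or `j`). -/
noncomputable def val : ColorRep → ℂ
  | color p => p
  | spin k => (k : ℂ) / 2

/-- The label of the summand with parameter `μ₁ + μ₂ - n` in `μ₁ ⊗ μ₂`
(used for `n < min (dim μ₁) (dim μ₂)` only, where the subtraction below does not truncate). -/
noncomputable def fuse : ColorRep → ColorRep → ℕ → ColorRep
  | spin k, spin l, n => spin (k + l - 2 * n)
  | spin k, color p, n => color ((k : ℂ) / 2 + p - n)
  | color p, spin k, n => color (p + (k : ℂ) / 2 - n)
  | color p, color p', n => color (p + p' - n)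

/-- The leading summand of `a ⊗ b`, with parameter `μ₁ + μ₂`. -/
noncomputable def add (a b : ColorRep) : ColorRep := fuse a b 0

end ColorRep

open ColorRep

namespace Setup

variable (D : Setup)

/-- `q ^ x`. -/
noncomputable def qpow (x : ℂ) : ℂ := Complex.exp (D.h * x)

/-- `[x]_q`. -/
noncomputable def qnum (x : ℂ) : ℂ :=
  (D.qpow x - D.qpow (-x)) / (D.qpow 1 - D.qpow (-1))

/-- `[n]_q !`. -/
noncomputable def qfact (n : ℕ) : ℂ := ∏ k ∈ Finset.range n, D.qnum ((k : ℂ) + 1)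

/-- The square root of `[x; n]_q ! = [x]_q [x-1]_q ⋯ [x-n+1]_q`. -/
noncomputable def rtFall (x : ℂ) (n : ℕ) : ℂ := ∏ k ∈ Finset.range n, D.rt (x - k)

/-- The square root of `[n]_q !`. -/
noncomputable def rtFact (n : ℕ) : ℂ := D.rtFall n n

/-- The infinite dimensional case: `q` is generic, i.e. not a root of unity. -/
def IsGenericCase : Prop := D.M = ⊤ ∧ ∀ m : ℕ, m ≠ 0 → Complex.exp D.h ^ m ≠ 1

/-- The finite dimensional case: `q = ε = exp (π i s / N)` with `(N, s) = 1`, and the color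
representations have dimension `N`. -/
def IsRootCase : Prop :=
  ∃ (N : ℕ) (s : ℤ), 2 ≤ N ∧ IsCoprime (N : ℤ) s ∧ D.M = (N : ℕ∞) ∧
    D.h = (Real.pi : ℂ) * Complex.I * (s : ℂ) / (N : ℂ)

/-- The dimension; the basis vectors of `a` are `|a, z⟩` with `z < dim a`. -/
def dim : ColorRep → ℕ∞
  | color _ => D.M
  | spin k => ((k + 1 : ℕ) : ℕ∞)

/-- A color is regular if `q ^ (4 p)` is not an integral power of `q ^ 2`; a spin is regular if it is
allowed: no condition in the infinite dimensional case, `0 ≤ 2 j ≤ N - 2` in the finite one. -/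
def Regular : ColorRep → Prop
  | color p => ∀ m : ℤ, D.qnum (2 * p + m) ≠ 0
  | spin k => ((k + 2 : ℕ) : ℕ∞) ≤ D.M

/-- Fusion rule: `c` is the summand with index `n` of `a ⊗ b`. -/
def FusesAt (a b c : ColorRep) (n : ℕ) : Prop :=
  (n : ℕ∞) < D.dim a ∧ (n : ℕ∞) < D.dim b ∧ c = fuse a b n

/-- `N_{a b}^c = 1`, that is, `c ⊂ a ⊗ b`. -/
def Fuses (a b c : ColorRep) : Prop := ∃ n, D.FusesAt a b c n

/-- The (unique) `n` with `c = a + b - n`, if `c ⊂ a ⊗ b`. -/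
noncomputable def level (a b c : ColorRep) : ℕ := sInf {n | D.FusesAt a b c n}

/-- The explicit expression of `C(μ₁, μ₂, μ₁ + μ₂ - n; z₁, z₂, z₃)_q`. For spins, the terms with
`ν > 2 j₂ - z₂` or `ν < n + z₁ - 2 j₁` vanish, because they contain `[0]_q`. -/
noncomputable def cgFormula (μ₁ μ₂ : ℂ) (n z₁ z₂ z₃ : ℕ) : ℂ :=
  D.rt (2 * μ₁ + 2 * μ₂ - 2 * n + 1)
    * (D.rtFact n * D.rtFact z₁ * D.rtFact z₂ * D.rtFact z₃)
    * D.qpow (((n : ℂ) - (n : ℂ) ^ 2) / 2 + ((n : ℂ) - z₂) * μ₁ + ((n : ℂ) + z₁) * μ₂)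
    * ∑ ν ∈ Finset.Icc (n - z₂) (min n z₁),
        ((-1) ^ ν * D.qpow (-((ν : ℂ) * (2 * μ₁ + 2 * μ₂ - n + 1)))
          / (D.qfact ν * D.qfact (n - ν) * D.qfact (z₁ - ν) * D.qfact (z₂ + ν - n)))
        * (D.rtFall (2 * μ₁ - n) (z₁ - ν) * D.rtFall (2 * μ₁ - z₁) (n - ν)
            * D.rtFall (2 * μ₂ - n) (z₂ + ν - n) * D.rtFall (2 * μ₂ - z₂) ν
          / D.rtFall (2 * μ₁ + 2 * μ₂ - n + 1) (z₁ + z₂ + 1))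

open Classical in
/-- The Clebsch-Gordan coefficient `C(a, b, c; z₁, z₂, z₃)_q`. -/
noncomputable def cg (a b c : ColorRep) (z₁ z₂ z₃ : ℕ) : ℂ :=
  if D.Fuses a b c ∧ z₁ + z₂ = z₃ + D.level a b c ∧
      (z₁ : ℕ∞) < D.dim a ∧ (z₂ : ℕ∞) < D.dim b ∧ (z₃ : ℕ∞) < D.dim c then
    D.cgFormula a.val b.val (D.level a b c) z₁ z₂ z₃
  else 0

/-- The coefficient of `|a, w₁⟩ ⊗ |b, w₂⟩ ⊗ |c, w₃⟩` in `|a b (ab) c m z⟩`. -/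
noncomputable def coupledLeft (a b c ab m : ColorRep) (z w₁ w₂ w₃ : ℕ) : ℂ :=
  ∑ᶠ y : ℕ, D.cg a b ab w₁ w₂ y * D.cg ab c m y w₃ z

/-- The coefficient of `|a, w₁⟩ ⊗ |b, w₂⟩ ⊗ |c, w₃⟩` in `|a, b c (bc) m z⟩`. -/
noncomputable def coupledRight (a b c bc m : ColorRep) (z w₁ w₂ w₃ : ℕ) : ℂ :=
  ∑ᶠ y : ℕ, D.cg b c bc w₂ w₃ y * D.cg a bc m w₁ y z

/-- The matrix element `R_{μ'' μ'}`, obtained by projecting `|a b (ab) c m z⟩` onto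
`|a, b c (bc) m z⟩` for `z = 0`. -/
noncomputable def racahMatrix (a b c m ab bc : ColorRep) : ℂ :=
  ∑ᶠ w : ℕ × ℕ × ℕ,
    D.coupledLeft a b c ab m 0 w.1 w.2.1 w.2.2 * D.coupledRight a b c bc m 0 w.1 w.2.1 w.2.2

/-- The Racah coefficient `W(a, b, m, c; ab, bc)_q`. -/
noncomputable def racahW (a b m c ab bc : ColorRep) : ℂ :=
  D.racahMatrix a b c m ab bc / (D.rt (2 * ab.val + 1) * D.rt (2 * bc.val + 1))

/-- The function `g(a, b, n; u)_q`. -/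
noncomputable def gFun (a b : ColorRep) (n : ℕ) (u : ℂ) : ℂ :=
  (-1) ^ n * ∏ k ∈ Finset.range n,
    (D.qnum (u - a.val - b.val + k) / D.qnum (u + a.val + b.val - k))

/-- The function `n ↦ g(a, b, n; u)_q` has no pole in the range `n < min (dim a) (dim b)`. -/
def NoPole (a b : ColorRep) (u : ℂ) : Prop :=
  ∀ k : ℕ, ((k + 1 : ℕ) : ℕ∞) < D.dim a → ((k + 1 : ℕ) : ℕ∞) < D.dim b →
    D.qnum (u + a.val + b.val - k) ≠ 0

/-- The vertex `R`-matrix element `R_{a b}(q; u)^{a₁ a₂}_{b₁ b₂}`, i.e. the matrix element of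
`∑ |b a; μ⟩ g(a, b, μ; u) ⟨a b; μ|` (followed by the permutation of the two factors). -/
noncomputable def vertexR (a b : ColorRep) (u : ℂ) (a₁ a₂ b₁ b₂ : ℕ) : ℂ :=
  ∑ᶠ (n : ℕ) (_ : (n : ℕ∞) < D.dim a ∧ (n : ℕ∞) < D.dim b),
    D.gFun a b n u *
      ∑ᶠ z : ℕ, D.cg a b (fuse a b n) b₁ b₂ z * D.cg b a (fuse a b n) a₂ a₁ z

/-- The admissibility condition for the configuration `{g₁₂, g₁, g₂₁, g₀; p₁, p₂}`. -/
def Admissible (g₁₂ g₁ g₂₁ g₀ p₁ p₂ : ColorRep) : Prop :=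
  D.Fuses p₁ g₀ g₁₂ ∧ D.Fuses p₂ g₁₂ g₁ ∧ D.Fuses p₂ g₀ g₂₁ ∧ D.Fuses p₁ g₂₁ g₁

open Classical in
/-- The Boltzmann weight `w(g₁₂, g₁, g₂₁, g₀; p₁, p₂; u)_q` of the colored IRF model. -/
noncomputable def weight (g₁₂ g₁ g₂₁ g₀ p₁ p₂ : ColorRep) (u : ℂ) : ℂ :=
  if D.Admissible g₁₂ g₁ g₂₁ g₀ p₁ p₂ then
    ∑ᶠ (n : ℕ) (_ : (n : ℕ∞) < D.dim p₁ ∧ (n : ℕ∞) < D.dim p₂),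
      D.gFun p₁ p₂ n u * D.qnum (2 * (fuse p₁ p₂ n).val + 1)
        * (D.rt (2 * g₁₂.val + 1) * D.rt (2 * g₂₁.val + 1))
        * D.racahW p₂ p₁ g₁ g₀ (fuse p₁ p₂ n) g₁₂
        * D.racahW p₁ p₂ g₁ g₀ (fuse p₁ p₂ n) g₂₁
  else 0

/-- Genericity of the colors: every representation occurring as `p_i`, in `p_i ⊗ p_j` (`i ≠ j`), or
on a path of heights starting from `g₀` is regular. -/
def GenericColors (p₁ p₂ p₃ g₀ : ColorRep) : Prop :=
  (D.Regular p₁ ∧ D.Regular p₂ ∧ D.Regular p₃) ∧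
  (D.Regular (add p₁ p₂) ∧ D.Regular (add p₁ p₃) ∧ D.Regular (add p₂ p₃)) ∧
  D.Regular g₀ ∧
  (D.Regular (add p₁ g₀) ∧ D.Regular (add p₂ g₀) ∧ D.Regular (add p₃ g₀)) ∧
  (D.Regular (add (add p₁ p₂) g₀) ∧ D.Regular (add (add p₁ p₃) g₀) ∧
    D.Regular (add (add p₂ p₃) g₀)) ∧
  D.Regular (add (add (add p₁ p₂) p₃) g₀)

end Setup

end ColoredIRF

section

open Finset

set_option linter.unusedSectionVars false

/-! ### Two-site operators of the quantum affine algebra and their commutation relations. -/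

namespace ColoredIRF

/-! Vectors of tensor products are treated as coefficient functions `φ z w`, on which the generators
`E`, `F`, `K` act by explicit operators; the level `z + w` measures the distance from the highest
weight.

Three facts about the Clebsch–Gordan coefficients carry the representation theory: they intertwine
the lowering operators (`lower_cgPsi`, from the telescoping identity `sum_cgTerm_recursion`), the
first vector of each channel is annihilated by `E` (`raise_cgPsi`), and it has norm one for the
bilinear pairing (`norm_cgPsi`, which is the `q`-Vandermonde sum). As `E` and `F` are transposes of
each other, and as singular vectors of one level form at most a line, orthonormality and
completeness follow by induction on the level (`CGBasis.orth`, `CGBasis.expand`). Regularity of the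
labels keeps the denominators nonzero and excludes a new singular vector where a channel ends, so
that the tensor products are completely reducible also at roots of unity.

Racah coefficients: by a Schur argument (`pair3_ladder`) the pairing of a left-coupled with a
right-coupled vector is diagonal in the weight and independent of it. Its value at weight zero, by
which `W` is defined, therefore gives the recoupling in every weight, and the first claim is
completeness applied twice.

Vertex–IRF transformation: on left-coupled vectors the `R`-matrix is multiplication by `g` followed
by the exchange of two factors (`rOp_cpL`). Passing from right-coupled vectors to left-coupled ones,
multiplying by `g` and passing back produces exactly the IRF weights.

Yang–Baxter relation: the quotients `g (n + 1) / g n` are such that the `R`-matrix intertwines the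
affine generator (`rCheck_basis`), hence the entries `A`, `C`, `D` of two-site monodromy matrices
for every spectral parameter `l`. Both sides of the vertex Yang–Baxter equation then intertwine the
entry `C` of the three-site monodromy matrix and agree on the vacuum. For generic parameters these
entries have no common kernel in positive level (`triple_kernel`), so the two sides agree by
induction on the level. Applied to vectors labelled by paths of heights, the vertex–IRF
transformation turns this into the IRF relation, because path vectors are linearly independent. The
remaining values of `u`, `v` are reached by continuity. -/

/-- The data of a weight module with basis `v z`, `z < d`, on which `E v (z + 1) = f z • v z`,
`F v z = f z • v (z + 1)` and `K v z = k0 * q ^ (-z) • v z`. -/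
structure Site where
  k0 : ℂ
  f : ℕ → ℂ
  d : ℕ∞

namespace Site

/-- The lowering coefficient into `v z`. -/
def fm (s : Site) : ℕ → ℂ
  | 0 => 0
  | z + 1 => s.f z

@[simp] lemma fm_zero (s : Site) : s.fm 0 = 0 := rfl
@[simp] lemma fm_succ (s : Site) (z : ℕ) : s.fm (z + 1) = s.f z := rfl

/-- The eigenvalue of `K` on `v z`. -/
noncomputable def k (s : Site) (q : ℂ) (z : ℕ) : ℂ := s.k0 * q⁻¹ ^ z

/-- The value of the (rescaled) Casimir element. -/
noncomputable def cas (s : Site) (q : ℂ) : ℂ := q * s.k0 ^ 2 + q⁻¹ * s.k0⁻¹ ^ 2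

/-- The conditions making the data of a `Site` an irreducible representation. -/
structure IsRep (s : Site) (q : ℂ) : Prop where
  k0_ne : s.k0 ≠ 0
  d_pos : 0 < s.d
  f_sq : ∀ z, (q - q⁻¹) ^ 2 * s.f z ^ 2 = s.cas q - q⁻¹ * s.k q z ^ 2 - q * (s.k q z)⁻¹ ^ 2
  f_ne : ∀ z : ℕ, ((z + 1 : ℕ) : ℕ∞) < s.d → s.f z ≠ 0
  f_top : ∀ z : ℕ, ((z + 1 : ℕ) : ℕ∞) = s.d → s.f z = 0

variable {s : Site} {q : ℂ}

lemma k_succ (s : Site) (q : ℂ) (z : ℕ) : s.k q (z + 1) = q⁻¹ * s.k q z := by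
  simp only [k, pow_succ]; ring

lemma IsRep.k_ne (h : s.IsRep q) (hq : q ≠ 0) (z : ℕ) : s.k q z ≠ 0 :=
  mul_ne_zero h.k0_ne (pow_ne_zero _ (inv_ne_zero hq))

/-- Where `f_sq` is the Casimir element written through `E F`, this is the same element written
through `F E`; at `z = 0`, where `F E` vanishes, it reduces to the definition of `cas`. -/
lemma IsRep.fm_sq (h : s.IsRep q) (hq : q ≠ 0) (z : ℕ) :
    (q - q⁻¹) ^ 2 * s.fm z ^ 2 = s.cas q - q * s.k q z ^ 2 - q⁻¹ * (s.k q z)⁻¹ ^ 2 := by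
  cases z with
  | zero => simp [k, cas]
  | succ z =>
    have := h.f_sq z
    have hk := h.k_ne hq z
    rw [fm_succ, this, k_succ]
    field_simp

/-- The commutator of `E` and `F`, as the difference of the two forms of the Casimir element. -/
lemma IsRep.f_sq_sub (h : s.IsRep q) (hq : q ≠ 0) (hω : q - q⁻¹ ≠ 0) (z : ℕ) :
    (q - q⁻¹) * (s.f z ^ 2 - s.fm z ^ 2) = s.k q z ^ 2 - (s.k q z)⁻¹ ^ 2 := by
  apply mul_left_cancel₀ hω
  linear_combination h.f_sq z - h.fm_sq hq z

end Site

open Site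

variable (q : ℂ) (s t : Site)

/-- The coproduct of `E`. -/
noncomputable def raiseOp : (ℕ → ℕ → ℂ) →ₗ[ℂ] (ℕ → ℕ → ℂ) where
  toFun φ z w := s.f z * t.k q w * φ (z + 1) w + (s.k q z)⁻¹ * t.f w * φ z (w + 1)
  map_add' φ χ := by ext z w; simp only [Pi.add_apply]; ring
  map_smul' c φ := by ext z w; simp only [Pi.smul_apply, smul_eq_mul, RingHom.id_apply]; ring

/-- The coproduct of `F`. -/
noncomputable def lowerOp : (ℕ → ℕ → ℂ) →ₗ[ℂ] (ℕ → ℕ → ℂ) where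
  toFun φ z w := s.fm z * t.k q w * φ (z - 1) w + (s.k q z)⁻¹ * t.fm w * φ z (w - 1)
  map_add' φ χ := by ext z w; simp only [Pi.add_apply]; ring
  map_smul' c φ := by ext z w; simp only [Pi.smul_apply, smul_eq_mul, RingHom.id_apply]; ring

/-- The coproduct of `K`. -/
noncomputable def weightOp : (ℕ → ℕ → ℂ) →ₗ[ℂ] (ℕ → ℕ → ℂ) where
  toFun φ z w := s.k q z * t.k q w * φ z w
  map_add' φ χ := by ext z w; simp only [Pi.add_apply]; ring
  map_smul' c φ := by ext z w; simp only [Pi.smul_apply, smul_eq_mul, RingHom.id_apply]; ring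

/-- The coproduct of `K⁻¹`. -/
noncomputable def weightInvOp : (ℕ → ℕ → ℂ) →ₗ[ℂ] (ℕ → ℕ → ℂ) where
  toFun φ z w := (s.k q z)⁻¹ * (t.k q w)⁻¹ * φ z w
  map_add' φ χ := by ext z w; simp only [Pi.add_apply]; ring
  map_smul' c φ := by ext z w; simp only [Pi.smul_apply, smul_eq_mul, RingHom.id_apply]; ring

/-- The affine raising operator `x E ⊗ K⁻¹ + x⁻¹ K ⊗ E`. -/
noncomputable def affOp (x : ℂ) : (ℕ → ℕ → ℂ) →ₗ[ℂ] (ℕ → ℕ → ℂ) where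
  toFun φ z w := x * (s.f z * (t.k q w)⁻¹ * φ (z + 1) w) + x⁻¹ * (s.k q z * t.f w * φ z (w + 1))
  map_add' φ χ := by ext z w; simp only [Pi.add_apply]; ring
  map_smul' c φ := by ext z w; simp only [Pi.smul_apply, smul_eq_mul, RingHom.id_apply]; ring

/-- The constant coefficient of the diagonal entry `A` of the monodromy matrix. -/
noncomputable def monA (x : ℂ) : (ℕ → ℕ → ℂ) →ₗ[ℂ] (ℕ → ℕ → ℂ) where
  toFun φ z w := -(x * (s.k q z * (t.k q w)⁻¹ * φ z w)) - x⁻¹ * ((s.k q z)⁻¹ * t.k q w * φ z w)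
    + (q - q⁻¹) ^ 2 * x⁻¹ * (s.fm z * t.f w * φ (z - 1) (w + 1))
  map_add' φ χ := by ext z w; simp only [Pi.add_apply]; ring
  map_smul' c φ := by ext z w; simp only [Pi.smul_apply, smul_eq_mul, RingHom.id_apply]; ring

/-- The constant coefficient of the diagonal entry `D` of the monodromy matrix. -/
noncomputable def monD (x : ℂ) : (ℕ → ℕ → ℂ) →ₗ[ℂ] (ℕ → ℕ → ℂ) where
  toFun φ z w := -(x * ((s.k q z)⁻¹ * t.k q w * φ z w)) - x⁻¹ * (s.k q z * (t.k q w)⁻¹ * φ z w)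
    + (q - q⁻¹) ^ 2 * x * (s.f z * t.fm w * φ (z + 1) (w - 1))
  map_add' φ χ := by ext z w; simp only [Pi.add_apply]; ring
  map_smul' c φ := by ext z w; simp only [Pi.smul_apply, smul_eq_mul, RingHom.id_apply]; ring

variable {q s t} (hq : q ≠ 0) (hω : q - q⁻¹ ≠ 0) (hs : s.IsRep q) (ht : t.IsRep q)

section apply
variable (φ : ℕ → ℕ → ℂ) (x : ℂ) (z w : ℕ)

lemma raiseOp_apply : raiseOp q s t φ z w =
    s.f z * t.k q w * φ (z + 1) w + (s.k q z)⁻¹ * t.f w * φ z (w + 1) := rfl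
lemma lowerOp_apply : lowerOp q s t φ z w =
    s.fm z * t.k q w * φ (z - 1) w + (s.k q z)⁻¹ * t.fm w * φ z (w - 1) := rfl
lemma weightOp_apply : weightOp q s t φ z w = s.k q z * t.k q w * φ z w := rfl
lemma weightInvOp_apply : weightInvOp q s t φ z w = (s.k q z)⁻¹ * (t.k q w)⁻¹ * φ z w := rfl
lemma affOp_apply : affOp q s t x φ z w = x * (s.f z * (t.k q w)⁻¹ * φ (z + 1) w)
    + x⁻¹ * (s.k q z * t.f w * φ z (w + 1)) := rfl
lemma monA_apply : monA q s t x φ z w =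
    -(x * (s.k q z * (t.k q w)⁻¹ * φ z w)) - x⁻¹ * ((s.k q z)⁻¹ * t.k q w * φ z w)
    + (q - q⁻¹) ^ 2 * x⁻¹ * (s.fm z * t.f w * φ (z - 1) (w + 1)) := rfl
lemma monD_apply : monD q s t x φ z w =
    -(x * ((s.k q z)⁻¹ * t.k q w * φ z w)) - x⁻¹ * (s.k q z * (t.k q w)⁻¹ * φ z w)
    + (q - q⁻¹) ^ 2 * x * (s.f z * t.fm w * φ (z + 1) (w - 1)) := rfl
end apply

include hq hs ht

/-- The two operators come from opposite coproducts: in the mixed terms, moving `K` past `E`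
produces mutually inverse powers of `q` in the two factors. Consequently `affOp` preserves singular
vectors. -/
lemma raiseOp_affOp (φ : ℕ → ℕ → ℂ) (x : ℂ) :
    raiseOp q s t (affOp q s t x φ) = affOp q s t x (raiseOp q s t φ) := by
  ext z w
  have := hs.k_ne hq z
  have := ht.k_ne hq w
  simp only [raiseOp_apply, affOp_apply, k_succ, mul_inv_rev, inv_inv]
  field_simp
  ring

/-- Up to the factor `q`, `monA` fails to commute with `E` only through `affOp`. Thus, after
applying `E`, an intertwining relation for `monA` follows from the one for `affOp` and the one for
`monA` on the raised vector. -/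
lemma raiseOp_monA (φ : ℕ → ℕ → ℂ) (x : ℂ) :
    raiseOp q s t (monA q s t x φ) = q • monA q s t x (raiseOp q s t φ)
      + (q - q⁻¹) • weightOp q s t (affOp q s t x φ) := by
  ext z w
  have h1 := hs.k_ne hq z
  have h2 := ht.k_ne hq w
  have e1 := hs.f_sq z
  have e2 := hs.fm_sq hq z
  rcases z with _ | z
  · simp only [raiseOp_apply, affOp_apply, monA_apply, weightOp_apply, k_succ, mul_inv_rev, inv_inv,
      Pi.add_apply, Pi.smul_apply, smul_eq_mul, fm_succ, fm_zero, Nat.add_sub_cancel] at *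
    linear_combination (norm := (field_simp; ring))
      x⁻¹ * t.k q w * t.f w * φ 0 (w + 1) * (e1 - e2)
  · simp only [raiseOp_apply, affOp_apply, monA_apply, weightOp_apply,
      Pi.add_apply, Pi.smul_apply, smul_eq_mul, fm_succ, Nat.add_sub_cancel] at *
    simp only [k_succ s q (z + 1), k_succ t q w, mul_inv_rev, inv_inv]
    have h3 := hs.k_ne hq z
    have e3 := k_succ s q z
    linear_combination (norm := (simp only [e3]; field_simp; ring))
      x⁻¹ * t.k q w * t.f w * φ (z + 1) (w + 1) * (e1 - e2)

lemma raiseOp_monD (φ : ℕ → ℕ → ℂ) (x : ℂ) :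
    raiseOp q s t (monD q s t x φ) = q⁻¹ • monD q s t x (raiseOp q s t φ)
      - (q - q⁻¹) • weightInvOp q s t (affOp q s t x φ) := by
  ext z w
  have h1 := hs.k_ne hq z
  have h2 := ht.k_ne hq w
  have e1 := ht.f_sq w
  have e2 := ht.fm_sq hq w
  rcases w with _ | w
  · simp only [raiseOp_apply, affOp_apply, monD_apply, weightInvOp_apply, k_succ, mul_inv_rev,
      inv_inv, Pi.sub_apply, Pi.smul_apply, smul_eq_mul, fm_succ, fm_zero,
      Nat.add_sub_cancel] at *
    linear_combination (norm := (field_simp; ring))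
      x * (s.k q z)⁻¹ * s.f z * φ (z + 1) 0 * (e1 - e2)
  · simp only [raiseOp_apply, affOp_apply, monD_apply, weightInvOp_apply,
      Pi.sub_apply, Pi.smul_apply, smul_eq_mul, fm_succ,
      Nat.add_sub_cancel] at *
    simp only [k_succ t q (w + 1), k_succ s q z, mul_inv_rev, inv_inv]
    have h3 := ht.k_ne hq w
    have e3 := k_succ t q w
    linear_combination (norm := (simp only [e3]; field_simp; ring))
      x * (s.k q z)⁻¹ * s.f z * φ (z + 1) (w + 1) * (e1 - e2)

include hω

/-- Commuting `F` past the affine generator returns the diagonal operators. So `affOp`, `monA` and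
`monD` form a closed system, and intertwining relations for all three can be carried down a lowering
ladder together. -/
lemma lowerOp_affOp (φ : ℕ → ℕ → ℂ) (x : ℂ) :
    (q - q⁻¹) • affOp q s t x (lowerOp q s t φ) =
      (q - q⁻¹) • lowerOp q s t (affOp q s t x φ) - weightOp q s t (monA q s t x φ)
        + weightInvOp q s t (monD q s t x φ) := by
  ext z w
  have h1 := hs.k_ne hq z
  have h2 := ht.k_ne hq w
  have e1 := hs.f_sq_sub hq hω z
  have e2 := ht.f_sq_sub hq hω w
  rcases z with _ | z <;> rcases w with _ | w <;>
    simp only [lowerOp_apply, affOp_apply, monA_apply, monD_apply, weightInvOp_apply,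
      weightOp_apply, k_succ, mul_inv_rev, inv_inv, Pi.add_apply, Pi.sub_apply, Pi.smul_apply,
      smul_eq_mul, fm_succ, fm_zero, Nat.add_sub_cancel, zero_mul, mul_zero, zero_add, add_zero]
      at *
  · linear_combination (norm := (field_simp; ring)) φ 0 0 * (x * e1 + x⁻¹ * e2)
  · have h3 := ht.k_ne hq w
    linear_combination (norm := (field_simp; ring)) φ 0 (w + 1) * (x * e1 + x⁻¹ * e2)
  · have h4 := hs.k_ne hq z
    linear_combination (norm := (field_simp; ring)) φ (z + 1) 0 * (x * e1 + x⁻¹ * e2)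
  · have h3 := ht.k_ne hq w
    have h4 := hs.k_ne hq z
    linear_combination (norm := (field_simp; ring)) φ (z + 1) (w + 1) * (x * e1 + x⁻¹ * e2)

lemma raiseOp_lowerOp (φ : ℕ → ℕ → ℂ) :
    (q - q⁻¹) • raiseOp q s t (lowerOp q s t φ) =
      (q - q⁻¹) • lowerOp q s t (raiseOp q s t φ)
        + weightOp q s t (weightOp q s t φ) - weightInvOp q s t (weightInvOp q s t φ) := by
  ext z w
  have h1 := hs.k_ne hq z
  have h2 := ht.k_ne hq w
  have e1 := hs.f_sq_sub hq hω z
  have e2 := ht.f_sq_sub hq hω w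
  rcases z with _ | z <;> rcases w with _ | w <;>
    simp only [raiseOp_apply, lowerOp_apply, weightInvOp_apply,
      weightOp_apply, k_succ, mul_inv_rev, inv_inv, Pi.add_apply, Pi.sub_apply, Pi.smul_apply,
      smul_eq_mul, fm_succ, fm_zero, Nat.add_sub_cancel, zero_mul, mul_zero, zero_add, add_zero]
      at *
  · linear_combination (norm := (field_simp; ring)) φ 0 0 * (t.k q 0 ^ 2 * e1 + (s.k q 0)⁻¹ ^ 2 * e2)
  · have h3 := ht.k_ne hq w
    linear_combination (norm := (field_simp; ring))
      φ 0 (w + 1) * (q⁻¹ ^ 2 * t.k q w ^ 2 * e1 + (s.k q 0)⁻¹ ^ 2 * e2)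
  · have h4 := hs.k_ne hq z
    linear_combination (norm := (field_simp; ring))
      φ (z + 1) 0 * (t.k q 0 ^ 2 * e1 + q ^ 2 * (s.k q z)⁻¹ ^ 2 * e2)
  · have h3 := ht.k_ne hq w
    have h4 := hs.k_ne hq z
    linear_combination (norm := (field_simp; ring))
      φ (z + 1) (w + 1) * (q⁻¹ ^ 2 * t.k q w ^ 2 * e1 + q ^ 2 * (s.k q z)⁻¹ ^ 2 * e2)

end ColoredIRF

/-! ### Bilinear pairing, singular vectors, and bases adapted to the decomposition. -/

namespace ColoredIRF
open Site

/-- The bilinear pairing of the components of level `l`. -/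
noncomputable def pair (l : ℕ) (φ χ : ℕ → ℕ → ℂ) : ℂ :=
  ∑ p ∈ antidiagonal l, φ p.1 p.2 * χ p.1 p.2

lemma pair_comm (l : ℕ) (φ χ : ℕ → ℕ → ℂ) : pair l φ χ = pair l χ φ := by
  simp only [pair, mul_comm]

lemma pair_add_right (l : ℕ) (φ χ χ' : ℕ → ℕ → ℂ) :
    pair l φ (χ + χ') = pair l φ χ + pair l φ χ' := by
  simp only [pair, Pi.add_apply, mul_add, sum_add_distrib]

lemma pair_smul_right (l : ℕ) (φ χ : ℕ → ℕ → ℂ) (c : ℂ) :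
    pair l φ (c • χ) = c * pair l φ χ := by
  simp only [pair, Pi.smul_apply, smul_eq_mul, mul_sum]
  exact sum_congr rfl fun _ _ => by ring

lemma pair_sub_right (l : ℕ) (φ χ χ' : ℕ → ℕ → ℂ) :
    pair l φ (χ - χ') = pair l φ χ - pair l φ χ' := by
  simp only [pair, Pi.sub_apply, mul_sub, sum_sub_distrib]

lemma pair_zero_right (l : ℕ) (φ : ℕ → ℕ → ℂ) : pair l φ 0 = 0 := by simp [pair]

lemma pair_smul_left (l : ℕ) (φ χ : ℕ → ℕ → ℂ) (c : ℂ) :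
    pair l (c • φ) χ = c * pair l φ χ := by
  rw [pair_comm, pair_smul_right, pair_comm]

lemma pair_zero_left (l : ℕ) (φ : ℕ → ℕ → ℂ) : pair l 0 φ = 0 := by simp [pair]

lemma pair_congr {l : ℕ} {φ φ' χ χ' : ℕ → ℕ → ℂ} (h : ∀ z w, z + w = l → φ z w = φ' z w)
    (h' : ∀ z w, z + w = l → χ z w = χ' z w) : pair l φ χ = pair l φ' χ' :=
  sum_congr rfl fun p hp => by
    rw [h _ _ (HasAntidiagonal.mem_antidiagonal.mp hp), h' _ _ (HasAntidiagonal.mem_antidiagonal.mp hp)]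

lemma pair_sum_right {ι : Type*} (l : ℕ) (φ : ℕ → ℕ → ℂ) (A : Finset ι) (χ : ι → ℕ → ℕ → ℂ) :
    pair l φ (∑ i ∈ A, χ i) = ∑ i ∈ A, pair l φ (χ i) := by
  simp only [pair, Finset.sum_apply, mul_sum]
  exact sum_comm

variable {q : ℂ} {s t : Site}

/-- `E` and `F` have the same matrix elements `f z`, so they are transposes of each other; the index
shift has no boundary term because `fm 0 = 0`. -/
lemma pair_raise (l : ℕ) (φ χ : ℕ → ℕ → ℂ) :
    pair l (raiseOp q s t φ) χ = pair (l + 1) φ (lowerOp q s t χ) := by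
  simp only [pair, raiseOp_apply, lowerOp_apply, add_mul, mul_add, sum_add_distrib]
  congr 1
  · rw [Nat.sum_antidiagonal_succ]
    simp only [fm_zero, zero_mul, mul_zero, zero_add, fm_succ, Nat.add_sub_cancel]
    exact sum_congr rfl fun _ _ => by ring
  · rw [Nat.sum_antidiagonal_succ']
    simp only [fm_zero, zero_mul, mul_zero, zero_add, fm_succ, Nat.add_sub_cancel]
    exact sum_congr rfl fun _ _ => by ring

/-- Transposition exchanges `F ⊗ E` with `E ⊗ F`, which sit in `monA` and `monD` with inverse powers
of the parameter. -/
lemma pair_monA (l : ℕ) (φ χ : ℕ → ℕ → ℂ) (x : ℂ) :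
    pair l (monA q s t x φ) χ = pair l φ (monD q s t x⁻¹ χ) := by
  have key : ∑ p ∈ antidiagonal l, s.fm p.1 * t.f p.2 * φ (p.1 - 1) (p.2 + 1) * χ p.1 p.2 =
      ∑ p ∈ antidiagonal l, s.f p.1 * t.fm p.2 * φ p.1 p.2 * χ (p.1 + 1) (p.2 - 1) := by
    cases l with
    | zero => simp
    | succ l =>
      rw [Nat.sum_antidiagonal_succ, Nat.sum_antidiagonal_succ']
      simp only [fm_zero, zero_mul, mul_zero, zero_add, fm_succ, Nat.add_sub_cancel]
  have e : pair l (monA q s t x φ) χ = ∑ p ∈ antidiagonal l,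
      ((-(x * (s.k q p.1 * (t.k q p.2)⁻¹)) - x⁻¹ * ((s.k q p.1)⁻¹ * t.k q p.2))
        * φ p.1 p.2 * χ p.1 p.2) + (q - q⁻¹) ^ 2 * x⁻¹ *
      ∑ p ∈ antidiagonal l, s.fm p.1 * t.f p.2 * φ (p.1 - 1) (p.2 + 1) * χ p.1 p.2 := by
    rw [mul_sum, ← sum_add_distrib]
    exact sum_congr rfl fun _ _ => by rw [monA_apply]; ring
  rw [e, key, mul_sum, ← sum_add_distrib]
  exact sum_congr rfl fun _ _ => by rw [monD_apply, inv_inv]; ring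

lemma pair_monD (l : ℕ) (φ χ : ℕ → ℕ → ℂ) (x : ℂ) :
    pair l (monD q s t x φ) χ = pair l φ (monA q s t x⁻¹ χ) := by
  rw [pair_comm, pair_comm l φ, pair_monA, inv_inv]

/-- Functions supported on the basis of the tensor product of `s` and `t`. -/
def Supp (s t : Site) (φ : ℕ → ℕ → ℂ) : Prop :=
  ∀ z w : ℕ, φ z w ≠ 0 → (z : ℕ∞) < s.d ∧ (w : ℕ∞) < t.d

namespace Supp
variable {φ χ : ℕ → ℕ → ℂ}

lemma zero : Supp s t 0 := fun _ _ h => absurd rfl h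

lemma add (h : Supp s t φ) (h' : Supp s t χ) : Supp s t (φ + χ) := fun z w hz => by
  by_cases h0 : φ z w = 0
  · exact h' z w fun h1 => hz (by simp [h0, h1])
  · exact h z w h0

lemma smul (h : Supp s t φ) (c : ℂ) : Supp s t (c • φ) := fun z w hz =>
  h z w fun h1 => hz (by simp [h1])

lemma sub (h : Supp s t φ) (h' : Supp s t χ) : Supp s t (φ - χ) := by
  have := h.add (h'.smul (-1))
  simpa [sub_eq_add_neg] using this

lemma sum {ι : Type*} (A : Finset ι) {φ : ι → ℕ → ℕ → ℂ} (h : ∀ i ∈ A, Supp s t (φ i)) :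
    Supp s t (∑ i ∈ A, φ i) :=
  Finset.sum_induction _ _ (fun _ _ => Supp.add) Supp.zero h

end Supp

lemma Site.IsRep.lt_of_f_ne (hs : s.IsRep q) {z : ℕ} (h : (z : ℕ∞) < s.d) (hf : s.f z ≠ 0) :
    ((z + 1 : ℕ) : ℕ∞) < s.d :=
  lt_of_le_of_ne (by push_cast; exact Order.add_one_le_of_lt h) fun h' => hf (hs.f_top z h')

lemma Site.IsRep.lt_of_fm_ne (hs : s.IsRep q) {z : ℕ} (h : ((z - 1 : ℕ) : ℕ∞) < s.d)
    (hf : s.fm z ≠ 0) : (z : ℕ∞) < s.d := by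
  cases z with
  | zero => simp at hf
  | succ z => exact hs.lt_of_f_ne h hf

lemma lt_of_succ_lt {z : ℕ} {d : ℕ∞} (h : ((z + 1 : ℕ) : ℕ∞) < d) : (z : ℕ∞) < d :=
  lt_of_le_of_lt (by exact_mod_cast z.le_succ) h

lemma supp_raise {φ : ℕ → ℕ → ℂ} (h : Supp s t φ) : Supp s t (raiseOp q s t φ) := by
  intro z w hz
  rw [raiseOp_apply] at hz
  by_cases h0 : φ (z + 1) w = 0
  · have h1 : φ z (w + 1) ≠ 0 := fun h1 => hz (by simp [h0, h1])
    exact ⟨(h _ _ h1).1, lt_of_succ_lt (h _ _ h1).2⟩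
  · exact ⟨lt_of_succ_lt (h _ _ h0).1, (h _ _ h0).2⟩

lemma supp_aff {φ : ℕ → ℕ → ℂ} (h : Supp s t φ) (x : ℂ) : Supp s t (affOp q s t x φ) := by
  intro z w hz
  rw [affOp_apply] at hz
  by_cases h0 : φ (z + 1) w = 0
  · have h1 : φ z (w + 1) ≠ 0 := fun h1 => hz (by simp [h0, h1])
    exact ⟨(h _ _ h1).1, lt_of_succ_lt (h _ _ h1).2⟩
  · exact ⟨lt_of_succ_lt (h _ _ h0).1, (h _ _ h0).2⟩

lemma supp_lower (hs : s.IsRep q) (ht : t.IsRep q) {φ : ℕ → ℕ → ℂ} (h : Supp s t φ) :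
    Supp s t (lowerOp q s t φ) := by
  intro z w hz
  rw [lowerOp_apply] at hz
  by_cases h0 : s.fm z * φ (z - 1) w = 0
  · have h1 : t.fm w * φ z (w - 1) ≠ 0 := fun h1 =>
      hz (by linear_combination t.k q w * h0 + (s.k q z)⁻¹ * h1)
    have h2 := h _ _ (right_ne_zero_of_mul h1)
    exact ⟨h2.1, ht.lt_of_fm_ne h2.2 (left_ne_zero_of_mul h1)⟩
  · have h2 := h _ _ (right_ne_zero_of_mul h0)
    exact ⟨hs.lt_of_fm_ne h2.1 (left_ne_zero_of_mul h0), h2.2⟩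

lemma supp_monA (hs : s.IsRep q) {φ : ℕ → ℕ → ℂ} (h : Supp s t φ) (x : ℂ) :
    Supp s t (monA q s t x φ) := by
  intro z w hz
  rw [monA_apply] at hz
  by_cases h0 : φ z w = 0
  · have h1 : s.fm z * φ (z - 1) (w + 1) ≠ 0 := fun h1 =>
      hz (by rw [h0]; linear_combination (q - q⁻¹) ^ 2 * x⁻¹ * t.f w * h1)
    have h2 := h _ _ (right_ne_zero_of_mul h1)
    exact ⟨hs.lt_of_fm_ne h2.1 (left_ne_zero_of_mul h1), lt_of_succ_lt h2.2⟩
  · exact h _ _ h0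

lemma supp_monD (ht : t.IsRep q) {φ : ℕ → ℕ → ℂ} (h : Supp s t φ) (x : ℂ) :
    Supp s t (monD q s t x φ) := by
  intro z w hz
  rw [monD_apply] at hz
  by_cases h0 : φ z w = 0
  · have h1 : t.fm w * φ (z + 1) (w - 1) ≠ 0 := fun h1 =>
      hz (by rw [h0]; linear_combination (q - q⁻¹) ^ 2 * x * s.f z * h1)
    have h2 := h _ _ (right_ne_zero_of_mul h1)
    exact ⟨lt_of_succ_lt h2.1, ht.lt_of_fm_ne h2.2 (left_ne_zero_of_mul h1)⟩
  · exact h _ _ h0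

section singular
variable (hq : q ≠ 0) (hs : s.IsRep q) (ht : t.IsRep q) {φ : ℕ → ℕ → ℂ} (hφ : Supp s t φ) {m : ℕ}
  (hE : ∀ z w, z + w + 1 = m → raiseOp q s t φ z w = 0)
include hq hs ht hφ hE

/-- The equation `E φ = 0` at `(z, w)` determines `φ (z + 1) w` from `φ z (w + 1)`, with a nonzero
coefficient inside the support. A singular vector is therefore determined by its entry at `(0, m)`,
and symmetrically by the one at `(m, 0)`. -/
lemma singular_eq_zero_of_left (h0 : φ 0 m = 0) : ∀ z w, z + w = m → φ z w = 0 := by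
  intro z
  induction z with
  | zero => intro w hw; rw [← h0, ← hw, zero_add]
  | succ z ih =>
    intro w hw
    by_contra hne
    have h1 := hE z w (by omega)
    rw [raiseOp_apply, ih (w + 1) (by omega), mul_zero, add_zero] at h1
    exact mul_ne_zero (mul_ne_zero (hs.f_ne _ (hφ _ _ hne).1) (ht.k_ne hq _)) hne h1

lemma singular_eq_zero_of_right (h0 : φ m 0 = 0) : ∀ w z, z + w = m → φ z w = 0 := by
  intro w
  induction w with
  | zero => intro z hz; rw [← h0, ← hz, add_zero]
  | succ w ih =>
    intro z hz
    by_contra hne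
    have h1 := hE z w (by omega)
    rw [raiseOp_apply, ih (z + 1) (by omega), mul_zero, zero_add] at h1
    exact mul_ne_zero (mul_ne_zero (inv_ne_zero (hs.k_ne hq _)) (ht.f_ne _ (hφ _ _ hne).2)) hne h1

/-- One of the corner entries `(0, m)` and `(m, 0)` lies outside the support, and the vanishing
propagates from there. -/
lemma singular_eq_zero_of_le (hm : ¬((m : ℕ∞) < s.d ∧ (m : ℕ∞) < t.d)) :
    ∀ z w, z + w = m → φ z w = 0 := by
  by_cases h1 : (m : ℕ∞) < s.d
  · refine singular_eq_zero_of_left hq hs ht hφ hE ?_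
    by_contra hne
    exact hm ⟨h1, (hφ _ _ hne).2⟩
  · intro z w hzw
    refine singular_eq_zero_of_right hq hs ht hφ hE ?_ w z hzw
    by_contra hne
    exact h1 (hφ _ _ hne).1

end singular

/-- A basis of the tensor product of `s` and `t` adapted to its decomposition into the
representations `c n`, `n < min s.d t.d`. -/
structure CGBasis (q : ℂ) (s t : Site) where
  c : ℕ → Site
  ψ : ℕ → ℕ → ℕ → ℕ → ℂ
  rep : ∀ n : ℕ, (n : ℕ∞) < s.d → (n : ℕ∞) < t.d → (c n).IsRep q
  k0 : ∀ n : ℕ, (n : ℕ∞) < s.d → (n : ℕ∞) < t.d → (c n).k0 = s.k0 * t.k0 * q⁻¹ ^ n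
  dim_le : ∀ n k : ℕ, (n : ℕ∞) < s.d → (n : ℕ∞) < t.d → ((k + 1 : ℕ) : ℕ∞) = (c n).d →
    ¬(((n + (k + 1) : ℕ) : ℕ∞) < s.d ∧ ((n + (k + 1) : ℕ) : ℕ∞) < t.d)
  level : ∀ n k z w, ψ n k z w ≠ 0 → z + w = n + k
  supp : ∀ n k, Supp s t (ψ n k)
  valid : ∀ n k z w, ψ n k z w ≠ 0 → (n : ℕ∞) < s.d ∧ (n : ℕ∞) < t.d ∧ (k : ℕ∞) < (c n).d
  raise_zero : ∀ n, raiseOp q s t (ψ n 0) = 0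
  lower_aux : ∀ n k : ℕ, (n : ℕ∞) < s.d → (n : ℕ∞) < t.d → ((k + 1 : ℕ) : ℕ∞) < (c n).d →
    lowerOp q s t (ψ n k) = (c n).f k • ψ n (k + 1)
  norm : ∀ n : ℕ, (n : ℕ∞) < s.d → (n : ℕ∞) < t.d → pair n (ψ n 0) (ψ n 0) = 1

namespace CGBasis
variable (B : CGBasis q s t)

/-- The condition that the channel `n` occurs. -/
def Ok (_ : CGBasis q s t) (n : ℕ) : Prop := (n : ℕ∞) < s.d ∧ (n : ℕ∞) < t.d

lemma ψ_eq_zero {n k : ℕ} (h : ¬(B.Ok n ∧ (k : ℕ∞) < (B.c n).d)) : B.ψ n k = 0 := by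
  ext z w
  by_contra hne
  have := B.valid n k z w hne
  exact h ⟨⟨this.1, this.2.1⟩, this.2.2⟩

lemma ψ_eq_zero_of_not_ok {n : ℕ} (h : ¬B.Ok n) (k : ℕ) : B.ψ n k = 0 :=
  B.ψ_eq_zero fun h' => h h'.1

lemma ψ_apply_eq_zero {n k z w : ℕ} (h : z + w ≠ n + k) : B.ψ n k z w = 0 := by
  by_contra hne
  exact h (B.level n k z w hne)

lemma k_mul (n k z w : ℕ) (hn : B.Ok n) (h : z + w = n + k) :
    s.k q z * t.k q w = (B.c n).k q k := by
  simp only [Site.k]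
  rw [B.k0 n hn.1 hn.2]
  have : q⁻¹ ^ z * q⁻¹ ^ w = q⁻¹ ^ n * q⁻¹ ^ k := by rw [← pow_add, ← pow_add, h]
  linear_combination s.k0 * t.k0 * this

lemma weight_ψ (n k : ℕ) (hn : B.Ok n) :
    weightOp q s t (B.ψ n k) = (B.c n).k q k • B.ψ n k := by
  ext z w
  rw [weightOp_apply, Pi.smul_apply, Pi.smul_apply, smul_eq_mul]
  by_cases h : z + w = n + k
  · rw [B.k_mul n k z w hn h]
  · simp [B.ψ_apply_eq_zero h]

lemma weightInv_ψ (n k : ℕ) (hn : B.Ok n) :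
    weightInvOp q s t (B.ψ n k) = ((B.c n).k q k)⁻¹ • B.ψ n k := by
  ext z w
  rw [weightInvOp_apply, Pi.smul_apply, Pi.smul_apply, smul_eq_mul]
  by_cases h : z + w = n + k
  · rw [← B.k_mul n k z w hn h, mul_inv]
  · simp [B.ψ_apply_eq_zero h]

variable (hq : q ≠ 0) (hω : q - q⁻¹ ≠ 0) (hs : s.IsRep q) (ht : t.IsRep q)
include hq hω hs ht

/-- Ladder step: the commutator of `E` and `F` converts the eigenvalue of `F E` on `ψ n k` into that
of `E F`. -/
lemma raise_lower_aux (n k : ℕ) (hn : B.Ok n)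
    (h : lowerOp q s t (raiseOp q s t (B.ψ n k)) = (B.c n).fm k ^ 2 • B.ψ n k) :
    raiseOp q s t (lowerOp q s t (B.ψ n k)) = (B.c n).f k ^ 2 • B.ψ n k := by
  have e := raiseOp_lowerOp hq hω hs ht (B.ψ n k)
  have hk := (B.rep n hn.1 hn.2).f_sq_sub hq hω k
  have h2 : (q - q⁻¹) • raiseOp q s t (lowerOp q s t (B.ψ n k)) =
      (q - q⁻¹) • ((B.c n).f k ^ 2 • B.ψ n k) := by
    rw [e, h, B.weight_ψ n k hn, map_smul, B.weight_ψ n k hn, B.weightInv_ψ n k hn, map_smul,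
      B.weightInv_ψ n k hn, smul_smul, smul_smul, smul_smul, smul_smul, ← add_smul, ← sub_smul]
    congr 1
    linear_combination -hk
  exact smul_right_injective _ hω h2

/-- A `CGBasis` prescribes `F` only. The action of `E` is forced: starting from the singular vector,
`E F` acts on `ψ n k` by `f k ^ 2`, and one factor `f k` cancels. -/
lemma raise_succ_aux (n k : ℕ) (hn : B.Ok n) (hk : ((k + 1 : ℕ) : ℕ∞) < (B.c n).d) :
    raiseOp q s t (B.ψ n (k + 1)) = (B.c n).f k • B.ψ n k := by
  have hr := B.rep n hn.1 hn.2
  have hf := hr.f_ne k hk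
  have step : lowerOp q s t (raiseOp q s t (B.ψ n k)) = (B.c n).fm k ^ 2 • B.ψ n k →
      raiseOp q s t (B.ψ n (k + 1)) = (B.c n).f k • B.ψ n k := fun h => by
    have h1 := B.raise_lower_aux hq hω hs ht n k hn h
    rw [B.lower_aux n k hn.1 hn.2 hk, map_smul, pow_two, mul_smul] at h1
    exact smul_right_injective _ hf h1
  induction k with
  | zero => exact step (by rw [B.raise_zero]; simp)
  | succ k ih =>
    apply step
    have hk' := lt_of_succ_lt hk
    have hf' := hr.f_ne k hk'
    rw [ih hk' hf' fun h => by
      have h1 := B.raise_lower_aux hq hω hs ht n k hn h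
      rw [B.lower_aux n k hn.1 hn.2 hk', map_smul, pow_two, mul_smul] at h1
      exact smul_right_injective _ hf' h1, map_smul, B.lower_aux n k hn.1 hn.2 hk', smul_smul,
      fm_succ, pow_two]

lemma raise_succ (n k : ℕ) (hn : B.Ok n) :
    raiseOp q s t (B.ψ n (k + 1)) = (B.c n).f k • B.ψ n k := by
  by_cases hk : ((k + 1 : ℕ) : ℕ∞) < (B.c n).d
  · exact B.raise_succ_aux hq hω hs ht n k hn hk
  · rw [B.ψ_eq_zero fun h => hk h.2, map_zero]
    by_cases hk' : (k : ℕ∞) < (B.c n).d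
    · by_cases h0 : (B.c n).f k = 0
      · rw [h0, zero_smul]
      · exact absurd ((B.rep n hn.1 hn.2).lt_of_f_ne hk' h0) hk
    · rw [B.ψ_eq_zero fun h => hk' h.2, smul_zero]

lemma raise_ψ (n k : ℕ) (hn : B.Ok n) :
    raiseOp q s t (B.ψ n k) = (B.c n).fm k • B.ψ n (k - 1) := by
  cases k with
  | zero => rw [B.raise_zero]; simp
  | succ k => exact B.raise_succ hq hω hs ht n k hn

/-- Below the top of a channel this is `lower_aux`. At the top, `F ψ` is again singular because `f`
vanishes there, and `dim_le` leaves no room for a singular vector in that level. -/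
lemma lower_ψ (n k : ℕ) (hn : B.Ok n) :
    lowerOp q s t (B.ψ n k) = (B.c n).f k • B.ψ n (k + 1) := by
  by_cases hk : ((k + 1 : ℕ) : ℕ∞) < (B.c n).d
  · exact B.lower_aux n k hn.1 hn.2 hk
  rw [B.ψ_eq_zero fun h => hk h.2, smul_zero]
  by_cases hk' : (k : ℕ∞) < (B.c n).d
  swap
  · rw [B.ψ_eq_zero fun h => hk' h.2, map_zero]
  have hd : ((k + 1 : ℕ) : ℕ∞) = (B.c n).d :=
    le_antisymm (by push_cast; exact Order.add_one_le_of_lt hk') (not_lt.mp hk)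
  have hr := B.rep n hn.1 hn.2
  have h0 : raiseOp q s t (lowerOp q s t (B.ψ n k)) = 0 := by
    rw [B.raise_lower_aux hq hω hs ht n k hn, hr.f_top k hd, zero_pow two_ne_zero, zero_smul]
    cases k with
    | zero => rw [B.raise_zero]; simp
    | succ k =>
      rw [B.raise_succ hq hω hs ht n k hn, map_smul, B.lower_aux n k hn.1 hn.2 hk', smul_smul,
        fm_succ, pow_two]
  ext z w
  by_cases hl : z + w = n + (k + 1)
  · exact singular_eq_zero_of_le hq hs ht (supp_lower hs ht (B.supp n k))
      (fun z w _ => by rw [h0]; rfl) (B.dim_le n k hn.1 hn.2 hd) z w hl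
  · rw [lowerOp_apply]
    have h1 : s.fm z * B.ψ n k (z - 1) w = 0 := by
      cases z with
      | zero => simp
      | succ z => rw [Nat.add_sub_cancel, B.ψ_apply_eq_zero (by omega), mul_zero]
    have h2 : t.fm w * B.ψ n k z (w - 1) = 0 := by
      cases w with
      | zero => simp
      | succ w => rw [Nat.add_sub_cancel, B.ψ_apply_eq_zero (by omega), mul_zero]
    simp only [Pi.zero_apply]
    linear_combination t.k q w * h1 + (s.k q z)⁻¹ * h2

/-- `F` on one side is moved to `E` on the other until a singular vector is reached, which `E`
annihilates. If both vectors arrive there together, the level forces equal channels and `norm`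
applies. -/
lemma orth {n k n' k' : ℕ} (hn : B.Ok n) (hk : (k : ℕ∞) < (B.c n).d) (hn' : B.Ok n')
    (hk' : (k' : ℕ∞) < (B.c n').d) (h : n + k = n' + k') :
    pair (n + k) (B.ψ n k) (B.ψ n' k') = if n = n' then 1 else 0 := by
  induction k generalizing k' with
  | zero =>
    cases k' with
    | zero =>
      obtain rfl : n = n' := by simpa using h
      rw [if_pos rfl]
      exact B.norm n hn.1 hn.2
    | succ k' =>
      have hf := (B.rep n' hn'.1 hn'.2).f_ne k' hk'
      rw [if_neg (by omega)]
      apply mul_left_cancel₀ hf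
      rw [mul_zero, ← pair_smul_right, ← B.lower_ψ hq hω hs ht n' k' hn', h, ← add_assoc,
        ← pair_raise, B.raise_zero, pair_zero_left]
  | succ k ih =>
    have hf := (B.rep n hn.1 hn.2).f_ne k hk
    apply mul_left_cancel₀ hf
    rw [← pair_smul_left, ← B.lower_ψ hq hω hs ht n k hn, pair_comm, ← add_assoc, ← pair_raise,
      B.raise_ψ hq hω hs ht n' k' hn', pair_smul_left, pair_comm]
    cases k' with
    | zero => simp only [fm_zero, zero_mul]; rw [if_neg (by omega), mul_zero]
    | succ k' =>
      rw [Nat.add_sub_cancel, ih (lt_of_succ_lt hk) (lt_of_succ_lt hk') (by omega), fm_succ]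
      split_ifs with h0
      · subst h0
        obtain rfl : k = k' := by omega
        rfl
      · simp

/-- Singular vectors of level `m` form at most a line. The pairing is only bilinear, so isotropic
vectors are not excluded a priori; it is `norm` that turns orthogonality to `ψ m 0` into vanishing.
-/
lemma singular_eq_zero {φ : ℕ → ℕ → ℂ} (hφ : Supp s t φ) {m : ℕ}
    (hE : ∀ z w, z + w + 1 = m → raiseOp q s t φ z w = 0) (h0 : pair m (B.ψ m 0) φ = 0) :
    ∀ z w, z + w = m → φ z w = 0 := by
  by_cases hm : (m : ℕ∞) < s.d ∧ (m : ℕ∞) < t.d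
  swap
  · exact singular_eq_zero_of_le hq hs ht hφ hE hm
  -- Singular and zero at `(0, m)` by construction, hence zero in level `m`; pairing it with `ψ m 0`
  -- then gives `φ 0 m = 0`.
  set χ : ℕ → ℕ → ℂ := B.ψ m 0 0 m • φ - φ 0 m • B.ψ m 0 with hχ
  have h1 : ∀ z w, z + w = m → χ z w = 0 := by
    refine singular_eq_zero_of_left hq hs ht ((hφ.smul _).sub ((B.supp m 0).smul _))
      (fun z w h => ?_) ?_
    · rw [map_sub, map_smul, map_smul, B.raise_zero, smul_zero, sub_zero, Pi.smul_apply,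
        Pi.smul_apply, hE z w h, smul_zero]
    · simp only [Pi.sub_apply, Pi.smul_apply, smul_eq_mul]; ring
  have h2 : pair m (B.ψ m 0) χ = 0 := by
    rw [pair_congr (fun _ _ _ => rfl) (χ' := 0) (fun z w h => by rw [h1 z w h]; rfl),
      pair_zero_right]
  rw [hχ, pair_sub_right, pair_smul_right, pair_smul_right, h0, B.norm m hm.1 hm.2] at h2
  exact singular_eq_zero_of_left hq hs ht hφ hE (by linear_combination -h2)

/-- Induction on the level: `E φ` is orthogonal to the whole basis of the previous level, since `F`
maps that basis into the present one. So `φ` is singular, and its pairing with the singular basis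
vector decides. -/
lemma eq_zero_of_pair {φ : ℕ → ℕ → ℂ} (hφ : Supp s t φ) {l : ℕ}
    (h : ∀ p ∈ antidiagonal l, pair l (B.ψ p.1 p.2) φ = 0) : ∀ z w, z + w = l → φ z w = 0 := by
  induction l generalizing φ with
  | zero =>
    exact B.singular_eq_zero hq hω hs ht hφ (fun z w h => by omega) (h (0, 0) (by simp))
  | succ l ih =>
    refine B.singular_eq_zero hq hω hs ht hφ (fun z w hzw => ?_) (h (l + 1, 0) (by simp))
    refine ih (supp_raise hφ) (fun p hp => ?_) z w (by omega)
    rw [pair_comm, pair_raise]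
    rw [HasAntidiagonal.mem_antidiagonal] at hp
    by_cases hn : B.Ok p.1
    · rw [B.lower_ψ hq hω hs ht p.1 p.2 hn, pair_smul_right, pair_comm,
        h (p.1, p.2 + 1) (by simp only [HasAntidiagonal.mem_antidiagonal]; omega), mul_zero]
    · rw [B.ψ_eq_zero_of_not_ok hn, map_zero, pair_zero_right]

/-- The orthonormality relations in all cases. -/
lemma pair_ψ {n k n' k' : ℕ} (h : n + k = n' + k') (hn : B.Ok n) (hk : (k : ℕ∞) < (B.c n).d) :
    pair (n + k) (B.ψ n k) (B.ψ n' k') = if n = n' then 1 else 0 := by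
  by_cases h' : B.Ok n' ∧ (k' : ℕ∞) < (B.c n').d
  · exact B.orth hq hω hs ht hn hk h'.1 h'.2 h
  · rw [B.ψ_eq_zero h', pair_zero_right, if_neg]
    rintro rfl
    obtain rfl : k = k' := by omega
    exact h' ⟨hn, hk⟩

/-- The completeness relation. -/
lemma expand {φ : ℕ → ℕ → ℂ} (hφ : Supp s t φ) (l z w : ℕ) (h : z + w = l) :
    φ z w = ∑ p ∈ antidiagonal l, pair l (B.ψ p.1 p.2) φ * B.ψ p.1 p.2 z w := by
  have key := B.eq_zero_of_pair hq hω hs ht (l := l)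
    (φ := φ - ∑ p ∈ antidiagonal l, pair l (B.ψ p.1 p.2) φ • B.ψ p.1 p.2)
    (hφ.sub (Supp.sum _ fun p _ => (B.supp _ _).smul _)) (fun p hp => ?_) z w h
  · simp only [Pi.sub_apply, Finset.sum_apply, Pi.smul_apply, smul_eq_mul] at key
    exact sub_eq_zero.mp key
  · rw [pair_sub_right, pair_sum_right]
    simp only [pair_smul_right]
    by_cases hv : B.Ok p.1 ∧ (p.2 : ℕ∞) < (B.c p.1).d
    · rw [HasAntidiagonal.mem_antidiagonal] at hp
      rw [Finset.sum_eq_single p]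
      · subst hp
        rw [B.pair_ψ hq hω hs ht rfl hv.1 hv.2, if_pos rfl, mul_one, sub_self]
      · intro p' hp' hne
        rw [HasAntidiagonal.mem_antidiagonal] at hp'
        subst hp
        rw [B.pair_ψ hq hω hs ht hp'.symm hv.1 hv.2, if_neg, mul_zero]
        intro h1
        exact hne (Prod.ext h1.symm (by omega))
      · intro h0; exact absurd (HasAntidiagonal.mem_antidiagonal.mpr hp) h0
    · rw [B.ψ_eq_zero hv]
      simp [pair]

end CGBasis

end ColoredIRF

/-! ### The R-matrix as an intertwiner of the affine generator and of the diagonal operators. -/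

namespace ColoredIRF
open Site

variable {q : ℂ} {s t : Site}

namespace CGBasis

/-- The matrix element of `E ⊗ K⁻¹` between consecutive singular vectors. -/
noncomputable def α (B : CGBasis q s t) (n : ℕ) : ℂ :=
  ∑ p ∈ antidiagonal n, B.ψ n 0 p.1 p.2 * (s.f p.1 * (t.k q p.2)⁻¹ * B.ψ (n + 1) 0 (p.1 + 1) p.2)

/-- The expectation value of `K² ⊗ 1` in a singular vector. -/
noncomputable def mom (B : CGBasis q s t) (n : ℕ) : ℂ :=
  ∑ p ∈ antidiagonal n, s.k q p.1 ^ 2 * B.ψ n 0 p.1 p.2 ^ 2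

lemma ok_of_succ {B : CGBasis q s t} {n : ℕ} (h : B.Ok (n + 1)) : B.Ok n :=
  ⟨lt_of_succ_lt h.1, lt_of_succ_lt h.2⟩

section single
variable (B : CGBasis q s t)
  (hq : q ≠ 0) (hω : q - q⁻¹ ≠ 0) (hs : s.IsRep q) (ht : t.IsRep q)

lemma k0_succ {n : ℕ} (h : B.Ok (n + 1)) : (B.c (n + 1)).k0 = q⁻¹ * (B.c n).k0 := by
  rw [B.k0 _ h.1 h.2, B.k0 _ (ok_of_succ h).1 (ok_of_succ h).2, pow_succ]; ring

lemma k_zero (n : ℕ) : (B.c n).k q 0 = (B.c n).k0 := by simp [Site.k]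

include hq hω hs ht

/-- `E ψ = 0` trades the second term of `affOp` for the first. The factor `(K ⊗ K) ^ 2` is constant
on a level, so on singular vectors `affOp` is a scalar times `E ⊗ K⁻¹`. -/
lemma swap_ψ {n z w : ℕ} :
    s.k q z * t.f w * B.ψ n 0 z (w + 1) =
      -((s.k q z * t.k q w) ^ 2 * (s.f z * (t.k q w)⁻¹ * B.ψ n 0 (z + 1) w)) := by
  have h := congrFun (congrFun (B.raise_zero n) z) w
  rw [raiseOp_apply] at h
  have h1 := hs.k_ne hq z
  have h2 := ht.k_ne hq w
  simp only [Pi.zero_apply] at h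
  have h' : t.f w * B.ψ n 0 z (w + 1) = -(s.k q z * t.k q w * s.f z * B.ψ n 0 (z + 1) w) := by
    linear_combination (norm := (field_simp; ring)) s.k q z * h
  linear_combination (norm := (field_simp; ring)) s.k q z * h'

lemma aff_ψ_zero (x : ℂ) : affOp q s t x (B.ψ 0 0) = 0 := by
  ext z w
  rw [affOp_apply, B.ψ_apply_eq_zero (by omega), B.ψ_apply_eq_zero (by omega)]
  simp

/-- The image is singular because `affOp` commutes with `E`, hence a multiple of `ψ n 0`; the
pairing with `ψ n 0` identifies the multiple. The dependence on `x` is confined to an explicit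
factor. -/
lemma aff_ψ {n : ℕ} (h : B.Ok (n + 1)) (x : ℂ) : affOp q s t x (B.ψ (n + 1) 0) =
    ((x - x⁻¹ * (B.c n).k0 ^ 2) * B.α n) • B.ψ n 0 := by
  have hp : ∀ z w, z + w = n → affOp q s t x (B.ψ (n + 1) 0) z w = (x - x⁻¹ * (B.c n).k0 ^ 2) *
      (s.f z * (t.k q w)⁻¹ * B.ψ (n + 1) 0 (z + 1) w) := fun z w hzw => by
    rw [affOp_apply, B.swap_ψ hq hω hs ht, B.k_mul n 0 z w (ok_of_succ h) (by simpa using hzw),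
      B.k_zero]
    ring
  have hpair : pair n (B.ψ n 0) (affOp q s t x (B.ψ (n + 1) 0)) =
      (x - x⁻¹ * (B.c n).k0 ^ 2) * B.α n := by
    rw [α, mul_sum]
    refine sum_congr rfl fun p hp' => ?_
    rw [hp _ _ (HasAntidiagonal.mem_antidiagonal.mp hp')]
    ring
  have hn := ok_of_succ h
  ext z w
  by_cases hzw : z + w = n
  · have := B.singular_eq_zero hq hω hs ht
      (φ := affOp q s t x (B.ψ (n + 1) 0) - ((x - x⁻¹ * (B.c n).k0 ^ 2) * B.α n) • B.ψ n 0)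
      (m := n) ((supp_aff (B.supp _ _) x).sub ((B.supp _ _).smul _)) (fun z w _ => ?_) ?_ z w hzw
    · simpa [sub_eq_zero] using this
    · rw [map_sub, map_smul, B.raise_zero, raiseOp_affOp hq hs ht, B.raise_zero]
      simp
    · rw [pair_sub_right, pair_smul_right, hpair, B.norm n hn.1 hn.2, mul_one, sub_self]
  · rw [affOp_apply, B.ψ_apply_eq_zero (by omega), B.ψ_apply_eq_zero (by omega), Pi.smul_apply,
      Pi.smul_apply, B.ψ_apply_eq_zero (by omega)]
    simp

lemma sum_sq {n : ℕ} (h : B.Ok n) : ∑ p ∈ antidiagonal n, B.ψ n 0 p.1 p.2 ^ 2 = 1 := by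
  rw [← B.norm n h.1 h.2]
  exact sum_congr rfl fun _ _ => pow_two _

/-- Squaring the singular vector equation and summing relates the averages of `s.fm ^ 2` and `t.fm ^
2`. Inserting the Casimir relations, the averages of `K⁻² ⊗ 1` cancel, and a linear equation for
`mom` remains. -/
lemma mom_succ {n : ℕ} (h : B.Ok (n + 1)) :
    (q ^ 3 * (B.c (n + 1)).k0 ^ 2 - q⁻¹ * (B.c (n + 1)).k0⁻¹ ^ 2) * B.mom (n + 1) =
      q ^ 2 * (B.c (n + 1)).k0 ^ 2 * s.cas q - t.cas q := by
  set κ := (B.c (n + 1)).k0 with hκ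
  have hκ0 : κ ≠ 0 := (B.rep _ h.1 h.2).k0_ne
  have key : ∑ p ∈ antidiagonal (n + 1), q ^ 2 * κ ^ 2 * s.fm p.1 ^ 2 * B.ψ (n + 1) 0 p.1 p.2 ^ 2 =
      ∑ p ∈ antidiagonal (n + 1), t.fm p.2 ^ 2 * B.ψ (n + 1) 0 p.1 p.2 ^ 2 := by
    rw [Nat.sum_antidiagonal_succ]
    conv_rhs => rw [Nat.sum_antidiagonal_succ']
    simp only [fm_zero, ne_eq, OfNat.ofNat_ne_zero, not_false_eq_true, zero_pow, mul_zero, zero_mul,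
      zero_add, fm_succ]
    refine sum_congr rfl fun p hp => ?_
    have hz := HasAntidiagonal.mem_antidiagonal.mp hp
    have e := congrFun (congrFun (B.raise_zero (n + 1)) p.1) p.2
    rw [raiseOp_apply] at e
    have h1 := hs.k_ne hq p.1
    have h2 := ht.k_ne hq p.2
    have h3 : s.k q p.1 * t.k q p.2 = q * κ := by
      rw [B.k_mul n 0 _ _ (ok_of_succ h) (by simpa using hz), B.k_zero, hκ, B.k0_succ h]
      field_simp
    simp only [Pi.zero_apply] at e
    have e' : t.f p.2 * B.ψ (n + 1) 0 p.1 (p.2 + 1) =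
        -(q * κ * (s.f p.1 * B.ψ (n + 1) 0 (p.1 + 1) p.2)) := by
      rw [← h3]
      field_simp at e
      linear_combination e
    linear_combination (-(t.f p.2 * B.ψ (n + 1) 0 p.1 (p.2 + 1)) +
      (q * κ * (s.f p.1 * B.ψ (n + 1) 0 (p.1 + 1) p.2))) * e'
  have h1 := B.sum_sq hq hω hs ht h
  have e1 : (q - q⁻¹) ^ 2 * ∑ p ∈ antidiagonal (n + 1),
      (q ^ 2 * κ ^ 2 * s.fm p.1 ^ 2 * B.ψ (n + 1) 0 p.1 p.2 ^ 2
        - t.fm p.2 ^ 2 * B.ψ (n + 1) 0 p.1 p.2 ^ 2) = 0 := by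
    rw [sum_sub_distrib, key, sub_self, mul_zero]
  have e2 : (q - q⁻¹) ^ 2 * ∑ p ∈ antidiagonal (n + 1),
      (q ^ 2 * κ ^ 2 * s.fm p.1 ^ 2 * B.ψ (n + 1) 0 p.1 p.2 ^ 2
        - t.fm p.2 ^ 2 * B.ψ (n + 1) 0 p.1 p.2 ^ 2) =
      (q ^ 2 * κ ^ 2 * s.cas q - t.cas q) * ∑ p ∈ antidiagonal (n + 1), B.ψ (n + 1) 0 p.1 p.2 ^ 2
        - (q ^ 3 * κ ^ 2 - q⁻¹ * κ⁻¹ ^ 2) * B.mom (n + 1) := by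
    rw [mom, mul_sum, mul_sum, mul_sum, ← sum_sub_distrib]
    refine sum_congr rfl fun p hp => ?_
    have hz := HasAntidiagonal.mem_antidiagonal.mp hp
    have h1 := hs.k_ne hq p.1
    have h3 : t.k q p.2 = κ * (s.k q p.1)⁻¹ := by
      rw [hκ, ← B.k_zero, ← B.k_mul (n + 1) 0 _ _ h (by simpa using hz)]
      field_simp
    have f1 := hs.fm_sq hq p.1
    have f2 := ht.fm_sq hq p.2
    rw [h3] at f2
    linear_combination (norm := (field_simp; ring))
      (q ^ 2 * κ ^ 2 * B.ψ (n + 1) 0 p.1 p.2 ^ 2) * f1 - B.ψ (n + 1) 0 p.1 p.2 ^ 2 * f2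
  rw [h1] at e2
  linear_combination e2 - e1

lemma mom_zero (h : B.Ok 0) : B.mom 0 = s.k0 ^ 2 := by
  have := B.sum_sq hq hω hs ht h
  simp only [Nat.antidiagonal_zero, sum_singleton] at this
  simp [mom, this, Site.k]

/-- On a singular vector the `F ⊗ E` part of `monA` becomes diagonal, so that its expectation value
involves no quantity other than `mom`. -/
lemma pair_monA_ψ {n : ℕ} (h : B.Ok n) (x : ℂ) : pair n (B.ψ n 0) (monA q s t x (B.ψ n 0)) =
    (-(x * (B.c n).k0⁻¹) + x⁻¹ * (B.c n).k0 * q ^ 2) * B.mom n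
      - x⁻¹ * q * (B.c n).k0 * s.cas q := by
  set κ := (B.c n).k0 with hκ
  have hκ0 : κ ≠ 0 := (B.rep _ h.1 h.2).k0_ne
  have h1 := B.sum_sq hq hω hs ht h
  have : pair n (B.ψ n 0) (monA q s t x (B.ψ n 0)) =
    (-(x * κ⁻¹) + x⁻¹ * κ * q ^ 2) * B.mom n
      - x⁻¹ * q * κ * s.cas q * ∑ p ∈ antidiagonal n, B.ψ n 0 p.1 p.2 ^ 2 := by
    rw [pair, mom, mul_sum, mul_sum, ← sum_sub_distrib]
    refine sum_congr rfl fun p hp => ?_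
    have hz := HasAntidiagonal.mem_antidiagonal.mp hp
    have h1 := hs.k_ne hq p.1
    have h3 : t.k q p.2 = κ * (s.k q p.1)⁻¹ := by
      rw [hκ, ← B.k_zero, ← B.k_mul n 0 _ _ h (by simpa using hz)]
      field_simp
    have f1 := hs.fm_sq hq p.1
    have e : s.fm p.1 * t.f p.2 * B.ψ n 0 (p.1 - 1) (p.2 + 1) =
        -(q * κ * (s.fm p.1 ^ 2 * B.ψ n 0 p.1 p.2)) := by
      obtain ⟨z, w⟩ := p
      rcases z with _ | z
      · simp
      · have e := congrFun (congrFun (B.raise_zero n) z) w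
        have h4 := hs.k_ne hq z
        simp only [raiseOp_apply, Pi.zero_apply] at e
        simp only [fm_succ, Nat.add_sub_cancel]
        simp only [k_succ] at h3
        rw [h3] at e
        field_simp at e
        linear_combination s.f z * e
    rw [monA_apply, e, h3]
    linear_combination (norm := (field_simp; ring))
      -(x⁻¹ * q * κ * B.ψ n 0 p.1 p.2 ^ 2) * f1
  rw [this, h1, mul_one]

lemma pair_monD_ψ {n : ℕ} (h : B.Ok n) (x : ℂ) : pair n (B.ψ n 0) (monD q s t x (B.ψ n 0)) =
    (-(x⁻¹ * (B.c n).k0⁻¹) + x * (B.c n).k0 * q ^ 2) * B.mom n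
      - x * q * (B.c n).k0 * s.cas q := by
  rw [pair_comm, pair_monD, B.pair_monA_ψ hq hω hs ht h, inv_inv]

/-- Transposed, `F` becomes `E` acting on `monD` of a singular vector. Only the `affOp` term of the
commutation relation survives; it is a multiple of `ψ (n + j) 0`, which is orthogonal to `ψ n j`
unless `j = 0`. -/
lemma pair_monA_lower {n j : ℕ} (h : B.Ok (n + j + 1)) (x : ℂ) :
    pair (n + j + 1) (B.ψ (n + j + 1) 0) (monA q s t x (lowerOp q s t (B.ψ n j))) =
      -((q - q⁻¹) * (B.c (n + j)).k0⁻¹ * ((x⁻¹ - x * (B.c (n + j)).k0 ^ 2) * B.α (n + j))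
        * if j = 0 then 1 else 0) := by
  have hn := ok_of_succ h
  rw [pair_comm, pair_monA, pair_comm, ← pair_raise, raiseOp_monD hq hs ht, B.raise_zero, map_zero,
    smul_zero, zero_sub, B.aff_ψ hq hω hs ht h, map_smul, B.weightInv_ψ _ _ hn, ← neg_smul,
    pair_smul_left, pair_smul_left, pair_smul_left]
  have := B.pair_ψ hq hω hs ht (n := n + j) (k := 0) (n' := n) (k' := j) rfl hn
    (B.rep _ hn.1 hn.2).d_pos
  rw [add_zero] at this
  rw [this, B.k_zero, inv_inv]
  simp only [Nat.add_eq_left]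
  ring

lemma pair_monD_lower {n j : ℕ} (h : B.Ok (n + j + 1)) (x : ℂ) :
    pair (n + j + 1) (B.ψ (n + j + 1) 0) (monD q s t x (lowerOp q s t (B.ψ n j))) =
      (q - q⁻¹) * (B.c (n + j)).k0 * ((x⁻¹ - x * (B.c (n + j)).k0 ^ 2) * B.α (n + j))
        * if j = 0 then 1 else 0 := by
  have hn := ok_of_succ h
  rw [pair_comm, pair_monD, pair_comm, ← pair_raise, raiseOp_monA hq hs ht, B.raise_zero, map_zero,
    smul_zero, zero_add, B.aff_ψ hq hω hs ht h, map_smul, B.weight_ψ _ _ hn,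
    pair_smul_left, pair_smul_left, pair_smul_left]
  have := B.pair_ψ hq hω hs ht (n := n + j) (k := 0) (n' := n) (k' := j) rfl hn
    (B.rep _ hn.1 hn.2).d_pos
  rw [add_zero] at this
  rw [this, B.k_zero, inv_inv]
  simp only [Nat.add_eq_left]
  ring

end single

/-- Compatibility of the bases of `s ⊗ t` and `t ⊗ s`. -/
structure Compat (B : CGBasis q s t) (B' : CGBasis q t s) : Prop where
  c_eq : ∀ n, B.Ok n → B'.c n = B.c n
  α_eq : ∀ n, B.Ok (n + 1) → B'.α n = B.α n
  nondeg : ∀ n, B.Ok (n + 1) →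
    q ^ 2 * (B.c (n + 1)).k0 ^ 2 - q⁻¹ ^ 2 * (B.c (n + 1)).k0⁻¹ ^ 2 ≠ 0

lemma ok_swap {B : CGBasis q s t} {B' : CGBasis q t s} {n : ℕ} : B'.Ok n ↔ B.Ok n := and_comm

/-- The operator acting as `g n` times the identification of the summands `c n` of `s ⊗ t` and
`t ⊗ s`. -/
noncomputable def rCheck (B : CGBasis q s t) (B' : CGBasis q t s) (g : ℕ → ℂ) :
    (ℕ → ℕ → ℂ) →ₗ[ℂ] (ℕ → ℕ → ℂ) where
  toFun φ z w := ∑ p ∈ antidiagonal (z + w),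
    g p.1 * pair (z + w) (B.ψ p.1 p.2) φ * B'.ψ p.1 p.2 z w
  map_add' φ χ := by
    ext z w
    simp only [Pi.add_apply, pair_add_right, ← sum_add_distrib]
    exact sum_congr rfl fun _ _ => by ring
  map_smul' c φ := by
    ext z w
    simp only [Pi.smul_apply, pair_smul_right, smul_eq_mul, RingHom.id_apply, mul_sum]
    exact sum_congr rfl fun _ _ => by ring

end CGBasis

open CGBasis

/-- A row-finite operator for which the component of level `l` of the image only depends on the
component of level `σ l` of the argument. -/
def Local (X : (ℕ → ℕ → ℂ) →ₗ[ℂ] (ℕ → ℕ → ℂ)) (σ : ℕ → ℕ) : Prop :=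
  ∀ φ z w, (∀ z' w', z' + w' = σ (z + w) → φ z' w' = 0) → X φ z w = 0

lemma Local.comp {X Y : (ℕ → ℕ → ℂ) →ₗ[ℂ] (ℕ → ℕ → ℂ)} {σ τ : ℕ → ℕ} (hX : Local X σ)
    (hY : Local Y τ) : Local (X ∘ₗ Y) (τ ∘ σ) := fun φ z w h =>
  hX _ z w fun z' w' h' => hY _ _ _ fun z'' w'' h'' => h _ _ (by rw [h'', h']; rfl)

lemma Local.sub {X Y : (ℕ → ℕ → ℂ) →ₗ[ℂ] (ℕ → ℕ → ℂ)} {σ : ℕ → ℕ} (hX : Local X σ)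
    (hY : Local Y σ) : Local (X - Y) σ := fun φ z w h => by
  rw [LinearMap.sub_apply, Pi.sub_apply, Pi.sub_apply, hX φ z w h, hY φ z w h, sub_zero]

lemma local_raise : Local (raiseOp q s t) (· + 1) := fun φ z w h => by
  rw [raiseOp_apply, h _ _ (by ring), h _ _ (by ring)]; simp

lemma local_aff (x : ℂ) : Local (affOp q s t x) (· + 1) := fun φ z w h => by
  rw [affOp_apply, h _ _ (by ring), h _ _ (by ring)]; simp

lemma local_lower : Local (lowerOp q s t) (· - 1) := fun φ z w h => by
  rw [lowerOp_apply]
  rcases z with _ | z <;> rcases w with _ | w <;> simp only [fm_zero, fm_succ, Nat.add_sub_cancel]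
  · simp
  · rw [h 0 w (by simp)]; simp
  · rw [h z 0 (by simp)]; simp
  · rw [h z (w + 1) (by simp; omega), h (z + 1) w (by simp)]; simp

lemma local_monA (x : ℂ) : Local (monA q s t x) id := fun φ z w h => by
  rw [monA_apply, h z w rfl]
  rcases z with _ | z
  · simp
  · rw [h (z + 1 - 1) (w + 1) (by simp; ring)]; simp

lemma local_monD (x : ℂ) : Local (monD q s t x) id := fun φ z w h => by
  rw [monD_apply, h z w rfl]
  rcases w with _ | w
  · simp
  · rw [h (z + 1) (w + 1 - 1) (by simp; ring)]; simp

namespace CGBasis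

lemma rCheck_apply (B : CGBasis q s t) (B' : CGBasis q t s) (g : ℕ → ℂ) (φ : ℕ → ℕ → ℂ)
    (z w : ℕ) : B.rCheck B' g φ z w = ∑ p ∈ antidiagonal (z + w),
    g p.1 * pair (z + w) (B.ψ p.1 p.2) φ * B'.ψ p.1 p.2 z w := rfl

lemma local_rCheck (B : CGBasis q s t) (B' : CGBasis q t s) (g : ℕ → ℂ) :
    Local (B.rCheck B' g) id := fun φ z w h => by
  rw [rCheck_apply]
  refine sum_eq_zero fun p _ => ?_
  rw [pair_congr (l := z + w) (fun _ _ _ => rfl) (χ' := 0) h, pair_zero_right, mul_zero, zero_mul]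

lemma supp_rCheck (B : CGBasis q s t) (B' : CGBasis q t s) (g : ℕ → ℂ) (φ : ℕ → ℕ → ℂ) :
    Supp t s (B.rCheck B' g φ) := fun z w h => by
  rw [rCheck_apply] at h
  obtain ⟨p, _, hp⟩ := Finset.exists_ne_zero_of_sum_ne_zero h
  exact B'.supp _ _ z w (right_ne_zero_of_mul hp)

variable (B : CGBasis q s t) (B' : CGBasis q t s) (g : ℕ → ℂ)
  (hq : q ≠ 0) (hω : q - q⁻¹ ≠ 0) (hs : s.IsRep q) (ht : t.IsRep q)

include hq hω hs ht

/-- A supported function may be an infinite combination of basis vectors, but by locality each value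
of `X φ` depends on one level, where the expansion is finite. -/
lemma eq_zero_of_basis {X : (ℕ → ℕ → ℂ) →ₗ[ℂ] (ℕ → ℕ → ℂ)} {σ : ℕ → ℕ} (hX : Local X σ)
    (h : ∀ n k, X (B.ψ n k) = 0) {φ : ℕ → ℕ → ℂ} (hφ : Supp s t φ) : X φ = 0 := by
  ext z w
  set l := σ (z + w)
  have h1 := hX (φ - ∑ p ∈ antidiagonal l, pair l (B.ψ p.1 p.2) φ • B.ψ p.1 p.2) z w
    fun z' w' h' => by
      simp only [Pi.sub_apply, Finset.sum_apply, Pi.smul_apply, smul_eq_mul]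
      rw [← B.expand hq hω hs ht hφ l z' w' h', sub_self]
  rw [map_sub, map_sum] at h1
  simpa [h] using h1

lemma rCheck_ψ (hB : B.Compat B') (n k : ℕ) : B.rCheck B' g (B.ψ n k) = g n • B'.ψ n k := by
  by_cases hv : B.Ok n ∧ (k : ℕ∞) < (B.c n).d
  swap
  · rw [B.ψ_eq_zero hv, B'.ψ_eq_zero, map_zero, smul_zero]
    rintro ⟨h1, h2⟩
    have h1' : B.Ok n := ok_swap.mp h1
    rw [hB.c_eq n h1'] at h2
    exact hv ⟨h1', h2⟩
  ext z w
  rw [rCheck_apply, Pi.smul_apply, Pi.smul_apply, smul_eq_mul]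
  by_cases h : z + w = n + k
  · rw [sum_eq_single (n, k), h, B.pair_ψ hq hω hs ht rfl hv.1 hv.2, if_pos rfl, mul_one]
    · rintro p hp hne
      rw [HasAntidiagonal.mem_antidiagonal] at hp
      rw [h, pair_comm, B.pair_ψ hq hω hs ht (by omega) hv.1 hv.2, if_neg, mul_zero, zero_mul]
      rintro rfl
      exact hne (Prod.ext rfl (by simp; omega))
    · intro h'
      exact absurd (HasAntidiagonal.mem_antidiagonal.mpr h.symm) h'
  · rw [B'.ψ_apply_eq_zero h, mul_zero]
    refine sum_eq_zero fun p hp => ?_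
    rw [pair_congr (fun _ _ _ => rfl) (χ' := 0), pair_zero_right, mul_zero, zero_mul]
    intro z' w' h'
    exact B.ψ_apply_eq_zero (by omega)

lemma rCheck_raise (hB : B.Compat B') {φ : ℕ → ℕ → ℂ} (hφ : Supp s t φ) :
    B.rCheck B' g (raiseOp q s t φ) = raiseOp q t s (B.rCheck B' g φ) := by
  have := B.eq_zero_of_basis hq hω hs ht (X := B.rCheck B' g ∘ₗ raiseOp q s t
    - raiseOp q t s ∘ₗ B.rCheck B' g) (σ := (· + 1))
    (Local.sub ((B.local_rCheck B' g).comp local_raise) (local_raise.comp (B.local_rCheck B' g)))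
    (fun n k => ?_) hφ
  · simpa [sub_eq_zero] using this
  · rw [LinearMap.sub_apply, LinearMap.comp_apply, LinearMap.comp_apply,
      B.rCheck_ψ B' g hq hω hs ht hB]
    by_cases hn : B.Ok n
    · rw [map_smul, B.raise_ψ hq hω hs ht n k hn,
        B'.raise_ψ hq hω ht hs n k (ok_swap.mpr hn), map_smul, B.rCheck_ψ B' g hq hω hs ht hB,
        hB.c_eq n hn, smul_comm, sub_self]
    · rw [B.ψ_eq_zero_of_not_ok hn, B'.ψ_eq_zero_of_not_ok (fun h => hn (ok_swap.mp h))]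
      simp

lemma rCheck_lower (hB : B.Compat B') {φ : ℕ → ℕ → ℂ} (hφ : Supp s t φ) :
    B.rCheck B' g (lowerOp q s t φ) = lowerOp q t s (B.rCheck B' g φ) := by
  have := B.eq_zero_of_basis hq hω hs ht (X := B.rCheck B' g ∘ₗ lowerOp q s t
    - lowerOp q t s ∘ₗ B.rCheck B' g) (σ := (· - 1))
    (Local.sub ((B.local_rCheck B' g).comp local_lower) (local_lower.comp (B.local_rCheck B' g)))
    (fun n k => ?_) hφ
  · simpa [sub_eq_zero] using this
  · rw [LinearMap.sub_apply, LinearMap.comp_apply, LinearMap.comp_apply,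
      B.rCheck_ψ B' g hq hω hs ht hB]
    by_cases hn : B.Ok n
    · rw [map_smul, B.lower_ψ hq hω hs ht n k hn,
        B'.lower_ψ hq hω ht hs n k (ok_swap.mpr hn), map_smul, B.rCheck_ψ B' g hq hω hs ht hB,
        hB.c_eq n hn, smul_comm, sub_self]
    · rw [B.ψ_eq_zero_of_not_ok hn, B'.ψ_eq_zero_of_not_ok (fun h => hn (ok_swap.mp h))]
      simp

lemma weight_rCheck (φ : ℕ → ℕ → ℂ) :
    B.rCheck B' g (weightOp q s t φ) = weightOp q t s (B.rCheck B' g φ) := by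
  ext z w
  rw [weightOp_apply, rCheck_apply, rCheck_apply, mul_sum]
  refine sum_congr rfl fun p hp => ?_
  rw [HasAntidiagonal.mem_antidiagonal] at hp
  by_cases hn : B.Ok p.1
  · have : pair (z + w) (B.ψ p.1 p.2) (weightOp q s t φ) =
        (t.k q z * s.k q w) * pair (z + w) (B.ψ p.1 p.2) φ := by
      rw [pair, pair, mul_sum]
      refine sum_congr rfl fun r hr => ?_
      rw [HasAntidiagonal.mem_antidiagonal] at hr
      rw [weightOp_apply, B.k_mul p.1 p.2 r.1 r.2 hn (by omega), mul_comm (t.k q z),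
        B.k_mul p.1 p.2 w z hn (by omega)]
      ring
    rw [this]; ring
  · rw [B.ψ_eq_zero_of_not_ok hn, pair_zero_left, pair_zero_left]; ring

lemma weightInv_rCheck (φ : ℕ → ℕ → ℂ) :
    B.rCheck B' g (weightInvOp q s t φ) = weightInvOp q t s (B.rCheck B' g φ) := by
  ext z w
  rw [weightInvOp_apply, rCheck_apply, rCheck_apply, mul_sum]
  refine sum_congr rfl fun p hp => ?_
  rw [HasAntidiagonal.mem_antidiagonal] at hp
  by_cases hn : B.Ok p.1
  · have : pair (z + w) (B.ψ p.1 p.2) (weightInvOp q s t φ) =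
        ((t.k q z)⁻¹ * (s.k q w)⁻¹) * pair (z + w) (B.ψ p.1 p.2) φ := by
      rw [pair, pair, mul_sum]
      refine sum_congr rfl fun r hr => ?_
      rw [HasAntidiagonal.mem_antidiagonal] at hr
      rw [weightInvOp_apply, ← mul_inv, ← mul_inv, B.k_mul p.1 p.2 r.1 r.2 hn (by omega),
        mul_comm (t.k q z), B.k_mul p.1 p.2 w z hn (by omega)]
      ring
    rw [this]; ring
  · rw [B.ψ_eq_zero_of_not_ok hn, pair_zero_left, pair_zero_left]; ring

lemma pair_rCheck (hB : B.Compat B') (n k : ℕ) (φ : ℕ → ℕ → ℂ) :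
    pair (n + k) (B'.ψ n k) (B.rCheck B' g φ) = g n * pair (n + k) (B.ψ n k) φ := by
  by_cases hv : B.Ok n ∧ (k : ℕ∞) < (B.c n).d
  swap
  · rw [B.ψ_eq_zero hv, B'.ψ_eq_zero, pair_zero_left, pair_zero_left, mul_zero]
    rintro ⟨h1, h2⟩
    have h1' : B.Ok n := ok_swap.mp h1
    rw [hB.c_eq n h1'] at h2
    exact hv ⟨h1', h2⟩
  have e : pair (n + k) (B'.ψ n k) (B.rCheck B' g φ) = pair (n + k) (B'.ψ n k)
      (∑ p ∈ antidiagonal (n + k), (g p.1 * pair (n + k) (B.ψ p.1 p.2) φ) • B'.ψ p.1 p.2) := by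
    refine pair_congr (fun _ _ _ => rfl) fun z w h => ?_
    rw [rCheck_apply, h]
    simp only [Finset.sum_apply, Pi.smul_apply, smul_eq_mul]
  rw [e, pair_sum_right, sum_eq_single (n, k)]
  · rw [pair_smul_right, B'.pair_ψ hq hω ht hs rfl (ok_swap.mpr hv.1)
      (by rw [hB.c_eq n hv.1]; exact hv.2), if_pos rfl, mul_one]
  · intro p hp hne
    rw [HasAntidiagonal.mem_antidiagonal] at hp
    rw [pair_smul_right, B'.pair_ψ hq hω ht hs (by omega) (ok_swap.mpr hv.1)
      (by rw [hB.c_eq n hv.1]; exact hv.2), if_neg, mul_zero]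
    rintro rfl
    exact hne (Prod.ext rfl (by simp; omega))
  · intro h
    exact absurd (HasAntidiagonal.mem_antidiagonal (a := (n, k)).mpr rfl) h

/-- The linear equations for the two moments differ by exchanging the Casimir values. Eliminating
that of `t` leaves a common factor, nonzero by `nondeg`. Level zero is not covered by `mom_succ` and
is checked directly. -/
lemma mom_add_mom (hB : B.Compat B') {n : ℕ} (h : B.Ok n) :
    q * B.mom n + q⁻¹ * (B.c n).k0⁻¹ ^ 2 * B'.mom n = s.cas q := by
  have hk := (B.rep n h.1 h.2).k0_ne
  cases n with
  | zero =>
    rw [B.mom_zero hq hω hs ht h, B'.mom_zero hq hω ht hs (ok_swap.mpr h), B.k0 0 h.1 h.2, cas]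
    have := hs.k0_ne
    have := ht.k0_ne
    field_simp
  | succ n =>
    have e1 := B.mom_succ hq hω hs ht h
    have e2 := B'.mom_succ hq hω ht hs (ok_swap.mpr h)
    rw [hB.c_eq _ h] at e2
    apply mul_left_cancel₀ (hB.nondeg n h)
    linear_combination (norm := (field_simp; ring)) e1 + q⁻¹ ^ 2 * (B.c (n + 1)).k0⁻¹ ^ 2 * e2

omit hq hω hs ht in
lemma Compat.symm {B : CGBasis q s t} {B' : CGBasis q t s} (hB : B.Compat B') : B'.Compat B where
  c_eq n h := (hB.c_eq n (ok_swap.mp h)).symm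
  α_eq n h := (hB.α_eq n (ok_swap.mp h)).symm
  nondeg n h := by
    rw [hB.c_eq _ (ok_swap.mp h)]
    exact hB.nondeg n (ok_swap.mp h)

/-- The difference of the two sides lies in one level. If `E` annihilates it, it is singular, and a
single matrix element, the one with `ψ (n + k) 0`, decides whether it vanishes. -/
lemma intertwines_of_raise {X X' : (ℕ → ℕ → ℂ) →ₗ[ℂ] (ℕ → ℕ → ℂ)} (hX : Local X id)
    (hX' : Local X' id) (hsupp : ∀ φ, Supp t s φ → Supp t s (X' φ)) (hB : B.Compat B') {n k : ℕ}
    (hr : raiseOp q t s (B.rCheck B' g (X (B.ψ n k))) =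
      raiseOp q t s (X' (B.rCheck B' g (B.ψ n k))))
    (hp : g (n + k) * pair (n + k) (B.ψ (n + k) 0) (X (B.ψ n k)) =
      g n * pair (n + k) (B'.ψ (n + k) 0) (X' (B'.ψ n k))) :
    B.rCheck B' g (X (B.ψ n k)) = X' (B.rCheck B' g (B.ψ n k)) := by
  rw [← sub_eq_zero]
  ext z w
  by_cases hzw : z + w = n + k
  · refine B'.singular_eq_zero hq hω ht hs (m := n + k)
      ((B.supp_rCheck B' g _).sub (hsupp _ (B.supp_rCheck B' g _))) (fun z w _ => ?_) ?_ z w hzw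
    · rw [map_sub, hr, sub_self]; rfl
    · have := B.pair_rCheck B' g hq hω hs ht hB (n + k) 0 (X (B.ψ n k))
      rw [add_zero] at this
      rw [pair_sub_right, this, hp, B.rCheck_ψ B' g hq hω hs ht hB, map_smul, pair_smul_right,
        sub_self]
  · have h0 : ∀ z' w', z' + w' = z + w → B.ψ n k z' w' = 0 := fun z' w' h =>
      B.ψ_apply_eq_zero (by omega)
    have h1 := (B.local_rCheck B' g).comp hX _ z w h0
    have h2 := hX'.comp (B.local_rCheck B' g) _ z w h0
    rw [LinearMap.comp_apply] at h1 h2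
    rw [Pi.sub_apply, Pi.sub_apply, h1, h2, sub_zero]
    rfl

variable {x : ℂ} (hx : x ≠ 0)
  (hg : ∀ n, B.Ok (n + 1) → g (n + 1) * (x⁻¹ - x * (B.c n).k0 ^ 2) =
    g n * (x - x⁻¹ * (B.c n).k0 ^ 2))
include hx hg

/-- On singular vectors `hg` is precisely the relation for `affOp`. The three relations must be
proved together: at `k + 1` that for `affOp` uses all three at `k`, and those for `monA` and `monD`
use `affOp` at `k + 1` and themselves at `k`. -/
lemma rCheck_basis (hB : B.Compat B') (k : ℕ) : ∀ n,
    B.rCheck B' g (affOp q s t x (B.ψ n k)) = affOp q t s x⁻¹ (B.rCheck B' g (B.ψ n k)) ∧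
    B.rCheck B' g (monA q s t x (B.ψ n k)) = monA q t s x⁻¹ (B.rCheck B' g (B.ψ n k)) ∧
    B.rCheck B' g (monD q s t x (B.ψ n k)) = monD q t s x⁻¹ (B.rCheck B' g (B.ψ n k)) := by
  induction k with
  | zero =>
    intro n
    by_cases hn : B.Ok n
    swap
    · rw [B.ψ_eq_zero_of_not_ok hn]; simp
    have hF : B.rCheck B' g (affOp q s t x (B.ψ n 0)) =
        affOp q t s x⁻¹ (B.rCheck B' g (B.ψ n 0)) := by
      rw [B.rCheck_ψ B' g hq hω hs ht hB, map_smul]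
      cases n with
      | zero => rw [B.aff_ψ_zero hq hω hs ht, B'.aff_ψ_zero hq hω ht hs]; simp
      | succ n =>
        rw [B.aff_ψ hq hω hs ht hn, B'.aff_ψ hq hω ht hs (ok_swap.mpr hn), map_smul,
          B.rCheck_ψ B' g hq hω hs ht hB, smul_smul, smul_smul, hB.c_eq n (ok_of_succ hn),
          hB.α_eq n hn, inv_inv]
        congr 1
        linear_combination -B.α n * hg n hn
    -- The expectation values of `monA` and `monD` in the two orders of the factors differ by
    -- multiples of these two sum rules.
    have hsum := B.mom_add_mom B' hq hω hs ht hB hn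
    have hsum' := B'.mom_add_mom B hq hω ht hs hB.symm (ok_swap.mpr hn)
    rw [hB.c_eq n hn] at hsum'
    have hk := (B.rep n hn.1 hn.2).k0_ne
    have hsup := B.supp n 0
    have hsup' := B.supp_rCheck B' g (B.ψ n 0)
    refine ⟨hF, ?_, ?_⟩
    · refine B.intertwines_of_raise B' g hq hω hs ht (local_monA x) (local_monA x⁻¹)
        (fun φ h => supp_monA ht h x⁻¹) hB ?_ ?_
      · rw [← B.rCheck_raise B' g hq hω hs ht hB (supp_monA hs hsup x),
          raiseOp_monA hq hs ht, raiseOp_monA hq ht hs,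
          ← B.rCheck_raise B' g hq hω hs ht hB hsup, B.raise_zero, ← hF]
        simp [B.weight_rCheck B' g hq hω hs ht]
      · rw [add_zero, B.pair_monA_ψ hq hω hs ht hn, B'.pair_monA_ψ hq hω ht hs (ok_swap.mpr hn),
          hB.c_eq n hn, inv_inv]
        linear_combination (norm := (field_simp; ring))
          g n * (x⁻¹ * q * (B.c n).k0 * hsum - x * q * (B.c n).k0 * hsum')
    · refine B.intertwines_of_raise B' g hq hω hs ht (local_monD x) (local_monD x⁻¹)
        (fun φ h => supp_monD hs h x⁻¹) hB ?_ ?_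
      · rw [← B.rCheck_raise B' g hq hω hs ht hB (supp_monD ht hsup x),
          raiseOp_monD hq hs ht, raiseOp_monD hq ht hs,
          ← B.rCheck_raise B' g hq hω hs ht hB hsup, B.raise_zero, ← hF]
        simp [B.weightInv_rCheck B' g hq hω hs ht]
      · rw [add_zero, B.pair_monD_ψ hq hω hs ht hn, B'.pair_monD_ψ hq hω ht hs (ok_swap.mpr hn),
          hB.c_eq n hn, inv_inv]
        linear_combination (norm := (field_simp; ring))
          g n * (x * q * (B.c n).k0 * hsum - x⁻¹ * q * (B.c n).k0 * hsum')
  | succ k ih =>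
    intro n
    by_cases hv : B.Ok n ∧ ((k + 1 : ℕ) : ℕ∞) < (B.c n).d
    swap
    · rw [B.ψ_eq_zero hv]; simp
    obtain ⟨hn, hk⟩ := hv
    obtain ⟨ihF, ihA, ihD⟩ := ih n
    have hf := (B.rep n hn.1 hn.2).f_ne k hk
    have hsup := B.supp n k
    have hsup1 := B.supp n (k + 1)
    have hsup' := B.supp_rCheck B' g (B.ψ n k)
    have hlow : B.ψ n (k + 1) = ((B.c n).f k)⁻¹ • lowerOp q s t (B.ψ n k) := by
      rw [B.lower_ψ hq hω hs ht n k hn, smul_smul, inv_mul_cancel₀ hf, one_smul]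
    have hlow' : B'.ψ n (k + 1) = ((B.c n).f k)⁻¹ • lowerOp q t s (B'.ψ n k) := by
      rw [B'.lower_ψ hq hω ht hs n k (ok_swap.mpr hn), hB.c_eq n hn, smul_smul,
        inv_mul_cancel₀ hf, one_smul]
    have hF : B.rCheck B' g (affOp q s t x (B.ψ n (k + 1))) =
        affOp q t s x⁻¹ (B.rCheck B' g (B.ψ n (k + 1))) := by
      rw [hlow]
      simp only [map_smul]
      congr 1
      apply smul_right_injective _ hω
      simp only
      rw [← map_smul, lowerOp_affOp hq hω hs ht, B.rCheck_lower B' g hq hω hs ht hB hsup,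
        lowerOp_affOp hq hω ht hs, map_add, map_sub, map_smul,
        B.rCheck_lower B' g hq hω hs ht hB (supp_aff hsup x), B.weight_rCheck B' g hq hω hs ht,
        B.weightInv_rCheck B' g hq hω hs ht, ihF, ihA, ihD]
    have hraise := B.raise_succ hq hω hs ht n k hn
    refine ⟨hF, ?_, ?_⟩
    · refine B.intertwines_of_raise B' g hq hω hs ht (local_monA x) (local_monA x⁻¹)
        (fun φ h => supp_monA ht h x⁻¹) hB ?_ ?_
      · rw [← B.rCheck_raise B' g hq hω hs ht hB (supp_monA hs hsup1 x),
          raiseOp_monA hq hs ht, raiseOp_monA hq ht hs,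
          ← B.rCheck_raise B' g hq hω hs ht hB hsup1, ← hF, hraise]
        simp only [map_add, map_smul, B.weight_rCheck B' g hq hω hs ht, ihA]
      -- For `k = 0` the recursion `hg` enters again; for `k > 0` both matrix elements are zero.
      · by_cases hl : B.Ok (n + k + 1)
        · rw [hlow, hlow', map_smul, map_smul, pair_smul_right, pair_smul_right, ← add_assoc,
            B.pair_monA_lower hq hω hs ht hl, B'.pair_monA_lower hq hω ht hs (ok_swap.mpr hl),
            hB.c_eq _ (ok_of_succ hl), hB.α_eq _ hl]
          split_ifs with h0
          · subst h0
            have := hg _ hl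
            rw [inv_inv, add_zero]
            linear_combination (-((B.c n).f 0)⁻¹ * (q - q⁻¹) * (B.c n).k0⁻¹ * B.α n) * this
          · ring
        · rw [B.ψ_eq_zero_of_not_ok (n := n + (k + 1)) hl,
            B'.ψ_eq_zero_of_not_ok (n := n + (k + 1)) (fun h => hl (ok_swap.mp h)),
            pair_zero_left, pair_zero_left]
          ring
    · refine B.intertwines_of_raise B' g hq hω hs ht (local_monD x) (local_monD x⁻¹)
        (fun φ h => supp_monD hs h x⁻¹) hB ?_ ?_
      · rw [← B.rCheck_raise B' g hq hω hs ht hB (supp_monD ht hsup1 x),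
          raiseOp_monD hq hs ht, raiseOp_monD hq ht hs,
          ← B.rCheck_raise B' g hq hω hs ht hB hsup1, ← hF, hraise]
        simp only [map_sub, map_smul, B.weightInv_rCheck B' g hq hω hs ht, ihD]
      · by_cases hl : B.Ok (n + k + 1)
        · rw [hlow, hlow', map_smul, map_smul, pair_smul_right, pair_smul_right, ← add_assoc,
            B.pair_monD_lower hq hω hs ht hl, B'.pair_monD_lower hq hω ht hs (ok_swap.mpr hl),
            hB.c_eq _ (ok_of_succ hl), hB.α_eq _ hl]
          split_ifs with h0
          · subst h0
            have := hg _ hl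
            rw [inv_inv, add_zero]
            linear_combination (((B.c n).f 0)⁻¹ * (q - q⁻¹) * (B.c n).k0 * B.α n) * this
          · ring
        · rw [B.ψ_eq_zero_of_not_ok (n := n + (k + 1)) hl,
            B'.ψ_eq_zero_of_not_ok (n := n + (k + 1)) (fun h => hl (ok_swap.mp h)),
            pair_zero_left, pair_zero_left]
          ring

lemma rCheck_aff (hB : B.Compat B') {φ : ℕ → ℕ → ℂ} (hφ : Supp s t φ) :
    B.rCheck B' g (affOp q s t x φ) = affOp q t s x⁻¹ (B.rCheck B' g φ) := by
  have := B.eq_zero_of_basis hq hω hs ht (X := B.rCheck B' g ∘ₗ affOp q s t x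
    - affOp q t s x⁻¹ ∘ₗ B.rCheck B' g) (σ := (· + 1))
    (Local.sub ((B.local_rCheck B' g).comp (local_aff x))
      ((local_aff x⁻¹).comp (B.local_rCheck B' g)))
    (fun n k => sub_eq_zero.mpr (B.rCheck_basis B' g hq hω hs ht hx hg hB k n).1) hφ
  simpa [sub_eq_zero] using this

lemma rCheck_monA (hB : B.Compat B') {φ : ℕ → ℕ → ℂ} (hφ : Supp s t φ) :
    B.rCheck B' g (monA q s t x φ) = monA q t s x⁻¹ (B.rCheck B' g φ) := by
  have := B.eq_zero_of_basis hq hω hs ht (X := B.rCheck B' g ∘ₗ monA q s t x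
    - monA q t s x⁻¹ ∘ₗ B.rCheck B' g) (σ := id)
    (Local.sub ((B.local_rCheck B' g).comp (local_monA x))
      ((local_monA x⁻¹).comp (B.local_rCheck B' g)))
    (fun n k => sub_eq_zero.mpr (B.rCheck_basis B' g hq hω hs ht hx hg hB k n).2.1) hφ
  simpa [sub_eq_zero] using this

lemma rCheck_monD (hB : B.Compat B') {φ : ℕ → ℕ → ℂ} (hφ : Supp s t φ) :
    B.rCheck B' g (monD q s t x φ) = monD q t s x⁻¹ (B.rCheck B' g φ) := by
  have := B.eq_zero_of_basis hq hω hs ht (X := B.rCheck B' g ∘ₗ monD q s t x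
    - monD q t s x⁻¹ ∘ₗ B.rCheck B' g) (σ := id)
    (Local.sub ((B.local_rCheck B' g).comp (local_monD x))
      ((local_monD x⁻¹).comp (B.local_rCheck B' g)))
    (fun n k => sub_eq_zero.mpr (B.rCheck_basis B' g hq hω hs ht hx hg hB k n).2.2) hφ
  simpa [sub_eq_zero] using this

end CGBasis

end ColoredIRF

/-! ### Monodromy matrices and the Yang–Baxter equation for generic parameters. -/

namespace ColoredIRF
open Site

/-- The diagonal entry `A` of the Lax matrix. -/
noncomputable def laxA (q : ℂ) (s : Site) (x l : ℂ) (z : ℕ) : ℂ :=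
  l * x * s.k q z - l⁻¹ * x⁻¹ * (s.k q z)⁻¹

/-- The diagonal entry `D` of the Lax matrix. -/
noncomputable def laxD (q : ℂ) (s : Site) (x l : ℂ) (z : ℕ) : ℂ :=
  l * x * (s.k q z)⁻¹ - l⁻¹ * x⁻¹ * s.k q z

/-- The raising entry of the monodromy matrix for two sites. -/
noncomputable def colC (q : ℂ) (s t : Site) (x y l : ℂ) : (ℕ → ℕ → ℂ) →ₗ[ℂ] (ℕ → ℕ → ℂ) :=
  (l * x * y) • raiseOp q s t - l⁻¹ • affOp q s t (x / y)

/-- The entry `A` of the monodromy matrix for two sites. -/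
noncomputable def colA (q : ℂ) (s t : Site) (x y l : ℂ) : (ℕ → ℕ → ℂ) →ₗ[ℂ] (ℕ → ℕ → ℂ) :=
  (l ^ 2 * x * y) • weightOp q s t + (l⁻¹ ^ 2 * x⁻¹ * y⁻¹) • weightInvOp q s t
    + monA q s t (x / y)

/-- The entry `D` of the monodromy matrix for two sites. -/
noncomputable def colD (q : ℂ) (s t : Site) (x y l : ℂ) : (ℕ → ℕ → ℂ) →ₗ[ℂ] (ℕ → ℕ → ℂ) :=
  (l ^ 2 * x * y) • weightInvOp q s t + (l⁻¹ ^ 2 * x⁻¹ * y⁻¹) • weightOp q s t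
    + monD q s t (x / y)

/-- The raising entry of the monodromy matrix for three sites. -/
noncomputable def triC (q : ℂ) (s t r : Site) (x y w l : ℂ) (φ : ℕ → ℕ → ℕ → ℂ) :
    ℕ → ℕ → ℕ → ℂ := fun a b c =>
  x * s.f a * colA q t r y w l (φ (a + 1)) b c + laxD q s x l a * colC q t r y w l (φ a) b c

variable {q : ℂ} {s t r : Site} {x y w l : ℂ}

lemma colC_apply (φ : ℕ → ℕ → ℂ) (a b : ℕ) : colC q s t x y l φ a b =
    l * x * y * raiseOp q s t φ a b - l⁻¹ * affOp q s t (x / y) φ a b := rfl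

lemma colA_apply (φ : ℕ → ℕ → ℂ) (a b : ℕ) : colA q s t x y l φ a b =
    l ^ 2 * x * y * weightOp q s t φ a b + l⁻¹ ^ 2 * x⁻¹ * y⁻¹ * weightInvOp q s t φ a b
    + monA q s t (x / y) φ a b := rfl

lemma colD_apply (φ : ℕ → ℕ → ℂ) (a b : ℕ) : colD q s t x y l φ a b =
    l ^ 2 * x * y * weightInvOp q s t φ a b + l⁻¹ ^ 2 * x⁻¹ * y⁻¹ * weightOp q s t φ a b
    + monD q s t (x / y) φ a b := rfl

/-- Associativity of the product of Lax matrices. `triC` splits off the first site and this form the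
last one, so operators on either adjacent pair can be pulled through. -/
lemma triC_apply_left (hx : x ≠ 0) (hy : y ≠ 0) (hw : w ≠ 0) (hl : l ≠ 0)
    (hq : q ≠ 0) (hs : s.IsRep q) (ht : t.IsRep q) (hr : r.IsRep q)
    (φ : ℕ → ℕ → ℕ → ℂ) (a b c : ℕ) : triC q s t r x y w l φ a b c =
    laxA q r w l c * colC q s t x y l (fun a b => φ a b c) a b +
      w * r.f c * colD q s t x y l (fun a b => φ a b (c + 1)) a b := by
  have h1 := hs.k_ne hq a
  have h2 := ht.k_ne hq b
  have h3 := hr.k_ne hq c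
  have h4 := ht.k0_ne
  simp only [triC, colC_apply, colA_apply, colD_apply, laxA, laxD, raiseOp_apply, affOp_apply,
    monA_apply, monD_apply, weightOp_apply, weightInvOp_apply]
  rcases b with _ | b
  · simp only [fm_zero]
    field_simp
    ring
  · simp only [fm_succ, Nat.add_sub_cancel]
    field_simp
    ring

/-- Functions supported on the basis of a tensor product of three sites. -/
def Supp3 (s t r : Site) (φ : ℕ → ℕ → ℕ → ℂ) : Prop :=
  ∀ a b c : ℕ, φ a b c ≠ 0 → (a : ℕ∞) < s.d ∧ (b : ℕ∞) < t.d ∧ (c : ℕ∞) < r.d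

lemma Supp3.slice {φ : ℕ → ℕ → ℕ → ℂ} (h : Supp3 s t r φ) (a : ℕ) : Supp t r (φ a) :=
  fun b c hb => (h a b c hb).2

lemma Supp3.slice' {φ : ℕ → ℕ → ℕ → ℂ} (h : Supp3 s t r φ) (c : ℕ) :
    Supp s t (fun a b => φ a b c) :=
  fun a b hb => ⟨(h a b c hb).1, (h a b c hb).2.1⟩

/-- The action of an operator on the first two factors. -/
def lift12 (R : (ℕ → ℕ → ℂ) →ₗ[ℂ] (ℕ → ℕ → ℂ)) (φ : ℕ → ℕ → ℕ → ℂ) : ℕ → ℕ → ℕ → ℂ :=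
  fun a b c => R (fun a b => φ a b c) a b

/-- The action of an operator on the last two factors. -/
def lift23 (R : (ℕ → ℕ → ℂ) →ₗ[ℂ] (ℕ → ℕ → ℂ)) (φ : ℕ → ℕ → ℕ → ℂ) : ℕ → ℕ → ℕ → ℂ :=
  fun a => R (φ a)

/-- An operator intertwining the monodromy matrices, normalized on the highest weight vector. -/
structure Intertwiner (q : ℂ) (s t : Site) (x y : ℂ)
    (R : (ℕ → ℕ → ℂ) →ₗ[ℂ] (ℕ → ℕ → ℂ)) : Prop where
  supp : ∀ φ, Supp t s (R φ)
  zero : ∀ φ, R φ 0 0 = φ 0 0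
  C : ∀ φ l, l ≠ 0 → Supp s t φ → R (colC q s t x y l φ) = colC q t s y x l (R φ)
  A : ∀ φ l, l ≠ 0 → Supp s t φ → R (colA q s t x y l φ) = colA q t s y x l (R φ)
  D : ∀ φ l, l ≠ 0 → Supp s t φ → R (colD q s t x y l φ) = colD q t s y x l (R φ)

lemma supp3_lift12 {R : (ℕ → ℕ → ℂ) →ₗ[ℂ] (ℕ → ℕ → ℂ)} (hR : Intertwiner q s t x y R)
    {φ : ℕ → ℕ → ℕ → ℂ} (h : Supp3 s t r φ) : Supp3 t s r (lift12 R φ) := by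
  intro a b c hne
  refine ⟨(hR.supp _ a b hne).1, (hR.supp _ a b hne).2, ?_⟩
  by_contra hc
  have : (fun a b => φ a b c) = 0 := by
    ext a b
    by_contra h'
    exact hc (h a b c h').2.2
  apply hne
  rw [lift12, this, map_zero]
  rfl

lemma supp3_lift23 {R : (ℕ → ℕ → ℂ) →ₗ[ℂ] (ℕ → ℕ → ℂ)} (hR : Intertwiner q t r y w R)
    {φ : ℕ → ℕ → ℕ → ℂ} (h : Supp3 s t r φ) : Supp3 s r t (lift23 R φ) := by
  intro a b c hne
  refine ⟨?_, hR.supp _ b c hne⟩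
  by_contra hc
  have : φ a = 0 := by
    ext b c
    by_contra h'
    exact hc (h a b c h').1
  apply hne
  rw [lift23, this, map_zero]
  rfl

section kernel
variable (hq : q ≠ 0) (hs : s.IsRep q) (ht : t.IsRep q) (hr : r.IsRep q) (hx : x ≠ 0) (hy : y ≠ 0)
  (hw : w ≠ 0)
include hq hs hx

/-- At this spectral parameter a site in state `a` loses its diagonal contribution to `C`, which
isolates the raising term. -/
lemma laxD_zero (a : ℕ) : laxD q s x (s.k q a / x) a = 0 := by
  have h := hs.k_ne hq a
  rw [laxD]
  field_simp
  ring

lemma laxD_ne (a : ℕ) (c : ℂ) (hc : c ≠ 0) (hc2 : c ^ 2 ≠ 1) :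
    laxD q s x (c * (s.k q a / x)) a ≠ 0 := by
  have h := hs.k_ne hq a
  rw [laxD]
  field_simp
  intro h'
  rw [div_eq_zero_iff] at h'
  exact hc2 (sub_eq_zero.mp (h'.resolve_right hc))

include ht hy

/-- The hypotheses are the two coefficients of `colC` in `l`, so `colC` annihilates `χ` for every
nonzero `l`. At the zero of `laxD` only the term with `χ (m + 1) 0` is left; any `l` with `laxD ≠ 0`
then passes from `b` to `b + 1`. -/
lemma pair_kernel (hgen : ∀ a, laxA q t y (s.k q a / x) 0 ≠ 0) {χ : ℕ → ℕ → ℂ}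
    (hχ : Supp s t χ) {m : ℕ} (hE : ∀ a b, a + b = m → raiseOp q s t χ a b = 0)
    (hF : ∀ a b, a + b = m → affOp q s t (x / y) χ a b = 0) :
    ∀ b a, a + b = m + 1 → χ a b = 0 := by
  have hC : ∀ l a b, l ≠ 0 → a + b = m → x * s.f a * laxA q t y l b * χ (a + 1) b
      + laxD q s x l a * (y * t.f b * χ a (b + 1)) = 0 := by
    intro l a b hl hab
    have h1 := hE a b hab
    have h2 := hF a b hab
    rw [raiseOp_apply] at h1
    rw [affOp_apply] at h2
    have h3 := hs.k_ne hq a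
    have h4 := ht.k_ne hq b
    rw [laxA, laxD]
    linear_combination (norm := (field_simp; ring)) l * x * y * h1 - l⁻¹ * h2
  intro b
  induction b with
  | zero =>
    intro a ha
    obtain rfl : a = m + 1 := by omega
    by_contra hne
    have h1 := hC (s.k q m / x) m 0 (div_ne_zero (hs.k_ne hq m) hx) (by omega)
    rw [laxD_zero hq hs hx, zero_mul, add_zero] at h1
    exact mul_ne_zero (mul_ne_zero (mul_ne_zero hx (hs.f_ne m (hχ _ _ hne).1)) (hgen m)) hne h1
  | succ b ih =>
    intro a ha
    by_contra hne
    -- The factor `2` is one of many: any nonzero factor with square different from `1` keeps `laxD`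
    -- away from zero.
    have h1 := hC (2 * (s.k q a / x)) a b (mul_ne_zero two_ne_zero
      (div_ne_zero (hs.k_ne hq a) hx)) (by omega)
    rw [ih (a + 1) (by omega), mul_zero, zero_add] at h1
    exact mul_ne_zero (laxD_ne hq hs hx a 2 two_ne_zero (by norm_num))
      (mul_ne_zero (mul_ne_zero hy (ht.f_ne b (hχ _ _ hne).2)) hne) h1

lemma colA_zero (φ : ℕ → ℕ → ℂ) (hl : l ≠ 0) :
    colA q s t x y l φ 0 0 = laxA q s x l 0 * laxA q t y l 0 * φ 0 0 := by
  have h1 := hs.k_ne hq 0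
  have h2 := ht.k_ne hq 0
  rw [colA_apply, weightOp_apply, weightInvOp_apply, monA_apply, laxA, laxA, fm_zero]
  field_simp
  ring

include hr hw

/-- The propagation of `pair_kernel`, with the last two sites in the role of the second one. On
their vacuum `colA` is the product of two `laxA`, nonzero by genericity. Once the values at `a + 1`
vanish, `colC` annihilates `χ a` for several `l`, and `pair_kernel` finishes. -/
lemma triple_kernel (hst : ∀ a, laxA q t y (s.k q a / x) 0 ≠ 0)
    (hsr : ∀ a, laxA q r w (s.k q a / x) 0 ≠ 0) (htr : ∀ a, laxA q r w (t.k q a / y) 0 ≠ 0)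
    {χ : ℕ → ℕ → ℕ → ℂ} (hχ : Supp3 s t r χ) {m : ℕ}
    (hC : ∀ l, l ≠ 0 → ∀ a b c, a + (b + c) = m → triC q s t r x y w l χ a b c = 0) :
    ∀ j a b c, a + j = m + 1 → b + c = j → χ a b c = 0 := by
  intro j
  induction j with
  | zero =>
    intro a b c ha hbc
    obtain rfl : a = m + 1 := by omega
    obtain rfl : b = 0 := by omega
    obtain rfl : c = 0 := by omega
    by_contra hne
    have hl := div_ne_zero (hs.k_ne hq m) hx
    have h1 := hC (s.k q m / x) hl m 0 0 (by omega)
    rw [triC, laxD_zero hq hs hx, zero_mul, add_zero, colA_zero hq ht hr hy hw _ hl] at h1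
    exact mul_ne_zero (mul_ne_zero hx (hs.f_ne m (hχ _ _ _ hne).1))
      (mul_ne_zero (mul_ne_zero (hst m) (hsr m)) hne) h1
  | succ j ih =>
    intro a b c ha hbc
    set μ := s.k q a / x with hμ
    have hμ0 : μ ≠ 0 := div_ne_zero (hs.k_ne hq a) hx
    have key : ∀ c : ℂ, c ≠ 0 → c ^ 2 ≠ 1 → ∀ b' c', b' + c' = j →
        colC q t r y w (c * μ) (χ a) b' c' = 0 := by
      intro d hd hd2 b' c' h'
      have h1 := hC (d * μ) (mul_ne_zero hd hμ0) a b' c' (by omega)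
      have h2 : colA q t r y w (d * μ) (χ (a + 1)) b' c' = 0 := by
        have h0 : ∀ z' w', z' + w' = b' + c' → χ (a + 1) z' w' = 0 := fun z' w' h =>
          ih _ _ _ (by omega) (by omega)
        rw [colA_apply, weightOp_apply, weightInvOp_apply, local_monA _ _ _ _ h0, h0 _ _ rfl]
        simp
      rw [triC, h2, mul_zero, zero_add] at h1
      exact (mul_eq_zero.mp h1).resolve_left (laxD_ne hq hs hx a d hd hd2)
    have hEF : ∀ b' c', b' + c' = j → raiseOp q t r (χ a) b' c' = 0 ∧
        affOp q t r (y / w) (χ a) b' c' = 0 := by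
      intro b' c' h'
      -- Two spectral parameters separate the coefficients of `l` and `l⁻¹` in `colC`: three times
      -- the relation at `3 * μ` minus twice the one at `2 * μ` leaves `5 * μ * y * w` times
      -- `raiseOp`.
      have h2 := key 2 two_ne_zero (by norm_num) b' c' h'
      have h3 := key 3 three_ne_zero (by norm_num) b' c' h'
      rw [colC_apply] at h2 h3
      have e1 : raiseOp q t r (χ a) b' c' = 0 := by
        have : (5 : ℂ) * μ * y * w * raiseOp q t r (χ a) b' c' = 0 := by
          linear_combination (norm := (field_simp; ring)) 3 * h3 - 2 * h2
        exact (mul_eq_zero.mp this).resolve_left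
          (mul_ne_zero (mul_ne_zero (mul_ne_zero (by norm_num) hμ0) hy) hw)
      refine ⟨e1, ?_⟩
      rw [e1, mul_zero, zero_sub, neg_eq_zero] at h2
      exact (mul_eq_zero.mp h2).resolve_left (inv_ne_zero (mul_ne_zero two_ne_zero hμ0))
    exact pair_kernel hq ht hr hy hw htr (hχ.slice a) (fun b c h => (hEF b c h).1)
      (fun b c h => (hEF b c h).2) c b hbc

end kernel

section commute
variable (hq : q ≠ 0) (hs : s.IsRep q) (ht : t.IsRep q) (hr : r.IsRep q) (hx : x ≠ 0) (hy : y ≠ 0)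
  (hw : w ≠ 0) (hl : l ≠ 0)

lemma triC_lift23 {R : (ℕ → ℕ → ℂ) →ₗ[ℂ] (ℕ → ℕ → ℂ)} (hR : Intertwiner q t r y w R)
    (hl : l ≠ 0) {φ : ℕ → ℕ → ℕ → ℂ} (h : Supp3 s t r φ) :
    lift23 R (triC q s t r x y w l φ) = triC q s r t x w y l (lift23 R φ) := by
  ext a b c
  have : triC q s t r x y w l φ a = (x * s.f a) • colA q t r y w l (φ (a + 1)) +
      laxD q s x l a • colC q t r y w l (φ a) := rfl
  rw [lift23, this, map_add, map_smul, map_smul, hR.A _ l hl (h.slice _),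
    hR.C _ l hl (h.slice _)]
  rfl

include hq hs ht hr hx hy hw hl

lemma triC_lift12 {R : (ℕ → ℕ → ℂ) →ₗ[ℂ] (ℕ → ℕ → ℂ)} (hR : Intertwiner q s t x y R)
    {φ : ℕ → ℕ → ℕ → ℂ} (h : Supp3 s t r φ) :
    lift12 R (triC q s t r x y w l φ) = triC q t s r y x w l (lift12 R φ) := by
  ext a b c
  have : (fun a b => triC q s t r x y w l φ a b c) =
      laxA q r w l c • colC q s t x y l (fun a b => φ a b c) +
      (w * r.f c) • colD q s t x y l (fun a b => φ a b (c + 1)) := by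
    ext a b
    rw [triC_apply_left hx hy hw hl hq hs ht hr]
    rfl
  rw [lift12, this, map_add, map_smul, map_smul, hR.C _ l hl (h.slice' _),
    hR.D _ l hl (h.slice' _), triC_apply_left hy hx hw hl hq ht hs hr]
  rfl

end commute

/-- The Yang–Baxter equation for generic spectral parameters. -/
theorem yangBaxter_of_intertwiners (hq : q ≠ 0) (hs : s.IsRep q) (ht : t.IsRep q) (hr : r.IsRep q)
    (hx : x ≠ 0) (hy : y ≠ 0) (hw : w ≠ 0)
    {Rrt Rrs Rts : (ℕ → ℕ → ℂ) →ₗ[ℂ] (ℕ → ℕ → ℂ)} (hrt : Intertwiner q r t w y Rrt)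
    (hrs : Intertwiner q r s w x Rrs) (hts : Intertwiner q t s y x Rts)
    (gst : ∀ a, laxA q t y (s.k q a / x) 0 ≠ 0)
    (gsr : ∀ a, laxA q r w (s.k q a / x) 0 ≠ 0) (gtr : ∀ a, laxA q r w (t.k q a / y) 0 ≠ 0)
    {φ : ℕ → ℕ → ℕ → ℂ} (hφ : Supp3 r t s φ) :
    lift12 Rts (lift23 Rrs (lift12 Rrt φ)) = lift23 Rrt (lift12 Rrs (lift23 Rts φ)) := by
  -- Induction on the level for all `φ` at once: the difference of the two sides in level `m + 1` is
  -- sent by `triC` to the difference for `triC φ` in level `m`, for every `l`.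
  suffices H : ∀ m, ∀ φ, Supp3 r t s φ → ∀ a b c, a + (b + c) = m →
      lift12 Rts (lift23 Rrs (lift12 Rrt φ)) a b c =
        lift23 Rrt (lift12 Rrs (lift23 Rts φ)) a b c by
    ext a b c; exact H _ φ hφ a b c rfl
  intro m
  induction m with
  | zero =>
    intro φ hφ a b c h
    obtain rfl : a = 0 := by omega
    obtain rfl : b = 0 := by omega
    obtain rfl : c = 0 := by omega
    simp only [lift12, lift23, hrt.zero, hrs.zero, hts.zero]
  | succ m ih =>
    intro φ hφ a b c h
    rw [← sub_eq_zero]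
    have s1 : Supp3 t r s (lift12 Rrt φ) := supp3_lift12 hrt hφ
    have s2 : Supp3 t s r (lift23 Rrs (lift12 Rrt φ)) := supp3_lift23 hrs s1
    have s3 : Supp3 s t r (lift12 Rts (lift23 Rrs (lift12 Rrt φ))) := supp3_lift12 hts s2
    have s1' : Supp3 r s t (lift23 Rts φ) := supp3_lift23 hts hφ
    have s2' : Supp3 s r t (lift12 Rrs (lift23 Rts φ)) := supp3_lift12 hrs s1'
    have s3' : Supp3 s t r (lift23 Rrt (lift12 Rrs (lift23 Rts φ))) := supp3_lift23 hrt s2'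
    refine triple_kernel hq hs ht hr hx hy hw gst gsr gtr (χ := fun a b c =>
      lift12 Rts (lift23 Rrs (lift12 Rrt φ)) a b c
        - lift23 Rrt (lift12 Rrs (lift23 Rts φ)) a b c) (m := m) ?_ ?_ (b + c) a b c h rfl
    · intro a b c hne
      by_cases h0 : lift12 Rts (lift23 Rrs (lift12 Rrt φ)) a b c = 0
      · exact s3' a b c fun h1 => hne (by simp only [h0, h1, sub_zero])
      · exact s3 a b c h0
    · intro l hl a b c habc
      have hsupp : Supp3 r t s (triC q r t s w y x l φ) := by
        intro a b c hne
        rw [triC] at hne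
        by_cases h0 : colA q t s y x l (φ (a + 1)) b c = 0
        · have h1 : colC q t s y x l (φ a) b c ≠ 0 := fun h1 => hne (by rw [h0, h1]; simp)
          have hC : Supp t s (colC q t s y x l (φ a)) :=
            ((supp_raise (hφ.slice a)).smul _).sub ((supp_aff (hφ.slice a) _).smul _)
          refine ⟨?_, hC b c h1⟩
          by_contra hc
          have : φ a = 0 := by
            ext b c
            by_contra h'
            exact hc (hφ a b c h').1
          rw [this, map_zero] at h1
          exact h1 rfl
        · have hW : Supp t s (weightOp q t s (φ (a + 1))) := fun b c h =>
            hφ.slice _ b c (right_ne_zero_of_mul h)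
          have hWi : Supp t s (weightInvOp q t s (φ (a + 1))) := fun b c h =>
            hφ.slice _ b c (right_ne_zero_of_mul h)
          have hA : Supp t s (colA q t s y x l (φ (a + 1))) :=
            ((hW.smul _).add (hWi.smul _)).add (supp_monA ht (hφ.slice (a + 1)) _)
          refine ⟨?_, hA b c h0⟩
          by_contra hc
          have : φ (a + 1) = 0 := by
            ext b c
            by_contra h'
            exact hc (lt_of_succ_lt (hφ (a + 1) b c h').1)
          rw [this, map_zero] at h0
          exact h0 rfl
      have e := ih (triC q r t s w y x l φ) hsupp a b c habc
      rw [triC_lift12 hq hr ht hs hw hy hx hl hrt hφ, triC_lift23 hrs hl s1,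
        triC_lift12 hq ht hs hr hy hx hw hl hts s2, triC_lift23 hts hl hφ,
        triC_lift12 hq hr hs ht hw hx hy hl hrs s1', triC_lift23 hrt hl s2'] at e
      rw [← sub_eq_zero] at e
      rw [← e]
      have lin : ∀ F G : ℕ → ℕ → ℕ → ℂ, triC q s t r x y w l (fun a b c => F a b c - G a b c) a b c
          = triC q s t r x y w l F a b c - triC q s t r x y w l G a b c := by
        intro F G
        have e1 : (fun b c => F (a + 1) b c - G (a + 1) b c) = F (a + 1) - G (a + 1) := rfl
        have e2 : (fun b c => F a b c - G a b c) = F a - G a := rfl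
        simp only [triC]
        rw [e1, e2, map_sub, map_sub]
        simp only [Pi.sub_apply]
        ring
      exact lin _ _

namespace CGBasis

/-- The monodromy entries are Laurent polynomials in `l`. Their outer coefficients are built from
the coproducts of `E`, `K`, `K⁻¹`, which `rCheck` respects for any `g`; only the coefficients at `x
/ y`, which become those at `y / x`, need `hg`. -/
lemma intertwiner (B : CGBasis q s t) (B' : CGBasis q t s) (g : ℕ → ℂ)
    (hq : q ≠ 0) (hω : q - q⁻¹ ≠ 0) (hs : s.IsRep q) (ht : t.IsRep q) (hx : x ≠ 0) (hy : y ≠ 0)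
    (hB : B.Compat B') (h0 : g 0 * B.ψ 0 0 0 0 * B'.ψ 0 0 0 0 = 1)
    (hg : ∀ n, B.Ok (n + 1) → g (n + 1) * (y / x - x / y * (B.c n).k0 ^ 2) =
      g n * (x / y - y / x * (B.c n).k0 ^ 2)) : Intertwiner q s t x y (B.rCheck B' g) where
  supp φ := B.supp_rCheck B' g φ
  zero φ := by
    rw [rCheck_apply]
    simp only [add_zero, Nat.antidiagonal_zero, sum_singleton, pair]
    linear_combination φ 0 0 * h0
  C φ l hl hφ := by
    have hxy : x / y ≠ 0 := div_ne_zero hx hy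
    have := B.rCheck_aff B' g hq hω hs ht hxy (by simpa using hg) hB hφ
    rw [inv_div] at this
    simp only [colC, LinearMap.sub_apply, LinearMap.smul_apply, map_sub, map_smul, this,
      B.rCheck_raise B' g hq hω hs ht hB hφ]
    rw [mul_right_comm]
  A φ l hl hφ := by
    have hxy : x / y ≠ 0 := div_ne_zero hx hy
    have := B.rCheck_monA B' g hq hω hs ht hxy (by simpa using hg) hB hφ
    rw [inv_div] at this
    simp only [colA, LinearMap.add_apply, LinearMap.smul_apply, map_add, map_smul, this,
      B.weight_rCheck B' g hq hω hs ht, B.weightInv_rCheck B' g hq hω hs ht]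
    rw [mul_right_comm, mul_right_comm (l⁻¹ ^ 2)]
  D φ l hl hφ := by
    have hxy : x / y ≠ 0 := div_ne_zero hx hy
    have := B.rCheck_monD B' g hq hω hs ht hxy (by simpa using hg) hB hφ
    rw [inv_div] at this
    simp only [colD, LinearMap.add_apply, LinearMap.smul_apply, map_add, map_smul, this,
      B.weight_rCheck B' g hq hω hs ht, B.weightInv_rCheck B' g hq hω hs ht]
    rw [mul_right_comm, mul_right_comm (l⁻¹ ^ 2)]

end CGBasis

end ColoredIRF

/-! ### Labels as representations, and the consequences of regularity. -/

namespace ColoredIRF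
open Site

namespace Setup
variable (D : Setup)

/-- The properties of `q`, of the dimension and of the square roots common to both cases. -/
structure Proper : Prop where
  ω_ne : D.qpow 1 - (D.qpow 1)⁻¹ ≠ 0
  rt_sq : ∀ x, D.rt x ^ 2 = D.qnum x
  ne : ∀ j : ℕ, 0 < j → (j : ℕ∞) < D.M → D.qnum j ≠ 0
  top : ∀ j : ℕ, (j : ℕ∞) = D.M → D.qnum j = 0
  one_lt : 1 < D.M

lemma qpow_add (x y : ℂ) : D.qpow (x + y) = D.qpow x * D.qpow y := by
  simp only [qpow, mul_add, Complex.exp_add]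

lemma qpow_neg (x : ℂ) : D.qpow (-x) = (D.qpow x)⁻¹ := by
  simp only [qpow, mul_neg, Complex.exp_neg]

lemma qpow_sub (x y : ℂ) : D.qpow (x - y) = D.qpow x * (D.qpow y)⁻¹ := by
  rw [sub_eq_add_neg, qpow_add, qpow_neg]

lemma qpow_zero : D.qpow 0 = 1 := by simp [qpow]

lemma qpow_natCast (n : ℕ) : D.qpow n = D.qpow 1 ^ n := by
  simp only [qpow, mul_one, ← Complex.exp_nat_mul]; ring_nf

lemma qpow_two_mul (x : ℂ) : D.qpow (2 * x) = D.qpow x ^ 2 := by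
  rw [two_mul, qpow_add, pow_two]

lemma qpow_ne (x : ℂ) : D.qpow x ≠ 0 := Complex.exp_ne_zero _

lemma qnum_eq (x : ℂ) : D.qnum x = (D.qpow x - (D.qpow x)⁻¹) / (D.qpow 1 - (D.qpow 1)⁻¹) := by
  rw [qnum, qpow_neg, qpow_neg]

lemma qnum_zero : D.qnum 0 = 0 := by simp [qnum_eq, qpow_zero]

lemma qnum_add (x y : ℂ) :
    D.qnum (x + y) = D.qpow y * D.qnum x + (D.qpow x)⁻¹ * D.qnum y := by
  have h1 := D.qpow_ne x
  have h2 := D.qpow_ne y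
  rw [qnum_eq, qnum_eq, qnum_eq, qpow_add, mul_inv]
  field_simp
  ring

lemma qnum_add' (x y : ℂ) :
    D.qnum (x + y) = (D.qpow y)⁻¹ * D.qnum x + D.qpow x * D.qnum y := by
  rw [add_comm, qnum_add]; ring

variable {D}

lemma Proper.mul_qnum (P : D.Proper) (x : ℂ) :
    (D.qpow 1 - (D.qpow 1)⁻¹) * D.qnum x = D.qpow x - (D.qpow x)⁻¹ := by
  rw [qnum_eq, mul_div_cancel₀ _ P.ω_ne]

lemma Proper.qnum_one (P : D.Proper) : D.qnum 1 = 1 := by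
  rw [qnum_eq, div_self P.ω_ne]

lemma Proper.rt_ne (P : D.Proper) {x : ℂ} (h : D.qnum x ≠ 0) : D.rt x ≠ 0 := fun h0 =>
  h (by rw [← P.rt_sq, h0]; simp)

lemma Proper.rt_zero (P : D.Proper) {x : ℂ} (h : D.qnum x = 0) : D.rt x = 0 := by
  rw [← P.rt_sq] at h; exact pow_eq_zero_iff two_ne_zero |>.mp h

/-- In the infinite dimensional case `q` is not a root of unity, in the finite dimensional case
`[j]_q` vanishes exactly for the multiples of `N`. -/
lemma proper_of (hq : D.IsGenericCase ∨ D.IsRootCase) (hrt : ∀ x : ℂ, D.rt x ^ 2 = D.qnum x) :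
    D.Proper := by
  have hz : ∀ x : ℂ, D.qpow x - (D.qpow x)⁻¹ = 0 ↔ Complex.exp (2 * (D.h * x)) = 1 := fun x => by
    rw [two_mul, Complex.exp_add, sub_eq_zero, ← mul_eq_one_iff_eq_inv₀ (D.qpow_ne x)]
    rfl
  have hn : ∀ j : ℕ, D.qpow 1 - (D.qpow 1)⁻¹ ≠ 0 →
      (D.qnum j = 0 ↔ Complex.exp (2 * (D.h * j)) = 1) := fun j h => by
    rw [qnum_eq, div_eq_zero_iff, hz]; simp [h]
  rcases hq with ⟨hM, hq⟩ | ⟨N, s, hN, hc, hM, hh⟩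
  · have h1 : ∀ j : ℕ, 0 < j → Complex.exp (2 * (D.h * j)) ≠ 1 := fun j hj h => by
      apply hq (2 * j) (by omega)
      rw [← Complex.exp_nat_mul, ← h]
      congr 1
      push_cast; ring
    have hω : D.qpow 1 - (D.qpow 1)⁻¹ ≠ 0 := fun h => h1 1 one_pos (by simpa using (hz 1).mp h)
    exact ⟨hω, hrt, fun j hj _ h => h1 j hj ((hn j hω).mp h), fun j h => by simp [hM] at h,
      by simp [hM]⟩
  · have hN0 : (N : ℂ) ≠ 0 := by exact_mod_cast (by omega : N ≠ 0)
    have h1 : ∀ j : ℕ, Complex.exp (2 * (D.h * j)) = 1 ↔ N ∣ j := fun j => by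
      rw [Complex.exp_eq_one_iff]
      have hpi : (2 * (Real.pi : ℂ) * Complex.I) ≠ 0 := Complex.two_pi_I_ne_zero
      constructor
      · rintro ⟨m, hm⟩
        have e : (s : ℂ) * j = m * N := by
          apply mul_left_cancel₀ hpi
          rw [hh] at hm
          field_simp at hm ⊢
          linear_combination hm
        have e' : s * j = m * N := by exact_mod_cast e
        exact Int.natCast_dvd_natCast.mp (hc.dvd_of_dvd_mul_left ⟨m, by rw [e', mul_comm]⟩)
      · rintro ⟨m, rfl⟩
        refine ⟨s * m, ?_⟩
        rw [hh]
        push_cast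
        field_simp
    have hω : D.qpow 1 - (D.qpow 1)⁻¹ ≠ 0 := fun h => by
      have := (h1 1).mp (by simpa using (hz 1).mp h)
      have := Nat.le_of_dvd one_pos this
      omega
    refine ⟨hω, hrt, fun j hj hjM h => ?_, fun j h => ?_, ?_⟩
    · have := Nat.le_of_dvd hj ((h1 j).mp ((hn j hω).mp h))
      rw [hM] at hjM
      have : j < N := by exact_mod_cast hjM
      omega
    · rw [hM] at h
      obtain rfl : j = N := by exact_mod_cast h
      exact (hn j hω).mpr ((h1 j).mpr dvd_rfl)
    · rw [hM]; exact_mod_cast hN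

variable (D)

/-- The representation with a given label. -/
noncomputable def site (a : ColorRep) : Site where
  k0 := D.qpow a.val
  f z := D.rt (z + 1) * D.rt (2 * a.val - z)
  d := D.dim a

variable {D}

lemma lt_dim_spin {n k : ℕ} : (n : ℕ∞) < D.dim (.spin k) ↔ n < k + 1 := Nat.cast_lt

lemma dim_le (a : ColorRep) (ha : D.Regular a) : D.dim a ≤ D.M := by
  cases a with
  | color p => exact le_rfl
  | spin k =>
    refine le_trans ?_ ha
    simp only [dim]
    exact_mod_cast Nat.le_succ _

variable (P : D.Proper)
include P

/-- Common source of the nonvanishing statements: a regular color allows every integral shift, and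
for a spin the hypothesis keeps the argument strictly between `0` and `M`, where `[j]_q` has no
zero. -/
lemma Proper.qnum_regular {a : ColorRep} (ha : D.Regular a) (m : ℤ)
    (h : ∀ k, a = .spin k → 0 < (k : ℤ) + m ∧ (((k : ℤ) + m).toNat : ℕ∞) < D.M) :
    D.qnum (2 * a.val + m) ≠ 0 := by
  cases a with
  | color p => exact ha m
  | spin k =>
    obtain ⟨h1, h2⟩ := h k rfl
    have := P.ne _ (by omega) h2
    have e : (((k : ℤ) + m).toNat : ℂ) = 2 * (ColorRep.spin k).val + m := by
      have : (((k : ℤ) + m).toNat : ℤ) = (k : ℤ) + m := Int.toNat_of_nonneg h1.le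
      have : (((k : ℤ) + m).toNat : ℂ) = (k : ℂ) + m := by exact_mod_cast this
      rw [this, ColorRep.val]
      ring
    rwa [e] at this

lemma Proper.rt_succ_ne {a : ColorRep} (ha : D.Regular a) {z : ℕ}
    (hz : ((z + 1 : ℕ) : ℕ∞) < D.dim a) : D.rt (z + 1) ≠ 0 :=
  P.rt_ne (by exact_mod_cast P.ne (z + 1) z.succ_pos (lt_of_lt_of_le hz (dim_le a ha)))

lemma Proper.rt_sub_ne {a : ColorRep} (ha : D.Regular a) {z : ℕ}
    (hz : ((z + 1 : ℕ) : ℕ∞) < D.dim a) : D.rt (2 * a.val - z) ≠ 0 := by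
  apply P.rt_ne
  have := P.qnum_regular ha (-z) fun k hk => by
    subst hk
    have h1 : z + 1 < k + 1 := lt_dim_spin.mp hz
    refine ⟨by omega, lt_of_lt_of_le ?_ (show ((k + 2 : ℕ) : ℕ∞) ≤ D.M from ha)⟩
    exact_mod_cast (by omega : ((k : ℤ) + -z).toNat < k + 2)
  push_cast at this
  rwa [← sub_eq_add_neg] at this

/-- Here `f z ^ 2 = [z + 1][2 μ - z]`, and expanding this product gives the Casimir relation. A
finite dimensional color ends because `[N] = 0`, a spin because `2 j - z` reaches `0`. -/
lemma Proper.isRep {a : ColorRep} (ha : D.Regular a) : (D.site a).IsRep (D.qpow 1) where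
  k0_ne := D.qpow_ne _
  d_pos := by
    cases a with
    | color p => exact lt_trans zero_lt_one P.one_lt
    | spin k => exact (lt_dim_spin (D := D) (n := 0)).mpr k.succ_pos
  f_sq z := by
    have h1 := P.mul_qnum (z + 1)
    have h2 := P.mul_qnum (2 * a.val - z)
    have e : (D.qpow 1 - (D.qpow 1)⁻¹) ^ 2 * (D.site a).f z ^ 2 =
        ((D.qpow 1 - (D.qpow 1)⁻¹) * D.qnum (z + 1)) *
        ((D.qpow 1 - (D.qpow 1)⁻¹) * D.qnum (2 * a.val - z)) := by
      simp only [site, mul_pow, P.rt_sq]; ring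
    rw [e, h1, h2, qpow_add, qpow_sub, qpow_two_mul, qpow_natCast]
    simp only [site, Site.cas, Site.k, inv_pow]
    have := D.qpow_ne 1
    have := D.qpow_ne a.val
    field_simp
    ring
  f_ne z hz := mul_ne_zero (P.rt_succ_ne ha hz) (P.rt_sub_ne ha hz)
  f_top z hz := by
    cases a with
    | color p =>
      have := P.top (z + 1) hz
      simp only [site]
      rw [P.rt_zero (by exact_mod_cast this), zero_mul]
    | spin k =>
      have h1 : z + 1 = k + 1 := Nat.cast_injective hz
      obtain rfl : z = k := by omega
      have : (2 * (ColorRep.spin z).val - z : ℂ) = 0 := by rw [ColorRep.val]; ring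
      simp only [site]
      rw [this, P.rt_zero D.qnum_zero, mul_zero]

omit P

variable (D)

/-- The pairs of labels with a completely reducible regular tensor product. -/
def Good (a b : ColorRep) : Prop := D.Regular a ∧ D.Regular b ∧ D.Regular (a.add b)

variable {D} {a b : ColorRep} {n : ℕ}

end Setup

open Setup

variable {D : Setup} {a b : ColorRep} {n : ℕ}

lemma ColorRep.fuse_comm (a b : ColorRep) (n : ℕ) : a.fuse b n = b.fuse a n := by
  cases a <;> cases b <;> simp only [fuse, add_comm]

lemma Setup.Good.symm (h : D.Good a b) : D.Good b a :=
  ⟨h.2.1, h.1, by rw [ColorRep.add, ColorRep.fuse_comm]; exact h.2.2⟩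

lemma spin_bound {k l n : ℕ} (h1 : (n : ℕ∞) < D.dim (.spin k)) (h2 : (n : ℕ∞) < D.dim (.spin l)) :
    n ≤ k ∧ n ≤ l := by
  have h1 := lt_dim_spin.mp h1
  have h2 := lt_dim_spin.mp h2
  omega

lemma val_fuse (h1 : (n : ℕ∞) < D.dim a) (h2 : (n : ℕ∞) < D.dim b) :
    (a.fuse b n).val = a.val + b.val - n := by
  cases a <;> cases b <;> simp only [ColorRep.fuse, ColorRep.val]
  obtain ⟨h3, h4⟩ := spin_bound h1 h2
  rw [Nat.cast_sub (by omega)]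
  push_cast; ring

lemma val_add : (a.add b).val = a.val + b.val := by
  cases a <;> cases b <;> simp only [ColorRep.add, ColorRep.fuse, ColorRep.val] <;> push_cast <;>
    simp
  ring

lemma fuse_inj {m : ℕ} (h1 : (n : ℕ∞) < D.dim a) (h2 : (n : ℕ∞) < D.dim b)
    (h3 : (m : ℕ∞) < D.dim a) (h4 : (m : ℕ∞) < D.dim b) (h : a.fuse b n = a.fuse b m) : n = m := by
  have := congrArg ColorRep.val h
  rw [val_fuse h1 h2, val_fuse h3 h4] at this
  have : (n : ℂ) = m := by linear_combination -this
  exact_mod_cast this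

/-- Regularity of the leading summand suffices: for colors the shift by `2 n` is absorbed into the
arbitrary integer, for spins the label only decreases. -/
lemma regular_fuse (hab : D.Good a b) (h1 : (n : ℕ∞) < D.dim a) (h2 : (n : ℕ∞) < D.dim b) :
    D.Regular (a.fuse b n) := by
  obtain ⟨ha, hb, hc⟩ := hab
  cases a with
  | color p =>
    cases b with
    | color p' =>
      intro m
      have := hc (m - 2 * n)
      convert this using 2
      push_cast; ring
    | spin l =>
      intro m
      have := hc (m - 2 * n)
      convert this using 2
      push_cast; ring
  | spin k =>
    cases b with
    | color p' =>
      intro m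
      have := hc (m - 2 * n)
      convert this using 2
      push_cast; ring
    | spin l =>
      refine le_trans ?_ hc
      exact_mod_cast (by omega : k + l - 2 * n + 2 ≤ k + l - 2 * 0 + 2)

/-- This provides the field `dim_le`. A channel of dimension `M` would continue at level `n + M`,
beyond both factors; a spin channel in `j₁ ⊗ j₂` would continue at level `2 j₁ + 2 j₂ - n + 1`,
which exceeds `2 j₁` and `2 j₂`. -/
lemma fuse_dim_le (hab : D.Good a b) (h1 : (n : ℕ∞) < D.dim a) (h2 : (n : ℕ∞) < D.dim b) (k : ℕ)
    (hk : ((k + 1 : ℕ) : ℕ∞) = D.dim (a.fuse b n)) :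
    ¬(((n + (k + 1) : ℕ) : ℕ∞) < D.dim a ∧ ((n + (k + 1) : ℕ) : ℕ∞) < D.dim b) := by
  rintro ⟨h3, h4⟩
  by_cases hM : ((k + 1 : ℕ) : ℕ∞) = D.M
  · have := lt_of_lt_of_le h3 (dim_le a hab.1)
    rw [← hM] at this
    have : n + (k + 1) < k + 1 := by exact_mod_cast this
    omega
  · cases a <;> cases b <;> try exact hM hk
    obtain ⟨h5, h6⟩ := spin_bound h1 h2
    obtain ⟨h7, h8⟩ := spin_bound h3 h4
    rename_i k' l
    simp only [ColorRep.fuse, dim] at hk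
    have : k + 1 = k' + l - 2 * n + 1 := by exact_mod_cast hk
    omega

/-- These are the factors of the denominator `[2a + 2b - n + 1; z₁ + z₂ + 1]` in the Clebsch–Gordan
coefficients. -/
lemma Setup.Proper.rt_fuse_ne (P : D.Proper) (hab : D.Good a b) (h1 : (n : ℕ∞) < D.dim a)
    (h2 : (n : ℕ∞) < D.dim b) {j z : ℕ} (hz : (z : ℕ∞) < D.dim (a.fuse b n)) (hj : j ≤ n + z) :
    D.rt (2 * a.val + 2 * b.val - n + 1 - j) ≠ 0 := by
  apply P.rt_ne
  have := P.qnum_regular hab.2.2 (1 - n - j) fun K hK => by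
    cases a <;> cases b <;> simp only [ColorRep.add, ColorRep.fuse, reduceCtorEq] at hK
    rename_i k l
    obtain ⟨h5, h6⟩ := spin_bound h1 h2
    have hK : k + l - 2 * 0 = K := by simpa using hK
    have hz' : z < k + l - 2 * n + 1 := lt_dim_spin.mp hz
    refine ⟨by omega, lt_of_lt_of_le ?_ (show ((k + l - 2 * 0 + 2 : ℕ) : ℕ∞) ≤ D.M from hab.2.2)⟩
    exact_mod_cast (by omega : ((K : ℤ) + (1 - n - j)).toNat < k + l - 2 * 0 + 2)
  rw [val_add] at this
  convert this using 2
  push_cast; ring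

/-- The source of `Compat.nondeg`: with `κ = q ^ c`, the quantity there is a nonzero multiple of
`[2c + 2]`. -/
lemma Setup.Proper.nondeg (P : D.Proper) (hab : D.Good a b) (h1 : ((n + 1 : ℕ) : ℕ∞) < D.dim a)
    (h2 : ((n + 1 : ℕ) : ℕ∞) < D.dim b) : D.qnum (2 * (a.fuse b (n + 1)).val + 2) ≠ 0 := by
  have := P.qnum_regular hab.2.2 (-2 * n) fun K hK => by
    cases a <;> cases b <;> simp only [ColorRep.add, ColorRep.fuse, reduceCtorEq] at hK
    rename_i k l
    obtain ⟨h5, h6⟩ := spin_bound h1 h2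
    have hK : k + l - 2 * 0 = K := by simpa using hK
    refine ⟨by omega, lt_of_lt_of_le ?_ (show ((k + l - 2 * 0 + 2 : ℕ) : ℕ∞) ≤ D.M from hab.2.2)⟩
    exact_mod_cast (by omega : ((K : ℤ) + (-2 * n)).toNat < k + l - 2 * 0 + 2)
  rw [val_add] at this
  rw [val_fuse h1 h2]
  convert this using 2
  push_cast; ring

end ColoredIRF

/-! ### Identities between q-numbers for the Clebsch–Gordan sums. -/

namespace ColoredIRF
namespace Setup

variable (D : Setup)

/-- The descending product `[x]_q [x-1]_q ⋯ [x-n+1]_q`. -/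
noncomputable def fall (x : ℂ) (n : ℕ) : ℂ := ∏ k ∈ range n, D.qnum (x - k)

/-- The ascending product `[x]_q [x+1]_q ⋯ [x+n-1]_q`. -/
noncomputable def rise (x : ℂ) (n : ℕ) : ℂ := ∏ k ∈ range n, D.qnum (x + k)

/-- The reciprocal of `[i]_q !`, which is `0` for negative `i`. -/
noncomputable def rfact (i : ℤ) : ℂ := if 0 ≤ i then (D.qfact i.toNat)⁻¹ else 0

lemma fall_succ (x : ℂ) (n : ℕ) : D.fall x (n + 1) = D.fall x n * D.qnum (x - n) :=
  prod_range_succ _ _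

lemma rise_succ (x : ℂ) (n : ℕ) : D.rise x (n + 1) = D.rise x n * D.qnum (x + n) :=
  prod_range_succ _ _

lemma rtFall_succ (x : ℂ) (n : ℕ) : D.rtFall x (n + 1) = D.rtFall x n * D.rt (x - n) :=
  prod_range_succ _ _

lemma rtFall_zero (x : ℂ) : D.rtFall x 0 = 1 := prod_range_zero _

lemma rtFall_add (x : ℂ) (m n : ℕ) :
    D.rtFall x (m + n) = D.rtFall x m * D.rtFall (x - m) n := by
  rw [rtFall, rtFall, rtFall, prod_range_add]
  congr 1
  exact prod_congr rfl fun k _ => by push_cast; ring_nf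

lemma rtFall_succ' (x : ℂ) (n : ℕ) : D.rtFall x (n + 1) = D.rt x * D.rtFall (x - 1) n := by
  rw [add_comm, rtFall_add, rtFall_succ, rtFall_zero]
  simp

lemma rtFact_succ (n : ℕ) : D.rtFact (n + 1) = D.rt (n + 1) * D.rtFact n := by
  rw [rtFact, rtFall_succ', rtFact]
  simp

lemma qfact_succ (n : ℕ) : D.qfact (n + 1) = D.qfact n * D.qnum (n + 1) :=
  prod_range_succ _ _

lemma qfact_zero : D.qfact 0 = 1 := prod_range_zero _

lemma fall_eq_rise (x : ℂ) (n : ℕ) : D.fall x n = D.rise (x - n + 1) n := by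
  rw [fall, rise, ← prod_range_reflect]
  refine prod_congr rfl fun k hk => ?_
  rw [mem_range] at hk
  rw [Nat.sub_sub, Nat.cast_sub (by omega)]
  push_cast
  ring_nf

lemma rfact_natCast (n : ℕ) : D.rfact n = (D.qfact n)⁻¹ := by simp [rfact]

lemma rfact_neg {i : ℤ} (h : i < 0) : D.rfact i = 0 := if_neg (by omega)

lemma qnum_mul_rfact (i : ℤ) (h : 0 < i → D.qnum i ≠ 0) : D.qnum i * D.rfact i = D.rfact (i - 1) := by
  rcases lt_trichotomy i 0 with hi | hi | hi
  · rw [rfact_neg _ hi, rfact_neg _ (by omega), mul_zero]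
  · subst hi
    simp [qnum_zero, rfact]
  · obtain ⟨n, rfl⟩ : ∃ n : ℕ, i = n + 1 := ⟨(i - 1).toNat, by omega⟩
    have h := h hi
    have e : ((n : ℤ) + 1 - 1) = n := by ring
    have e' : ((n : ℤ) + 1) = (n + 1 : ℕ) := by push_cast; ring
    rw [e, rfact_natCast, e', rfact_natCast, qfact_succ, mul_inv]
    push_cast at h ⊢
    field_simp

variable {D}

lemma Proper.rtFall_sq (P : D.Proper) (x : ℂ) (n : ℕ) : D.rtFall x n ^ 2 = D.fall x n := by
  rw [rtFall, fall, ← prod_pow]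
  exact prod_congr rfl fun _ _ => P.rt_sq _

lemma Proper.rtFact_sq (P : D.Proper) (n : ℕ) : D.rtFact n ^ 2 = D.qfact n := by
  induction n with
  | zero => simp [rtFact, rtFall, qfact]
  | succ n ih => rw [rtFact_succ, mul_pow, ih, P.rt_sq, qfact_succ]; ring

variable (D)

/-- The terms of the sum in the Clebsch–Gordan coefficients, with common denominators removed. -/
noncomputable def cgTerm (α β : ℂ) (n : ℕ) (z w : ℤ) (ν : ℕ) : ℂ :=
  (-1) ^ ν * D.qpow (-((ν : ℂ) * (2 * α + 2 * β - n + 1)))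
    * (D.fall (2 * α) (n + z - ν).toNat * D.fall (2 * β) (w + ν).toNat)
    * (D.rfact ν * D.rfact (n - ν) * D.rfact (z - ν) * D.rfact (w + ν - n))

/-- The prefactor of the sum in the Clebsch–Gordan coefficients. -/
noncomputable def cgPre (α β : ℂ) (n z w y : ℕ) : ℂ :=
  D.rt (2 * α + 2 * β - 2 * n + 1) * (D.rtFact n * D.rtFact z * D.rtFact w * D.rtFact y)
    * D.qpow (((n : ℂ) - (n : ℂ) ^ 2) / 2 + ((n : ℂ) - w) * α + ((n : ℂ) + z) * β)
    / (D.rtFall (2 * α) n * D.rtFall (2 * α) z * (D.rtFall (2 * β) n * D.rtFall (2 * β) w)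
      * D.rtFall (2 * α + 2 * β - n + 1) (z + w + 1))

variable {D}

/-- Each of the two root products in a summand is completed, by a factor independent of `k`, to the
same product of `n + z - k` roots. The result is a square, so no choice of roots is left. -/
lemma Proper.rtFall_mul (P : D.Proper) (x : ℂ) (n z k : ℕ) (hk : k ≤ n) (hk' : k ≤ z) :
    D.rtFall x n * D.rtFall x z * (D.rtFall (x - n) (z - k) * D.rtFall (x - z) (n - k)) =
      D.fall x (n + z - k) := by
  have e1 := D.rtFall_add x n (z - k)
  have e2 := D.rtFall_add x z (n - k)
  have e3 : n + (z - k) = n + z - k := by omega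
  have e4 : z + (n - k) = n + z - k := by omega
  rw [e3] at e1
  rw [e4] at e2
  rw [← P.rtFall_sq, pow_two]
  nth_rewrite 1 [e1]
  rw [e2]
  ring

lemma div_div_mul_rearrange {R Q s a b c d t₁ t₂ t₃ t₄ K h₁ h₂ h₃ h₄ : ℂ} (e₁ : h₁ ≠ 0) (e₂ : h₂ ≠ 0)
    (e₃ : h₃ ≠ 0) (e₄ : h₄ ≠ 0) :
    R * Q * (s / (a * b * c * d) * (t₁ * t₂ * t₃ * t₄ / K)) =
      R * Q / (h₁ * h₂ * (h₃ * h₄) * K) *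
        (s * (h₁ * h₂ * (t₁ * t₂) * (h₃ * h₄ * (t₃ * t₄))) * (a⁻¹ * b⁻¹ * c⁻¹ * d⁻¹)) := by
  have e : h₁⁻¹ * h₂⁻¹ * h₃⁻¹ * h₄⁻¹ * (h₁ * h₂ * h₃ * h₄) = 1 := by
    field_simp
  simp only [div_eq_mul_inv, mul_inv]
  linear_combination -(R * Q * s * (a⁻¹ * b⁻¹ * c⁻¹ * d⁻¹) * (t₁ * t₂ * t₃ * t₄ * K⁻¹)) * e

/-- All square roots are moved to the prefactor, so the remaining sum obeys rational identities. Its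
range can be `0, …, n`, because reciprocal factorials of negative integers are set to zero. -/
lemma Proper.cgFormula_eq (P : D.Proper) (α β : ℂ) (n z w y : ℕ) (h1 : D.rtFall (2 * α) n ≠ 0)
    (h2 : D.rtFall (2 * α) z ≠ 0) (h3 : D.rtFall (2 * β) n ≠ 0) (h4 : D.rtFall (2 * β) w ≠ 0) :
    D.cgFormula α β n z w y =
      D.cgPre α β n z w y * ∑ ν ∈ range (n + 1), D.cgTerm α β n z w ν := by
  have hsub : ∑ ν ∈ range (n + 1), D.cgTerm α β n z w ν =
      ∑ ν ∈ Icc (n - w) (min n z), D.cgTerm α β n z w ν := by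
    symm
    refine sum_subset (fun ν hν => ?_) fun ν hν hν' => ?_
    · simp only [mem_Icc, le_min_iff, mem_range] at hν ⊢
      omega
    · simp only [mem_Icc, le_min_iff, mem_range, not_and_or, not_le] at hν hν'
      have : (z : ℤ) - ν < 0 ∨ (w : ℤ) + ν - n < 0 := by omega
      rcases this with h | h <;> rw [cgTerm, rfact_neg _ h] <;> ring
  rw [hsub, cgFormula, cgPre, mul_sum, mul_sum]
  refine sum_congr rfl fun ν hν => ?_
  simp only [mem_Icc, le_min_iff] at hν
  have e1 : D.rfact ((n : ℤ) - ν) = (D.qfact (n - ν))⁻¹ := by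
    rw [← Nat.cast_sub hν.2.1, rfact_natCast]
  have e2 : D.rfact ((z : ℤ) - ν) = (D.qfact (z - ν))⁻¹ := by
    rw [← Nat.cast_sub hν.2.2, rfact_natCast]
  have e3 : D.rfact ((w : ℤ) + ν - n) = (D.qfact (w + ν - n))⁻¹ := by
    rw [← rfact_natCast]; congr 1; omega
  have e4 : ((n : ℤ) + z - ν).toNat = n + z - ν := by omega
  have e5 : ((w : ℤ) + ν).toNat = n + w - (n - ν) := by omega
  have f1 := P.rtFall_mul (2 * α) n z ν hν.2.1 hν.2.2
  have f2 := P.rtFall_mul (2 * β) n w (n - ν) (by omega) (by omega)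
  have e6 : w - (n - ν) = w + ν - n := by omega
  have e7 : n - (n - ν) = ν := by omega
  rw [e6, e7] at f2
  rw [cgTerm, rfact_natCast, e1, e2, e3, e4, e5, ← f1, ← f2]
  exact div_div_mul_rearrange h1 h2 h3 h4

section recursion
variable (α β : ℂ) (n : ℕ) (z w : ℤ)
  (hz : ∀ ν ≤ n, 0 < z - ν → D.qnum ((z : ℂ) - ν) ≠ 0)
  (hw : ∀ ν ≤ n, 0 < w + ν - n → D.qnum ((w : ℂ) + ν - n) ≠ 0)
  (hn : ∀ ν ≤ n, 0 < ν → D.qnum (ν : ℂ) ≠ 0)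

lemma cgTerm_left (ν : ℕ) (hz : 0 < z - ν → D.qnum ((z : ℂ) - ν) ≠ 0) :
    D.qnum (2 * α - (n + z - ν) + 1) * D.cgTerm α β n (z - 1) w ν =
      D.qnum (z - ν) * D.cgTerm α β n z w ν := by
  have e := D.qnum_mul_rfact (z - ν) (by push_cast; exact hz)
  push_cast at e
  have e0 : z - 1 - ν = z - ν - 1 := by ring
  by_cases hc : 0 < (n : ℤ) + z - ν
  · have e1 : ((n : ℤ) + z - ν).toNat = (n + (z - 1) - ν : ℤ).toNat + 1 := by omega
    have e2 : (((n + (z - 1) - ν : ℤ).toNat : ℕ) : ℂ) = n + z - 1 - ν := by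
      have : (((n + (z - 1) - ν : ℤ).toNat : ℕ) : ℤ) = n + z - 1 - ν := by omega
      exact_mod_cast this
    rw [cgTerm, cgTerm, e1, fall_succ, e0, ← e, e2]
    ring_nf
  · have e3 : D.rfact (z - ν - 1) = 0 := rfact_neg _ (by omega)
    rw [e3] at e
    rw [cgTerm, cgTerm, e0, e3]
    linear_combination -((-1) ^ ν * D.qpow (-((ν : ℂ) * (2 * α + 2 * β - n + 1)))
    * (D.fall (2 * α) (n + z - ν).toNat * D.fall (2 * β) (w + ν).toNat)
    * (D.rfact ν * D.rfact (n - ν) * D.rfact (w + ν - n))) * e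

lemma cgTerm_right (ν : ℕ) (hw : 0 < w + ν - n → D.qnum ((w : ℂ) + ν - n) ≠ 0) :
    D.qnum (2 * β - (w + ν) + 1) * D.cgTerm α β n z (w - 1) ν =
      D.qnum (w + ν - n) * D.cgTerm α β n z w ν := by
  have e := D.qnum_mul_rfact (w + ν - n) (by push_cast; exact hw)
  push_cast at e
  have e0 : w - 1 + ν - n = w + ν - n - 1 := by ring
  by_cases hc : 0 < (w : ℤ) + ν
  · have e1 : ((w : ℤ) + ν).toNat = (w - 1 + ν : ℤ).toNat + 1 := by omega
    have e2 : (((w - 1 + ν : ℤ).toNat : ℕ) : ℂ) = w - 1 + ν := by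
      have : (((w - 1 + ν : ℤ).toNat : ℕ) : ℤ) = w - 1 + ν := by omega
      exact_mod_cast this
    rw [cgTerm, cgTerm, e1, fall_succ, e0, ← e, e2]
    ring_nf
  · have e3 : D.rfact (w + ν - n - 1) = 0 := rfact_neg _ (by omega)
    rw [e3] at e
    rw [cgTerm, cgTerm, e0, e3]
    linear_combination -((-1) ^ ν * D.qpow (-((ν : ℂ) * (2 * α + 2 * β - n + 1)))
    * (D.fall (2 * α) (n + z - ν).toNat * D.fall (2 * β) (w + ν).toNat)
    * (D.rfact ν * D.rfact (n - ν) * D.rfact (z - ν))) * e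

/-- The two terms have the same falling products, as `n + z - (ν + 1) = n + (z - 1) - ν` and `(w -
1) + (ν + 1) = w + ν`. Only the sign, a power of `q` and the factorials of `ν` and `n - ν` change;
this is what makes the recursion telescope. -/
lemma cgTerm_shift (ν : ℕ) (hn : D.qnum ((ν : ℂ) + 1) ≠ 0)
    (hn' : D.qnum ((n : ℂ) - ν) ≠ 0) :
    D.qpow z * D.qpow (2 * β - w - ν) * D.qnum (ν + 1) * D.cgTerm α β n z (w - 1) (ν + 1) =
    -((D.qpow w)⁻¹ * (D.qpow (2 * α - (n + z - ν) + 1))⁻¹ * D.qnum (n - ν)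
      * D.cgTerm α β n (z - 1) w ν) := by
  have e := D.qnum_mul_rfact (ν + 1) (by push_cast; exact fun _ => hn)
  have e' := D.qnum_mul_rfact (n - ν) (by push_cast; exact fun _ => hn')
  push_cast at e e'
  have e0 : (n : ℤ) - (ν + 1 : ℕ) = n - ν - 1 := by push_cast; ring
  have e1 : (n : ℤ) + z - (ν + 1 : ℕ) = n + (z - 1) - ν := by push_cast; ring
  have e2 : w - 1 + (ν + 1 : ℕ) = w + ν := by push_cast; ring
  have e3 : z - (ν + 1 : ℕ) = z - 1 - ν := by push_cast; ring
  rw [add_sub_cancel_right] at e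
  have e5 : D.rfact ((ν + 1 : ℕ) : ℤ) = D.rfact ((ν : ℤ) + 1) := by push_cast; rfl
  rw [cgTerm, cgTerm, e0, e1, e2, e3, ← e, ← e', e5]
  have q1 : D.qpow (-(((ν + 1 : ℕ) : ℂ) * (2 * α + 2 * β - n + 1))) =
      D.qpow (-((ν : ℂ) * (2 * α + 2 * β - n + 1))) * (D.qpow (2 * α + 2 * β - n + 1))⁻¹ := by
    rw [← qpow_neg, ← qpow_add]; congr 1; push_cast; ring
  have q2 : D.qpow z * D.qpow (2 * β - w - ν) * (D.qpow (2 * α + 2 * β - n + 1))⁻¹ =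
      (D.qpow w)⁻¹ * (D.qpow (2 * α - (n + z - ν) + 1))⁻¹ := by
    rw [← qpow_neg, ← qpow_neg, ← qpow_neg, ← qpow_add, ← qpow_add, ← qpow_add]
    congr 1; ring
  rw [q1, ← q2]
  ring

include hz hw hn

/-- The recursion relation for the sums in the Clebsch–Gordan coefficients, which expresses that
they intertwine the lowering operators. -/
lemma sum_cgTerm_recursion :
    (D.qpow w)⁻¹ * D.qnum (2 * α - z + 1) * ∑ ν ∈ range (n + 1), D.cgTerm α β n (z - 1) w ν +
    D.qpow z * D.qnum (2 * β - w + 1) * ∑ ν ∈ range (n + 1), D.cgTerm α β n z (w - 1) ν =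
    D.qnum (z + w - n) * ∑ ν ∈ range (n + 1), D.cgTerm α β n z w ν := by
  -- `r1` and `r2` are the remainders when the `q`-numbers on the left are split off `[n - ν]` and
  -- `[ν]` by the addition formula. `r1 ν` cancels `r2 (ν + 1)`, and the two unpaired ends contain
  -- `[0]`.
  set r1 : ℕ → ℂ := fun ν => (D.qpow w)⁻¹ * (D.qpow (2 * α - (n + z - ν) + 1))⁻¹ * D.qnum (n - ν)
      * D.cgTerm α β n (z - 1) w ν with hr1
  set r2 : ℕ → ℂ := fun ν => D.qpow z * D.qpow (2 * β - (w + ν) + 1) * D.qnum ν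
      * D.cgTerm α β n z (w - 1) ν with hr2
  have key : ∀ ν ∈ range (n + 1), (D.qpow w)⁻¹ * D.qnum (2 * α - z + 1) *
      D.cgTerm α β n (z - 1) w ν + D.qpow z * D.qnum (2 * β - w + 1) * D.cgTerm α β n z (w - 1) ν =
      D.qnum (z + w - n) * D.cgTerm α β n z w ν + (r1 ν + r2 ν) := by
    intro ν hν
    have hν : ν ≤ n := Nat.lt_succ_iff.mp (mem_range.mp hν)
    have a1 := D.qnum_add (2 * α - (n + z - ν) + 1) (n - ν)
    have a2 := D.qnum_add' (2 * β - (w + ν) + 1) ν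
    have a3 := D.qnum_add' (z - ν) (w + ν - n)
    have b1 : (2 * α - (n + z - ν) + 1) + (n - ν) = 2 * α - z + 1 := by ring
    have b2 : (2 * β - (w + ν) + 1) + (ν : ℂ) = 2 * β - w + 1 := by ring
    have b3 : (z - ν) + (w + ν - n) = (z + w - n : ℂ) := by ring
    rw [b1] at a1
    rw [b2] at a2
    rw [b3] at a3
    have c1 := cgTerm_left (D := D) α β n z w ν (hz ν hν)
    have c2 := cgTerm_right (D := D) α β n z w ν (hw ν hν)
    have d1 : (D.qpow (w + ν - n))⁻¹ = (D.qpow w)⁻¹ * D.qpow (n - ν) := by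
      rw [← qpow_neg, ← qpow_neg, ← qpow_add]; congr 1; ring
    have d2 : D.qpow (z - ν) = D.qpow z * (D.qpow ν)⁻¹ := D.qpow_sub _ _
    rw [d1, d2] at a3
    rw [a1, a2, a3, hr1, hr2]
    linear_combination (D.qpow w)⁻¹ * D.qpow (n - ν) * c1 + D.qpow z * (D.qpow ν)⁻¹ * c2
  rw [mul_sum, mul_sum, ← sum_add_distrib, sum_congr rfl key, sum_add_distrib, mul_sum]
  suffices h : ∑ ν ∈ range (n + 1), (r1 ν + r2 ν) = 0 by rw [h, add_zero]
  rw [sum_add_distrib, sum_range_succ, sum_range_succ' (f := r2)]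
  have h1 : r1 n = 0 := by simp [hr1, qnum_zero]
  have h2 : r2 0 = 0 := by simp [hr2, qnum_zero]
  rw [h1, h2, add_zero, add_zero, ← sum_add_distrib]
  refine sum_eq_zero fun ν hν => ?_
  have hν := mem_range.mp hν
  have := cgTerm_shift (D := D) α β n z w ν (by exact_mod_cast hn (ν + 1) hν ν.succ_pos)
    (by have := hn (n - ν) (by omega) (by omega); rwa [Nat.cast_sub hν.le] at this)
  simp only [hr1, hr2]
  have e : (2 * β - (w + ((ν + 1 : ℕ) : ℂ)) + 1) = 2 * β - w - ν := by push_cast; ring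
  rw [e]
  push_cast at this ⊢
  linear_combination this

end recursion

/-- The `q`-Vandermonde summation. -/
lemma sum_vandermonde (x y : ℂ) (n : ℕ)
    (hn : ∀ i ≤ n, 0 < i → D.qnum (i : ℂ) ≠ 0) :
    D.qfact n * ∑ p ∈ antidiagonal n, D.qpow (p.2 * y - p.1 * x)
      * (D.rise x p.2 * D.rise y p.1 / (D.qfact p.1 * D.qfact p.2)) = D.rise (x + y) n := by
  induction n with
  | zero => simp [qfact, rise, qpow_zero]
  | succ n ih =>
    have hq : ∀ i ≤ n + 1, D.qfact i ≠ 0 := fun i hi => prod_ne_zero_iff.mpr fun k hk => by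
      have := hn (k + 1) (by have := mem_range.mp hk; omega) k.succ_pos
      exact_mod_cast this
    have ih := ih fun i hi => hn i (by omega)
    rw [rise_succ, ← ih, qfact_succ, mul_assoc, mul_assoc]
    congr 1
    -- A `q`-Pascal step: `[n + 1] = [p.2 + p.1]` is split by the addition formula, and each part
    -- lowers one of the two factorials.
    have hsplit : D.qnum (n + 1) * ∑ p ∈ antidiagonal (n + 1), D.qpow (p.2 * y - p.1 * x)
      * (D.rise x p.2 * D.rise y p.1 / (D.qfact p.1 * D.qfact p.2)) =
      (∑ p ∈ antidiagonal (n + 1), D.qpow (p.2 * y - p.1 * x) * D.qpow p.1 * D.qnum p.2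
      * (D.rise x p.2 * D.rise y p.1 / (D.qfact p.1 * D.qfact p.2))) +
      ∑ p ∈ antidiagonal (n + 1), D.qpow (p.2 * y - p.1 * x) * (D.qpow p.2)⁻¹ * D.qnum p.1
      * (D.rise x p.2 * D.rise y p.1 / (D.qfact p.1 * D.qfact p.2)) := by
      rw [mul_sum, ← sum_add_distrib]
      refine sum_congr rfl fun p hp => ?_
      have h := HasAntidiagonal.mem_antidiagonal.mp hp
      have : (n : ℂ) + 1 = p.2 + p.1 := by
        rw [add_comm (p.2 : ℂ)]; exact_mod_cast h.symm
      rw [this, qnum_add]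
      ring
    rw [hsplit, Nat.sum_antidiagonal_succ', Nat.sum_antidiagonal_succ, sum_mul]
    simp only [Nat.cast_zero, qnum_zero, mul_zero, zero_mul, zero_add]
    rw [← sum_add_distrib]
    refine sum_congr rfl fun p hp => ?_
    have h := HasAntidiagonal.mem_antidiagonal.mp hp
    have h1 := hq p.1 (by omega)
    have h2 := hq p.2 (by omega)
    have h3 : D.qnum ((p.1 : ℂ) + 1) ≠ 0 := by
      exact_mod_cast hn (p.1 + 1) (by omega) p.1.succ_pos
    have h4 : D.qnum ((p.2 : ℂ) + 1) ≠ 0 := by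
      exact_mod_cast hn (p.2 + 1) (by omega) p.2.succ_pos
    have e : x + y + n = (x + p.2) + (y + p.1) := by
      have : (n : ℂ) = p.1 + p.2 := by exact_mod_cast h.symm
      rw [this]; ring
    have q1 : D.qpow ((p.2 + 1) * y - p.1 * x) * D.qpow p.1 =
        D.qpow (p.2 * y - p.1 * x) * D.qpow (y + p.1) := by
      rw [← qpow_add, ← qpow_add]; congr 1; ring
    have q2 : D.qpow (p.2 * y - (p.1 + 1) * x) * (D.qpow p.2)⁻¹ =
        D.qpow (p.2 * y - p.1 * x) * (D.qpow (x + p.2))⁻¹ := by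
      rw [← qpow_neg, ← qpow_neg, ← qpow_add, ← qpow_add]; congr 1; ring
    push_cast
    rw [e, D.qnum_add (x + p.2) (y + p.1), q1, q2, rise_succ, rise_succ, qfact_succ, qfact_succ]
    field_simp

end Setup
end ColoredIRF

/-! ### The Clebsch–Gordan coefficients as an adapted basis. -/

namespace ColoredIRF
open Site Setup

namespace Setup
variable (D : Setup)

open Classical in
/-- The Clebsch–Gordan coefficients in terms of the channel `n`. -/
noncomputable def cgPsi (a b : ColorRep) (n k z w : ℕ) : ℂ :=
  if (n : ℕ∞) < D.dim a ∧ (n : ℕ∞) < D.dim b ∧ z + w = n + k ∧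
      (z : ℕ∞) < D.dim a ∧ (w : ℕ∞) < D.dim b ∧ (k : ℕ∞) < D.dim (a.fuse b n) then
    D.cgFormula a.val b.val n z w k
  else 0

variable {D} {a b : ColorRep} {n : ℕ}

lemma cgPsi_of (h1 : (n : ℕ∞) < D.dim a) (h2 : (n : ℕ∞) < D.dim b) {k z w : ℕ} (h : z + w = n + k)
    (hz : (z : ℕ∞) < D.dim a) (hw : (w : ℕ∞) < D.dim b) (hk : (k : ℕ∞) < D.dim (a.fuse b n)) :
    D.cgPsi a b n k z w = D.cgFormula a.val b.val n z w k :=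
  if_pos ⟨h1, h2, h, hz, hw, hk⟩

lemma Proper.rtFall_ne (P : D.Proper) (ha : D.Regular a) {z : ℕ} (hz : (z : ℕ∞) < D.dim a) :
    D.rtFall (2 * a.val) z ≠ 0 := prod_ne_zero_iff.mpr fun k hk =>
  P.rt_sub_ne ha (lt_of_le_of_lt (by exact_mod_cast mem_range.mp hk) hz)

lemma Proper.rt_natCast_ne (P : D.Proper) (ha : D.Regular a) {z : ℕ} (hz : (z : ℕ∞) < D.dim a)
    {i : ℕ} (h0 : 0 < i) (hi : i ≤ z) : D.rt i ≠ 0 := by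
  obtain ⟨j, rfl⟩ : ∃ j, i = j + 1 := ⟨i - 1, by omega⟩
  have := P.rt_succ_ne ha (z := j) (lt_of_le_of_lt (by exact_mod_cast hi) hz)
  exact_mod_cast this

lemma Proper.qnum_natCast_ne (P : D.Proper) (ha : D.Regular a) {z : ℕ} (hz : (z : ℕ∞) < D.dim a)
    {i : ℕ} (h0 : 0 < i) (hi : i ≤ z) : D.qnum i ≠ 0 := by
  have := P.rt_natCast_ne ha hz h0 hi
  rw [← P.rt_sq]; exact pow_ne_zero _ this

lemma Proper.qfact_ne (P : D.Proper) (ha : D.Regular a) {z : ℕ} (hz : (z : ℕ∞) < D.dim a) :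
    D.qfact z ≠ 0 := prod_ne_zero_iff.mpr fun k hk => by
  have := P.qnum_natCast_ne ha hz k.succ_pos (mem_range.mp hk)
  exact_mod_cast this

lemma Proper.rtFall_fuse_ne (P : D.Proper) (hab : D.Good a b) (h1 : (n : ℕ∞) < D.dim a)
    (h2 : (n : ℕ∞) < D.dim b) {z j : ℕ} (hz : (z : ℕ∞) < D.dim (a.fuse b n)) (hj : j ≤ n + z + 1) :
    D.rtFall (2 * a.val + 2 * b.val - n + 1) j ≠ 0 := prod_ne_zero_iff.mpr fun k hk =>
  P.rt_fuse_ne hab h1 h2 hz (by have := mem_range.mp hk; omega)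

lemma cgTerm_neg_left (α β : ℂ) (w : ℤ) (ν : ℕ) : D.cgTerm α β n (-1) w ν = 0 := by
  rw [cgTerm, rfact_neg D (i := -1 - ν) (by omega)]; ring

lemma cgTerm_neg_right (α β : ℂ) (z : ℤ) (ν : ℕ) (hν : ν < n + 1) :
    D.cgTerm α β n z (-1) ν = 0 := by
  rw [cgTerm, rfact_neg D (i := -1 + ν - n) (by omega)]; ring

lemma k_site (a : ColorRep) (z : ℕ) : (D.site a).k (D.qpow 1) z = D.qpow (a.val - z) := by
  rw [Site.k, qpow_sub, qpow_natCast, inv_pow]; rfl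

/-- The common factor of the terms in the intertwining relation of the lowering operators. -/
noncomputable def cgPre' (D : Setup) (α β : ℂ) (n z w y : ℕ) : ℂ :=
  D.rt (2 * α + 2 * β - 2 * n + 1) * (D.rtFact n * D.rtFact z * D.rtFact w * D.rtFact y)
    * D.qpow (((n : ℂ) - (n : ℂ) ^ 2) / 2 + ((n : ℂ) - w) * α + ((n : ℂ) + z) * β)
    / (D.rtFall (2 * α) n * D.rtFall (2 * α) z * (D.rtFall (2 * β) n * D.rtFall (2 * β) w)
      * D.rtFall (2 * α + 2 * β - n + 1) (z + w))

lemma Proper.cgPre_left (P : D.Proper) {α : ℂ} (β : ℂ) (n z w y : ℕ) (h : D.rt (2 * α - z) ≠ 0) :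
    D.rt (z + 1) * D.rt (2 * α - z) * D.qpow (β - w) * D.cgPre α β n z w y =
      D.cgPre' α β n (z + 1) w y * ((D.qpow w)⁻¹ * D.qnum (2 * α - z)) := by
  have e1 : z + 1 + w = z + w + 1 := by omega
  have e2 : D.qpow (((n : ℂ) - (n : ℂ) ^ 2) / 2 + ((n : ℂ) - w) * α + ((n : ℂ) + (z + 1 : ℕ)) * β) =
    D.qpow (((n : ℂ) - (n : ℂ) ^ 2) / 2 + ((n : ℂ) - w) * α + ((n : ℂ) + z) * β) * D.qpow β := by
    rw [← qpow_add]; congr 1; push_cast; ring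
  rw [cgPre, cgPre', e1, e2, ← P.rt_sq, rtFact_succ, rtFall_succ _ (2 * α), qpow_sub]
  generalize D.rt (2 * α - z) = r at *
  generalize D.qpow (((n : ℂ) - (n : ℂ) ^ 2) / 2 + ((n : ℂ) - w) * α + ((n : ℂ) + z) * β) = X
  generalize D.rt (2 * α + 2 * β - 2 * n + 1) = Y
  simp only [div_eq_mul_inv, mul_inv]
  have := mul_inv_cancel₀ h
  generalize r⁻¹ = r' at *
  generalize (D.rtFall (2 * α) z)⁻¹ = A
  linear_combination -(D.rt (z + 1) * (D.qpow w)⁻¹ * D.qpow β * Y * D.rtFact n * D.rtFact z *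
    D.rtFact w * D.rtFact y * X * (D.rtFall (2 * α) n)⁻¹ * A * (D.rtFall (2 * β) n)⁻¹ *
    (D.rtFall (2 * β) w)⁻¹ * (D.rtFall (2 * α + 2 * β - n + 1) (z + w + 1))⁻¹ * r) * this

lemma Proper.cgPre_right (P : D.Proper) (α : ℂ) {β : ℂ} (n z w y : ℕ) (h : D.rt (2 * β - w) ≠ 0) :
    (D.qpow (α - z))⁻¹ * (D.rt (w + 1) * D.rt (2 * β - w)) * D.cgPre α β n z w y =
      D.cgPre' α β n z (w + 1) y * (D.qpow z * D.qnum (2 * β - w)) := by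
  have e1 : z + (w + 1) = z + w + 1 := by omega
  have e2 : D.qpow (((n : ℂ) - (n : ℂ) ^ 2) / 2 + ((n : ℂ) - (w + 1 : ℕ)) * α + ((n : ℂ) + z) * β) =
    D.qpow (((n : ℂ) - (n : ℂ) ^ 2) / 2 + ((n : ℂ) - w) * α + ((n : ℂ) + z) * β) *
      (D.qpow α)⁻¹ := by
    rw [← qpow_neg, ← qpow_add]; congr 1; push_cast; ring
  rw [cgPre, cgPre', e1, e2, ← P.rt_sq, rtFact_succ, rtFall_succ _ (2 * β), qpow_sub, mul_inv,
    inv_inv]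
  generalize D.rt (2 * β - w) = r at *
  generalize D.qpow (((n : ℂ) - (n : ℂ) ^ 2) / 2 + ((n : ℂ) - w) * α + ((n : ℂ) + z) * β) = X
  generalize D.rt (2 * α + 2 * β - 2 * n + 1) = Y
  simp only [div_eq_mul_inv, mul_inv]
  have := mul_inv_cancel₀ h
  generalize r⁻¹ = r' at *
  generalize (D.rtFall (2 * β) w)⁻¹ = A
  linear_combination -(D.rt (w + 1) * (D.qpow α)⁻¹ * D.qpow z * Y * D.rtFact n * D.rtFact z *
    D.rtFact w * D.rtFact y * X * (D.rtFall (2 * α) n)⁻¹ * A * (D.rtFall (2 * β) n)⁻¹ *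
    (D.rtFall (2 * α) z)⁻¹ * (D.rtFall (2 * α + 2 * β - n + 1) (z + w + 1))⁻¹ * r) * this

lemma Proper.cgPre_target (P : D.Proper) {α β : ℂ} {n z w y : ℕ} (hl : z + w = n + y + 1)
    (h : D.rt (2 * (α + β - n) - y) ≠ 0) :
    D.rt (y + 1) * D.rt (2 * (α + β - n) - y) * D.cgPre α β n z w (y + 1) =
      D.cgPre' α β n z w y * D.qnum (z + w - n) := by
  have e1 : (z : ℂ) + w - n = y + 1 := by
    have : (z : ℂ) + w = n + y + 1 := by exact_mod_cast hl
    rw [this]; ring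
  have e2 : 2 * α + 2 * β - n + 1 - (z + w : ℕ) = 2 * (α + β - n) - y := by
    have : (z : ℂ) + w = n + y + 1 := by exact_mod_cast hl
    push_cast
    rw [this]; ring
  rw [e1, cgPre, cgPre', ← P.rt_sq, rtFact_succ, rtFall_succ, e2]
  generalize D.rt (2 * (α + β - n) - y) = r at *
  generalize D.qpow (((n : ℂ) - (n : ℂ) ^ 2) / 2 + ((n : ℂ) - w) * α + ((n : ℂ) + z) * β) = X
  generalize D.rt (2 * α + 2 * β - 2 * n + 1) = Y
  simp only [div_eq_mul_inv, mul_inv]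
  have := mul_inv_cancel₀ h
  generalize r⁻¹ = r' at *
  linear_combination (D.rt (y + 1) ^ 2 * Y * D.rtFact n * D.rtFact z *
    D.rtFact w * D.rtFact y * X * (D.rtFall (2 * α) n)⁻¹ * (D.rtFall (2 * α) z)⁻¹ *
    (D.rtFall (2 * β) n)⁻¹ *
    (D.rtFall (2 * β) w)⁻¹ * (D.rtFall (2 * α + 2 * β - n + 1) (z + w))⁻¹) * this

/-- The Clebsch–Gordan coefficients intertwine the lowering operators. -/
lemma Proper.lower_cgPsi (P : D.Proper) (hab : D.Good a b) (h1 : (n : ℕ∞) < D.dim a)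
    (h2 : (n : ℕ∞) < D.dim b) {k : ℕ} (hk : ((k + 1 : ℕ) : ℕ∞) < D.dim (a.fuse b n)) :
    lowerOp (D.qpow 1) (D.site a) (D.site b) (D.cgPsi a b n k) =
      (D.site (a.fuse b n)).f k • D.cgPsi a b n (k + 1) := by
  have hsupp : ∀ k, Supp (D.site a) (D.site b) (D.cgPsi a b n k) := fun k z w h => by
    rw [cgPsi, ne_eq, ite_eq_right_iff, not_forall] at h
    exact ⟨h.1.2.2.2.1, h.1.2.2.2.2.1⟩
  ext z w
  by_cases hd : (z : ℕ∞) < D.dim a ∧ (w : ℕ∞) < D.dim b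
  swap
  · have h1 := mt (supp_lower (P.isRep hab.1) (P.isRep hab.2.1) (hsupp k) z w) hd
    have h2 := mt ((hsupp (k + 1)).smul ((D.site (a.fuse b n)).f k) z w) hd
    rw [not_not.mp h1, not_not.mp h2]
  obtain ⟨hz, hw⟩ := hd
  rw [lowerOp_apply, Pi.smul_apply, Pi.smul_apply, smul_eq_mul]
  by_cases hl : z + w = n + k + 1
  swap
  · have e1 : D.cgPsi a b n (k + 1) z w = 0 := if_neg (by omega)
    have e2 : (D.site a).fm z * D.cgPsi a b n k (z - 1) w = 0 := by
      cases z with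
      | zero => simp
      | succ z => rw [cgPsi, if_neg (by omega), mul_zero]
    have e3 : (D.site b).fm w * D.cgPsi a b n k z (w - 1) = 0 := by
      cases w with
      | zero => simp
      | succ w => rw [cgPsi, if_neg (by omega), mul_zero]
    rw [e1]
    linear_combination (D.site b).k (D.qpow 1) w * e2 + ((D.site a).k (D.qpow 1) z)⁻¹ * e3
  have hk' := lt_of_succ_lt hk
  have ne1 := P.rtFall_ne hab.1 h1
  have ne2 := P.rtFall_ne hab.2.1 h2
  have hv : (a.fuse b n).val = a.val + b.val - n := val_fuse h1 h2
  set α := a.val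
  set β := b.val
  have e1 : (D.site a).fm z * (D.site b).k (D.qpow 1) w * D.cgPsi a b n k (z - 1) w =
      D.cgPre' α β n z w k * ((D.qpow w)⁻¹ * D.qnum (2 * α - z + 1) *
        ∑ ν ∈ range (n + 1), D.cgTerm α β n (z - 1) w ν) := by
    cases z with
    | zero =>
      have : ∀ ν ∈ range (n + 1), D.cgTerm α β n (((0 : ℕ) : ℤ) - 1) w ν = 0 := fun ν _ =>
        cgTerm_neg_left _ _ _ _
      rw [sum_eq_zero this]; simp
    | succ z =>
      have hz' := lt_of_succ_lt hz
      have := P.cgPre_left (α := α) β n z w k (P.rt_sub_ne hab.1 hz)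
      rw [Nat.add_sub_cancel, cgPsi_of h1 h2 (by omega) hz' hw hk',
        P.cgFormula_eq _ _ _ _ _ _ ne1 (P.rtFall_ne hab.1 hz') ne2 (P.rtFall_ne hab.2.1 hw), fm_succ,
        k_site]
      have e3 : 2 * α - ((z + 1 : ℕ) : ℂ) + 1 = 2 * α - z := by push_cast; ring
      have e4 : (((z + 1 : ℕ) : ℤ) - 1) = z := by push_cast; ring
      rw [e3, e4]
      simp only [site]
      linear_combination (∑ ν ∈ range (n + 1), D.cgTerm α β n z w ν) * this
  have e2 : ((D.site a).k (D.qpow 1) z)⁻¹ * (D.site b).fm w * D.cgPsi a b n k z (w - 1) =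
      D.cgPre' α β n z w k * (D.qpow z * D.qnum (2 * β - w + 1) *
        ∑ ν ∈ range (n + 1), D.cgTerm α β n z (w - 1) ν) := by
    cases w with
    | zero =>
      have : ∀ ν ∈ range (n + 1), D.cgTerm α β n z (((0 : ℕ) : ℤ) - 1) ν = 0 := fun ν hν =>
        cgTerm_neg_right _ _ _ _ (mem_range.mp hν)
      rw [sum_eq_zero this]; simp
    | succ w =>
      have hw' := lt_of_succ_lt hw
      have := P.cgPre_right α (β := β) n z w k (P.rt_sub_ne hab.2.1 hw)
      rw [Nat.add_sub_cancel, cgPsi_of h1 h2 (by omega) hz hw' hk',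
        P.cgFormula_eq _ _ _ _ _ _ ne1 (P.rtFall_ne hab.1 hz) ne2 (P.rtFall_ne hab.2.1 hw'), fm_succ,
        k_site]
      have e3 : 2 * β - ((w + 1 : ℕ) : ℂ) + 1 = 2 * β - w := by push_cast; ring
      have e4 : (((w + 1 : ℕ) : ℤ) - 1) = w := by push_cast; ring
      rw [e3, e4]
      simp only [site]
      linear_combination (∑ ν ∈ range (n + 1), D.cgTerm α β n z w ν) * this
  have e3 := P.cgPre_target (α := α) (β := β) hl
    (by rw [← hv]; exact P.rt_sub_ne (regular_fuse hab h1 h2) hk)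
  rw [cgPsi_of h1 h2 (by omega) hz hw hk,
    P.cgFormula_eq _ _ _ _ _ _ ne1 (P.rtFall_ne hab.1 hz) ne2 (P.rtFall_ne hab.2.1 hw)]
  have hrec := sum_cgTerm_recursion (D := D) α β n z w
    (fun ν hν h => by
      have := P.qnum_natCast_ne hab.1 hz (i := z - ν) (by omega) (by omega)
      rwa [Nat.cast_sub (by omega)] at this)
    (fun ν hν h => by
      have := P.qnum_natCast_ne hab.2.1 hw (i := w + ν - n) (by omega) (by omega)
      rw [Nat.cast_sub (by omega)] at this
      exact_mod_cast this)
    (fun ν hν h => P.qnum_natCast_ne hab.1 h1 h hν)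
  rw [e1, e2, ← mul_add]
  push_cast at hrec
  rw [hrec]
  simp only [site]
  rw [hv]
  linear_combination -(∑ ν ∈ range (n + 1), D.cgTerm α β n z w ν) * e3

/-- The singular vectors. -/
lemma Proper.cgPsi_zero (P : D.Proper) (hab : D.Good a b) (h1 : (n : ℕ∞) < D.dim a)
    (h2 : (n : ℕ∞) < D.dim b) {z w : ℕ} (h : z + w = n) :
    D.cgPsi a b n 0 z w = D.rt (2 * a.val + 2 * b.val - 2 * n + 1) * D.rtFact n
      / D.rtFall (2 * a.val + 2 * b.val - n + 1) (n + 1) *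
      ((-1) ^ z * D.qpow (((n : ℂ) - (n : ℂ) ^ 2) / 2 + z * a.val + ((n : ℂ) + z) * b.val
        - z * (2 * a.val + 2 * b.val - n + 1)) * (D.rtFact z * D.rtFact w / (D.qfact z * D.qfact w))
        * (D.rtFall (2 * a.val - z) w * D.rtFall (2 * b.val - w) z)) := by
  have hz : (z : ℕ∞) < D.dim a := lt_of_le_of_lt (by exact_mod_cast (by omega : z ≤ n)) h1
  have hw : (w : ℕ∞) < D.dim b := lt_of_le_of_lt (by exact_mod_cast (by omega : w ≤ n)) h2
  rw [cgPsi_of h1 h2 (by omega) hz hw (P.isRep (regular_fuse hab h1 h2)).d_pos, cgFormula]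
  -- Both limits of summation equal `z`, so a single term is left.
  have e1 : n - w = z := by omega
  have e2 : min n z = z := by omega
  have e3 : n - z = w := by omega
  have e4 : w + z - n = 0 := by omega
  have e5 : ((n : ℂ) - w) = z := by rw [← h]; push_cast; ring
  rw [e1, e2, Icc_self, sum_singleton, e3, e4, e5, Nat.sub_self, rtFall_zero, rtFall_zero,
    qfact_zero, show D.rtFact 0 = 1 from D.rtFall_zero _, h, qpow_neg,
    D.qpow_sub _ ((z : ℂ) * (2 * a.val + 2 * b.val - n + 1))]
  ring

/-- The entries are single products by `cgPsi_zero`; the two terms of `E` agree up to the sign `(-1)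
^ z`, once the powers of `q` are matched. -/
lemma Proper.raise_cgPsi (P : D.Proper) (hab : D.Good a b) (n : ℕ) :
    raiseOp (D.qpow 1) (D.site a) (D.site b) (D.cgPsi a b n 0) = 0 := by
  ext z w
  rw [raiseOp_apply, Pi.zero_apply, Pi.zero_apply]
  by_cases h : ((n : ℕ∞) < D.dim a ∧ (n : ℕ∞) < D.dim b) ∧ z + w + 1 = n
  swap
  · rw [cgPsi, if_neg fun h' => h ⟨⟨h'.1, h'.2.1⟩, by omega⟩, cgPsi,
      if_neg fun h' => h ⟨⟨h'.1, h'.2.1⟩, by omega⟩]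
    simp
  obtain ⟨⟨h1, h2⟩, rfl⟩ := h
  rw [P.cgPsi_zero hab h1 h2 (by omega), P.cgPsi_zero hab h1 h2 (by omega), k_site, k_site]
  have n1 := P.rt_natCast_ne hab.1 h1 z.succ_pos (by omega)
  have n2 := P.rt_natCast_ne hab.1 h1 w.succ_pos (by omega)
  push_cast at n1 n2
  rw [D.rtFact_succ z, D.rtFact_succ w, qfact_succ, qfact_succ, ← P.rt_sq, ← P.rt_sq,
    rtFall_succ' _ (2 * a.val - z), rtFall_succ' _ (2 * b.val - w)]
  simp only [site]
  have q1 : D.qpow (b.val - w) * D.qpow ((((z + w + 1 : ℕ) : ℂ) - ((z + w + 1 : ℕ) : ℂ) ^ 2) / 2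
        + ((z + 1 : ℕ) : ℂ) * a.val + (((z + w + 1 : ℕ) : ℂ) + ((z + 1 : ℕ) : ℂ)) * b.val
        - ((z + 1 : ℕ) : ℂ) * (2 * a.val + 2 * b.val - ((z + w + 1 : ℕ) : ℂ) + 1)) =
      (D.qpow (a.val - z))⁻¹ * D.qpow ((((z + w + 1 : ℕ) : ℂ) - ((z + w + 1 : ℕ) : ℂ) ^ 2) / 2
        + (z : ℂ) * a.val + (((z + w + 1 : ℕ) : ℂ) + (z : ℂ)) * b.val
        - (z : ℂ) * (2 * a.val + 2 * b.val - ((z + w + 1 : ℕ) : ℂ) + 1)) := by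
    rw [← qpow_neg, ← qpow_add, ← qpow_add]; congr 1; push_cast; ring
  have e1 : 2 * a.val - ((z + 1 : ℕ) : ℂ) = 2 * a.val - z - 1 := by push_cast; ring
  have e2 : 2 * b.val - ((w + 1 : ℕ) : ℂ) = 2 * b.val - w - 1 := by push_cast; ring
  rw [e1, e2]
  generalize D.rt (2 * a.val + 2 * b.val - 2 * ((z + w + 1 : ℕ) : ℂ) + 1) * D.rtFact (z + w + 1)
      / D.rtFall (2 * a.val + 2 * b.val - ((z + w + 1 : ℕ) : ℂ) + 1) (z + w + 1 + 1) = X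
  generalize D.qpow ((((z + w + 1 : ℕ) : ℂ) - ((z + w + 1 : ℕ) : ℂ) ^ 2) / 2
        + ((z + 1 : ℕ) : ℂ) * a.val + (((z + w + 1 : ℕ) : ℂ) + ((z + 1 : ℕ) : ℂ)) * b.val
        - ((z + 1 : ℕ) : ℂ) * (2 * a.val + 2 * b.val - ((z + w + 1 : ℕ) : ℂ) + 1)) = Q1 at *
  generalize D.qpow ((((z + w + 1 : ℕ) : ℂ) - ((z + w + 1 : ℕ) : ℂ) ^ 2) / 2
        + (z : ℂ) * a.val + (((z + w + 1 : ℕ) : ℂ) + (z : ℂ)) * b.val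
        - (z : ℂ) * (2 * a.val + 2 * b.val - ((z + w + 1 : ℕ) : ℂ) + 1)) = Q2 at *
  generalize D.rtFall (2 * a.val - z - 1) w = A
  generalize D.rtFall (2 * b.val - w - 1) z = B
  generalize D.rt (2 * a.val - z) = A'
  generalize D.rt (2 * b.val - w) = B'
  have c1 : D.rt (z + 1) * (D.rt (z + 1) / D.rt (z + 1) ^ 2) = 1 := by field_simp
  have c2 : D.rt (w + 1) * (D.rt (w + 1) / D.rt (w + 1) ^ 2) = 1 := by field_simp
  generalize D.rt (z + 1) = r1 at *
  generalize D.rt (w + 1) = r2 at *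
  simp only [div_eq_mul_inv, mul_inv] at *
  linear_combination -(X * (-1) ^ z * A * B * A' * B' * D.rtFact z * D.rtFact w * (D.qfact z)⁻¹ *
      (D.qfact w)⁻¹ * D.qpow (b.val - w) * Q1) * c1 +
    (X * (-1) ^ z * A * B * A' * B' * D.rtFact z * D.rtFact w * (D.qfact z)⁻¹ *
      (D.qfact w)⁻¹ * (D.qpow (a.val - z))⁻¹ * Q2) * c2 -
    (X * (-1) ^ z * A * B * A' * B' * D.rtFact z * D.rtFact w * (D.qfact z)⁻¹ * (D.qfact w)⁻¹) * q1

/-- The squares of the entries are the terms of the `q`-Vandermonde sum for `2a - n + 1` and `2b - n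
+ 1`. Its value is the squared denominator of the prefactor without the factor `[2a + 2b - 2n + 1]`,
which stands in the numerator. -/
lemma Proper.norm_cgPsi (P : D.Proper) (hab : D.Good a b) (h1 : (n : ℕ∞) < D.dim a)
    (h2 : (n : ℕ∞) < D.dim b) : pair n (D.cgPsi a b n 0) (D.cgPsi a b n 0) = 1 := by
  have V := D.sum_vandermonde (2 * a.val - n + 1) (2 * b.val - n + 1) n
    fun i hi h0 => P.qnum_natCast_ne hab.1 h1 h0 hi
  have hF := P.rtFall_fuse_ne hab h1 h2 (z := 0) (j := n + 1)
    (P.isRep (regular_fuse hab h1 h2)).d_pos le_rfl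
  have hF2 : D.rtFall (2 * a.val + 2 * b.val - n + 1) (n + 1) ^ 2 =
      D.rise (2 * a.val - n + 1 + (2 * b.val - n + 1)) n *
      D.rt (2 * a.val + 2 * b.val - 2 * n + 1) ^ 2 := by
    rw [rtFall_succ, mul_pow, P.rtFall_sq, fall_eq_rise]
    ring_nf
  rw [← V] at hF2
  apply mul_right_cancel₀ (pow_ne_zero 2 hF)
  rw [one_mul]
  refine Eq.trans ?_ hF2.symm
  rw [pair, sum_mul, mul_sum, sum_mul]
  refine sum_congr rfl fun p hp => ?_
  have h := mem_antidiagonal.mp hp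
  have hn : (n : ℂ) = p.1 + p.2 := by exact_mod_cast h.symm
  have hz : (p.1 : ℕ∞) < D.dim a := lt_of_le_of_lt (by exact_mod_cast (by omega : p.1 ≤ n)) h1
  have hw : (p.2 : ℕ∞) < D.dim b := lt_of_le_of_lt (by exact_mod_cast (by omega : p.2 ≤ n)) h2
  have f1 := P.qfact_ne hab.1 hz
  have f2 := P.qfact_ne hab.2.1 hw
  have r1 : D.rise (2 * a.val - n + 1) p.2 = D.rtFall (2 * a.val - p.1) p.2 ^ 2 := by
    rw [P.rtFall_sq, fall_eq_rise, hn]; ring_nf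
  have r2 : D.rise (2 * b.val - n + 1) p.1 = D.rtFall (2 * b.val - p.2) p.1 ^ 2 := by
    rw [P.rtFall_sq, fall_eq_rise, hn]; ring_nf
  have q1 : D.qpow (p.2 * (2 * b.val - n + 1) - p.1 * (2 * a.val - n + 1)) =
      D.qpow (((n : ℂ) - (n : ℂ) ^ 2) / 2 + p.1 * a.val + ((n : ℂ) + p.1) * b.val
        - p.1 * (2 * a.val + 2 * b.val - n + 1)) ^ 2 := by
    rw [← qpow_two_mul, hn]; congr 1; ring
  have s1 : (((-1 : ℂ)) ^ p.1) ^ 2 = 1 := by rw [← pow_mul, mul_comm, pow_mul]; simp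
  rw [P.cgPsi_zero hab h1 h2 h, r1, r2, q1, ← P.rtFact_sq n]
  have t1 := P.rtFact_sq p.1
  have t2 := P.rtFact_sq p.2
  generalize D.qpow (((n : ℂ) - (n : ℂ) ^ 2) / 2 + p.1 * a.val + ((n : ℂ) + p.1) * b.val
        - p.1 * (2 * a.val + 2 * b.val - n + 1)) = Q
  generalize D.rtFall (2 * a.val + 2 * b.val - n + 1) (n + 1) = F at *
  generalize D.rt (2 * a.val + 2 * b.val - 2 * n + 1) = Y
  generalize D.rtFall (2 * b.val - p.2) p.1 = R1
  generalize D.rtFall (2 * a.val - p.1) p.2 = R2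
  have t3 : D.rtFact p.1 * D.rtFact p.2 / (D.qfact p.1 * D.qfact p.2) *
      (D.rtFact p.1 * D.rtFact p.2 / (D.qfact p.1 * D.qfact p.2)) =
      1 / (D.qfact p.1 * D.qfact p.2) := by
    rw [div_mul_div_comm, div_eq_div_iff (by simp [*]) (by simp [*]), ← t1, ← t2]
    ring
  have t4 : Y * D.rtFact n / F * F = Y * D.rtFact n := div_mul_cancel₀ _ hF
  generalize D.rtFact p.1 * D.rtFact p.2 / (D.qfact p.1 * D.qfact p.2) = T at *
  generalize Y * D.rtFact n / F = U at *
  rw [div_eq_mul_one_div (R2 ^ 2 * _), ← t3]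
  linear_combination ((-1) ^ p.1) ^ 2 * Q ^ 2 * T ^ 2 * (R1 * R2) ^ 2 * (U * F + Y * D.rtFact n) * t4
    + (Y * D.rtFact n) ^ 2 * Q ^ 2 * T ^ 2 * (R1 * R2) ^ 2 * s1

/-- The Clebsch–Gordan basis of `a ⊗ b`. -/
noncomputable def cgBasis (P : D.Proper) (hab : D.Good a b) :
    CGBasis (D.qpow 1) (D.site a) (D.site b) where
  c n := D.site (a.fuse b n)
  ψ := D.cgPsi a b
  rep n h1 h2 := P.isRep (regular_fuse hab h1 h2)
  k0 n h1 h2 := by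
    simp only [site]
    rw [val_fuse h1 h2, qpow_sub, qpow_add, qpow_natCast, inv_pow]
  dim_le n k h1 h2 h := fuse_dim_le hab h1 h2 k h
  level n k z w h := by
    rw [cgPsi, ne_eq, ite_eq_right_iff, not_forall] at h
    exact h.1.2.2.1
  supp n k z w h := by
    rw [cgPsi, ne_eq, ite_eq_right_iff, not_forall] at h
    exact ⟨h.1.2.2.2.1, h.1.2.2.2.2.1⟩
  valid n k z w h := by
    rw [cgPsi, ne_eq, ite_eq_right_iff, not_forall] at h
    exact ⟨h.1.1, h.1.2.1, h.1.2.2.2.2.2⟩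
  raise_zero := P.raise_cgPsi hab
  lower_aux n k h1 h2 h := P.lower_cgPsi hab h1 h2 h
  norm n h1 h2 := P.norm_cgPsi hab h1 h2

end Setup

/-- `aff_ψ` read entrywise carries the factor `x ^ 2 - κ ^ 2`. The values `x = 1` and `x = 2` give
factors differing by `3`, so no assumption on `κ` is needed to remove it. -/
lemma CGBasis.α_spec {q : ℂ} {s t : Site} (B : CGBasis q s t) (hq : q ≠ 0) (hω : q - q⁻¹ ≠ 0)
    (hs : s.IsRep q) (ht : t.IsRep q) {n : ℕ} (h : B.Ok (n + 1)) {z w : ℕ} (hzw : z + w = n) :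
    s.f z * (t.k q w)⁻¹ * B.ψ (n + 1) 0 (z + 1) w = B.α n * B.ψ n 0 z w := by
  have key : ∀ x : ℂ, x ≠ 0 → (x ^ 2 - (B.c n).k0 ^ 2) * (s.f z * (t.k q w)⁻¹ * B.ψ (n + 1) 0 (z + 1) w
      - B.α n * B.ψ n 0 z w) = 0 := fun x hx => by
    have e := congrFun (congrFun (B.aff_ψ hq hω hs ht h x) z) w
    rw [affOp_apply, B.swap_ψ hq hω hs ht, B.k_mul n 0 z w (CGBasis.ok_of_succ h) (by simpa using hzw),
      B.k_zero, Pi.smul_apply, Pi.smul_apply, smul_eq_mul] at e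
    have hx' : x * x⁻¹ = 1 := mul_inv_cancel₀ hx
    linear_combination x * e + ((B.c n).k0 ^ 2 * (s.f z * (t.k q w)⁻¹ * B.ψ (n + 1) 0 (z + 1) w
      - B.α n * B.ψ n 0 z w)) * hx'
  have h1 := key 1 one_ne_zero
  have h2 := key 2 two_ne_zero
  linear_combination (h2 - h1) / 3

namespace Setup
variable {D : Setup} {a b : ColorRep} {n : ℕ}

/-- Comparison of the entries at `(0, n)`. The point of the closed form is its symmetry in `a` and
`b`, with the same chosen square roots on both sides, as `Compat` requires. -/
lemma α_cgBasis (P : D.Proper) (hab : D.Good a b)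
    (h : ((n + 1 : ℕ) : ℕ∞) < D.dim a ∧ ((n + 1 : ℕ) : ℕ∞) < D.dim b) :
    (cgBasis P hab).α n = -(D.rt (n + 1) * D.rt (2 * a.val - n) * D.rt (2 * b.val - n) *
      (D.rt (2 * a.val + 2 * b.val - 2 * (n + 1 : ℕ) + 1)
        * D.rtFall (2 * a.val + 2 * b.val - n + 1) (n + 1) /
      (D.rt (2 * a.val + 2 * b.val - 2 * n + 1)
        * D.rtFall (2 * a.val + 2 * b.val - (n + 1 : ℕ) + 1) (n + 1 + 1)))
      * D.qpow (n - a.val - b.val)) := by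
  have h0 : (n : ℕ∞) < D.dim a ∧ (n : ℕ∞) < D.dim b := ⟨lt_of_succ_lt h.1, lt_of_succ_lt h.2⟩
  have hrep := P.isRep (regular_fuse hab h0.1 h0.2)
  have e := (cgBasis P hab).α_spec (D.qpow_ne 1) P.ω_ne (P.isRep hab.1) (P.isRep hab.2.1) h
    (z := 0) (w := n) (by omega)
  have hY := P.rt_fuse_ne hab h0.1 h0.2 (j := n) (z := 0) hrep.d_pos le_rfl
  have hF := P.rtFall_fuse_ne hab h0.1 h0.2 (z := 0) (j := n + 1) hrep.d_pos le_rfl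
  have hF' := P.rtFall_fuse_ne hab h.1 h.2 (z := 0) (j := n + 1 + 1)
    (P.isRep (regular_fuse hab h.1 h.2)).d_pos le_rfl
  have eY : 2 * a.val + 2 * b.val - n + 1 - n = 2 * a.val + 2 * b.val - 2 * n + 1 := by ring
  rw [eY] at hY
  have r1 := P.rtFall_ne hab.1 h0.1
  have n1 := P.qfact_ne hab.1 h0.1
  have n2 := P.rtFact_sq n
  have one : D.rt 1 ^ 2 = 1 := by rw [P.rt_sq, P.qnum_one]
  have ef1 : D.rtFact 1 = D.rt 1 := by simp [rtFact, rtFall]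
  have ef2 : D.qfact 1 = 1 := by simp [qfact, P.qnum_one]
  have ef0 : D.rtFact 0 = 1 := by simp [rtFact, rtFall]
  have es : (D.site a).f 0 = D.rt 1 * D.rt (2 * a.val) := by simp [site]
  have eb : 2 * a.val - ((0 + 1 : ℕ) : ℂ) = 2 * a.val - 1 := by push_cast; ring
  have ea : D.rt (2 * a.val) * D.rtFall (2 * a.val - 1) n = D.rtFall (2 * a.val) n *
    D.rt (2 * a.val - n) := by rw [← rtFall_succ', rtFall_succ]
  have ec : D.rtFall (2 * b.val - n) (0 + 1) = D.rt (2 * b.val - n) := by simp [rtFall]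
  change _ * D.cgPsi a b (n + 1) 0 (0 + 1) n = _ * D.cgPsi a b n 0 0 n at e
  rw [P.cgPsi_zero hab h.1 h.2 (by omega), P.cgPsi_zero hab h0.1 h0.2 (by omega), k_site, es, zero_add,
    ef1, ef2, ef0, D.qfact_zero, D.rtFact_succ n] at e
  have q1 : (D.qpow (b.val - n))⁻¹ * D.qpow ((((n + 1 : ℕ) : ℂ) - ((n + 1 : ℕ) : ℂ) ^ 2) / 2 +
      ((1 : ℕ) : ℂ) * a.val + (((n + 1 : ℕ) : ℂ) + ((1 : ℕ) : ℂ)) * b.val -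
      ((1 : ℕ) : ℂ) * (2 * a.val + 2 * b.val - ((n + 1 : ℕ) : ℂ) + 1)) =
      D.qpow (n - a.val - b.val) * D.qpow (((n : ℂ) - (n : ℂ) ^ 2) / 2 + ((0 : ℕ) : ℂ) * a.val +
        ((n : ℂ) + ((0 : ℕ) : ℂ)) * b.val -
        ((0 : ℕ) : ℂ) * (2 * a.val + 2 * b.val - (n : ℂ) + 1)) := by
    rw [← qpow_neg, ← qpow_add, ← qpow_add]; congr 1; push_cast; ring
  have q0 := D.qpow_ne (((n : ℂ) - (n : ℂ) ^ 2) / 2 + ((0 : ℕ) : ℂ) * a.val +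
        ((n : ℂ) + ((0 : ℕ) : ℂ)) * b.val -
        ((0 : ℕ) : ℂ) * (2 * a.val + 2 * b.val - (n : ℂ) + 1))
  have e1 : 2 * a.val - ((1 : ℕ) : ℂ) = 2 * a.val - 1 := by push_cast; ring
  have e0 : 2 * a.val - ((0 : ℕ) : ℂ) = 2 * a.val := by push_cast; ring
  rw [zero_add] at ec
  rw [e1, e0, ec, rtFall_zero] at e
  have t : D.rtFact n * (D.rtFact n / D.qfact n) = 1 := by
    rw [← mul_div_assoc, ← pow_two, n2, div_self n1]
  generalize D.qpow (((n : ℂ) - (n : ℂ) ^ 2) / 2 + ((0 : ℕ) : ℂ) * a.val +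
        ((n : ℂ) + ((0 : ℕ) : ℂ)) * b.val -
        ((0 : ℕ) : ℂ) * (2 * a.val + 2 * b.val - (n : ℂ) + 1)) = Q0 at *
  generalize D.qpow ((((n + 1 : ℕ) : ℂ) - ((n + 1 : ℕ) : ℂ) ^ 2) / 2 +
      ((1 : ℕ) : ℂ) * a.val + (((n + 1 : ℕ) : ℂ) + ((1 : ℕ) : ℂ)) * b.val -
      ((1 : ℕ) : ℂ) * (2 * a.val + 2 * b.val - ((n + 1 : ℕ) : ℂ) + 1)) = Q1 at *
  generalize D.qpow (b.val - n) = Qb at *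
  generalize D.qpow (n - a.val - b.val) = Q at *
  generalize D.rtFall (2 * a.val + 2 * b.val - n + 1) (n + 1) = F at *
  generalize D.rtFall (2 * a.val + 2 * b.val - (n + 1 : ℕ) + 1) (n + 1 + 1) = F' at *
  generalize D.rt (2 * a.val + 2 * b.val - 2 * n + 1) = Y at *
  generalize D.rt (2 * a.val + 2 * b.val - 2 * (n + 1 : ℕ) + 1) = Y' at *
  generalize D.rtFall (2 * a.val - 1) n = A1 at *
  generalize D.rtFall (2 * a.val) n = A0 at *
  generalize D.rt (2 * a.val - n) = ra at *
  generalize D.rt (2 * b.val - n) = rb at *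
  generalize D.rt (2 * a.val) = r0 at *
  generalize (cgBasis P hab).α n = α at *
  have t' : D.rtFact n * D.rtFact n * (D.qfact n)⁻¹ = 1 := by rw [← t]; ring
  have c1 : F * F⁻¹ = 1 := mul_inv_cancel₀ hF
  have c2 : Y * Y⁻¹ = 1 := mul_inv_cancel₀ hY
  have e' : -(Q * D.rt (n + 1) * Y' * rb * ra * F'⁻¹) = α * Y * F⁻¹ := by
    apply mul_right_cancel₀ (mul_ne_zero q0 r1)
    have e2 : -(D.rt 1 ^ 2 * (r0 * A1) * (Qb⁻¹ * Q1) * Y' * D.rt (n + 1) * F'⁻¹ * rb) *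
        (D.rtFact n * D.rtFact n * (D.qfact n)⁻¹) = 
        α * Y * F⁻¹ * (Q0 * A0) * (D.rtFact n * D.rtFact n * (D.qfact n)⁻¹) := by
      simp only [div_eq_mul_inv, mul_inv] at e
      linear_combination e
    rw [t', one, ea, q1] at e2
    linear_combination e2
  simp only [div_eq_mul_inv, mul_inv]
  linear_combination -(α * Y * Y⁻¹) * c1 - α * c2 - F * Y⁻¹ * e'

lemma cgPsi_zero_zero (P : D.Proper) (hab : D.Good a b) : D.cgPsi a b 0 0 0 0 = 1 := by
  have h1 := (P.isRep hab.1).d_pos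
  have h2 := (P.isRep hab.2.1).d_pos
  have hY := P.rt_fuse_ne hab h1 h2 (j := 0) (z := 0) (P.isRep (regular_fuse hab h1 h2)).d_pos le_rfl
  rw [P.cgPsi_zero hab h1 h2 rfl]
  simp only [Nat.cast_zero, sub_zero] at hY
  simp [rtFact, rtFall, qfact, qpow_zero, hY]

lemma compat_cgBasis (P : D.Proper) (hab : D.Good a b) (hba : D.Good b a) :
    (cgBasis P hab).Compat (cgBasis P hba) where
  c_eq n _ := by
    change D.site _ = D.site _
    rw [ColorRep.fuse_comm]
  α_eq n h := by
    rw [α_cgBasis P hab h, α_cgBasis P hba h.symm, add_comm (2 * b.val), sub_right_comm _ b.val,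
      mul_right_comm _ (D.rt (2 * b.val - n))]
  nondeg n h := by
    have e := P.mul_qnum (2 * (a.fuse b (n + 1)).val + 2)
    have e2 := mul_ne_zero P.ω_ne (P.nondeg hab h.1 h.2)
    rw [e, qpow_add, qpow_two_mul] at e2
    have e3 : D.qpow 2 = D.qpow 1 ^ 2 := by rw [← qpow_two_mul, mul_one]
    rw [e3] at e2
    convert e2 using 1
    change _ * D.qpow _ ^ 2 - _ * (D.qpow _)⁻¹ ^ 2 = _
    rw [mul_inv, inv_pow, inv_pow]; ring

end Setup
end ColoredIRF

/-! ### Three-fold tensor products, embeddings of channels, and the Schur argument. -/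

namespace ColoredIRF
open Site

variable {q : ℂ} {s t r : Site}

/-- The action of `E` on a tensor product of three sites. -/
noncomputable def raise3 (q : ℂ) (s t r : Site) (φ : ℕ → ℕ → ℕ → ℂ) (a b c : ℕ) : ℂ :=
  s.f a * t.k q b * r.k q c * φ (a + 1) b c + (s.k q a)⁻¹ * t.f b * r.k q c * φ a (b + 1) c
    + (s.k q a)⁻¹ * (t.k q b)⁻¹ * r.f c * φ a b (c + 1)

/-- The action of `F` on a tensor product of three sites. -/
noncomputable def lower3 (q : ℂ) (s t r : Site) (φ : ℕ → ℕ → ℕ → ℂ) (a b c : ℕ) : ℂ :=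
  s.fm a * t.k q b * r.k q c * φ (a - 1) b c + (s.k q a)⁻¹ * t.fm b * r.k q c * φ a (b - 1) c
    + (s.k q a)⁻¹ * (t.k q b)⁻¹ * r.fm c * φ a b (c - 1)

/-- The bilinear pairing of the components of level `l`. -/
noncomputable def pair3 (l : ℕ) (φ χ : ℕ → ℕ → ℕ → ℂ) : ℂ :=
  ∑ p ∈ antidiagonal l, pair p.2 (φ p.1) (χ p.1)

lemma pair3_comm (l : ℕ) (φ χ : ℕ → ℕ → ℕ → ℂ) : pair3 l φ χ = pair3 l χ φ :=
  sum_congr rfl fun _ _ => pair_comm _ _ _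

/-- The defining sum groups the last two factors; this form groups the first two, as needed for
channels of `s ⊗ t`. -/
lemma pair3_eq (l : ℕ) (φ χ : ℕ → ℕ → ℕ → ℂ) :
    pair3 l φ χ = ∑ p ∈ antidiagonal l, pair p.1 (fun a b => φ a b p.2) (fun a b => χ a b p.2) := by
  simp only [pair3, pair]
  rw [sum_sigma', sum_sigma']
  refine sum_nbij' (fun x => ⟨(x.1.1 + x.2.1, x.2.2), (x.1.1, x.2.1)⟩)
    (fun x => ⟨(x.2.1, x.2.2 + x.1.2), (x.2.2, x.1.2)⟩) ?_ ?_ ?_ ?_ ?_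
  · rintro ⟨⟨a, b⟩, ⟨c, d⟩⟩ h
    simp only [mem_sigma, HasAntidiagonal.mem_antidiagonal] at h ⊢
    exact ⟨by omega, by simp⟩
  · rintro ⟨⟨a, b⟩, ⟨c, d⟩⟩ h
    simp only [mem_sigma, HasAntidiagonal.mem_antidiagonal] at h ⊢
    exact ⟨by omega, by simp⟩
  · rintro ⟨⟨a, b⟩, ⟨c, d⟩⟩ h
    simp only [mem_sigma, HasAntidiagonal.mem_antidiagonal] at h
    simp [h.2]
  · rintro ⟨⟨a, b⟩, ⟨c, d⟩⟩ h
    simp only [mem_sigma, HasAntidiagonal.mem_antidiagonal] at h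
    simp [h.2]
  · intro x _
    rfl

lemma pair3_smul_right (l : ℕ) (φ χ : ℕ → ℕ → ℕ → ℂ) (x : ℂ) :
    pair3 l φ (x • χ) = x * pair3 l φ χ := by
  simp only [pair3, Pi.smul_apply, pair_smul_right, mul_sum]

lemma pair3_smul_left (l : ℕ) (φ χ : ℕ → ℕ → ℕ → ℂ) (x : ℂ) :
    pair3 l (x • φ) χ = x * pair3 l φ χ := by
  rw [pair3_comm, pair3_smul_right, pair3_comm]

lemma pair3_zero_right (l : ℕ) (φ : ℕ → ℕ → ℕ → ℂ) : pair3 l φ 0 = 0 := by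
  simp [pair3, pair]

lemma pair3_zero_left (l : ℕ) (φ : ℕ → ℕ → ℕ → ℂ) : pair3 l 0 φ = 0 := by
  rw [pair3_comm, pair3_zero_right]

lemma pair3_raise (l : ℕ) (φ χ : ℕ → ℕ → ℕ → ℂ) :
    pair3 l (raise3 q s t r φ) χ = pair3 (l + 1) φ (lower3 q s t r χ) := by
  have e1 : ∀ a, raise3 q s t r φ a =
      s.f a • weightOp q t r (φ (a + 1)) + (s.k q a)⁻¹ • raiseOp q t r (φ a) := fun a => by
    ext b c
    simp only [raise3, Pi.add_apply, Pi.smul_apply, smul_eq_mul, weightOp_apply, raiseOp_apply]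
    ring
  have e2 : ∀ a, lower3 q s t r χ a =
      s.fm a • weightOp q t r (χ (a - 1)) + (s.k q a)⁻¹ • lowerOp q t r (χ a) := fun a => by
    ext b c
    simp only [lower3, Pi.add_apply, Pi.smul_apply, smul_eq_mul, weightOp_apply, lowerOp_apply]
    ring
  have e3 : ∀ l (φ χ : ℕ → ℕ → ℂ), pair l (weightOp q t r φ) χ = pair l φ (weightOp q t r χ) :=
    fun l φ χ => sum_congr rfl fun _ _ => by simp only [weightOp_apply]; ring
  simp only [pair3, e1, e2, pair_comm _ (_ + _), pair_add_right, pair_smul_right, sum_add_distrib]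
  congr 1
  · rw [Nat.sum_antidiagonal_succ]
    simp only [fm_zero, zero_mul, zero_add, fm_succ, Nat.add_sub_cancel]
    exact sum_congr rfl fun _ _ => by rw [pair_comm, e3]
  · rw [Nat.sum_antidiagonal_succ']
    have : ∀ a, pair 0 (φ a) (lowerOp q t r (χ a)) = 0 := fun a => by simp [pair, lowerOp_apply]
    simp only [this, mul_zero, zero_add]
    exact sum_congr rfl fun _ _ => by rw [pair_comm, pair_raise]

/-- Two sequences of vectors carrying irreducible representations are orthogonal, except for vectors
of the same weight in equivalent representations, where the pairing is independent of the weight. -/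
lemma pair3_ladder {m m' : Site} (hm : m.IsRep q) (hm' : m'.IsRep q) {l l' : ℕ}
    (h : l = l' → m = m') {X Y : ℕ → ℕ → ℕ → ℕ → ℂ}
    (hX : ∀ z, raise3 q s t r (X z) = m.fm z • X (z - 1))
    (hX' : ∀ z, lower3 q s t r (X z) = m.f z • X (z + 1))
    (hY : ∀ z, raise3 q s t r (Y z) = m'.fm z • Y (z - 1))
    (hY' : ∀ z, lower3 q s t r (Y z) = m'.f z • Y (z + 1)) (z : ℕ) :
    ∀ z' : ℕ, (z : ℕ∞) < m.d → (z' : ℕ∞) < m'.d → l + z = l' + z' →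
      pair3 (l + z) (X z) (Y z') = if z = z' then pair3 l (X 0) (Y 0) else 0 := by
  induction z with
  | zero =>
    intro z' _ hz' hl
    cases z' with
    | zero => simp
    | succ z' =>
      rw [if_neg (by omega)]
      apply (mul_eq_zero.mp _).resolve_left (hm'.f_ne z' hz')
      rw [← pair3_smul_right, ← hY', hl, ← add_assoc, ← pair3_raise, hX, fm_zero, zero_smul,
        pair3_zero_left]
  | succ z ih =>
    intro z' hz hz' hl
    cases z' with
    | zero =>
      rw [if_neg (by omega)]
      apply (mul_eq_zero.mp _).resolve_left (hm.f_ne z hz)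
      rw [← pair3_smul_left, ← hX', pair3_comm, ← add_assoc, ← pair3_raise, hY, fm_zero, zero_smul,
        pair3_zero_left]
    | succ z' =>
      have h1 := ih z' (lt_of_succ_lt hz) (lt_of_succ_lt hz') (by omega)
      have h2 : m.f z * pair3 (l + (z + 1)) (X (z + 1)) (Y (z' + 1)) =
          m'.f z' * pair3 (l + z) (X z) (Y z') := by
        rw [← pair3_smul_left, ← hX', pair3_comm, ← add_assoc, ← pair3_raise, hY, fm_succ,
          pair3_smul_left, pair3_comm, Nat.add_sub_cancel]
      apply mul_left_cancel₀ (hm.f_ne z hz)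
      rw [h2, h1]
      by_cases hzz : z = z'
      · rw [if_pos hzz, if_pos (by omega), h (by omega), hzz]
      · rw [if_neg hzz, if_neg (by omega), mul_zero, mul_zero]

namespace CGBasis

/-- The embedding of `c ⊗ r` into `s ⊗ t ⊗ r` for a summand `c` of `s ⊗ t`. -/
noncomputable def embL (B : CGBasis q s t) (n : ℕ) (χ : ℕ → ℕ → ℂ) (a b c : ℕ) : ℂ :=
  B.ψ n (a + b - n) a b * χ (a + b - n) c

/-- The embedding of `s ⊗ c` into `s ⊗ t ⊗ r` for a summand `c` of `t ⊗ r`. -/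
noncomputable def embR (B : CGBasis q t r) (n : ℕ) (χ : ℕ → ℕ → ℂ) (a b c : ℕ) : ℂ :=
  B.ψ n (b + c - n) b c * χ a (b + c - n)

lemma embL_smul (B : CGBasis q s t) (n : ℕ) (χ : ℕ → ℕ → ℂ) (x : ℂ) :
    B.embL n (x • χ) = x • B.embL n χ := by
  ext a b c; simp only [embL, Pi.smul_apply, smul_eq_mul]; ring

lemma embR_smul (B : CGBasis q t r) (n : ℕ) (χ : ℕ → ℕ → ℂ) (x : ℂ) :
    B.embR n (x • χ) = x • B.embR n χ := by
  ext a b c; simp only [embR, Pi.smul_apply, smul_eq_mul]; ring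

section
variable (hq : q ≠ 0) (hω : q - q⁻¹ ≠ 0) (hs : s.IsRep q) (ht : t.IsRep q)
include hq hω hs ht

lemma raise_emb_aux (B : CGBasis q s t) {n : ℕ} (hn : B.Ok n) (a b : ℕ) :
    s.f a * t.k q b * B.ψ n (a + b + 1 - n) (a + 1) b
      + (s.k q a)⁻¹ * t.f b * B.ψ n (a + b + 1 - n) a (b + 1) =
    (B.c n).fm (a + b + 1 - n) * B.ψ n (a + b + 1 - n - 1) a b := by
  have h := congrFun (congrFun (B.raise_ψ hq hω hs ht n (a + b + 1 - n) hn) a) b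
  rwa [raiseOp_apply, Pi.smul_apply, Pi.smul_apply, smul_eq_mul] at h

lemma lower_emb_aux (B : CGBasis q s t) {n : ℕ} (hn : B.Ok n) (a b : ℕ) :
    s.fm a * t.k q b * B.ψ n (a + b - 1 - n) (a - 1) b
      + (s.k q a)⁻¹ * t.fm b * B.ψ n (a + b - 1 - n) a (b - 1) =
    (B.c n).f (a + b - 1 - n) * B.ψ n (a + b - 1 - n + 1) a b := by
  have h := congrFun (congrFun (B.lower_ψ hq hω hs ht n (a + b - 1 - n) hn) a) b
  rwa [lowerOp_apply, Pi.smul_apply, Pi.smul_apply, smul_eq_mul] at h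

/-- Coassociativity: on a channel of `s ⊗ t` the coproducts of `E` and `K` act as they do on `c n`.
-/
lemma raise3_embL (B : CGBasis q s t) {n : ℕ} (hn : B.Ok n) (χ : ℕ → ℕ → ℂ) :
    raise3 q s t r (B.embL n χ) = B.embL n (raiseOp q (B.c n) r χ) := by
  ext a b c
  have h := B.raise_emb_aux hq hω hs ht hn a b
  have e1 : a + 1 + b - n = a + b + 1 - n := by omega
  have e2 : a + (b + 1) - n = a + b + 1 - n := by omega
  simp only [raise3, embL, raiseOp_apply]
  rw [e1, e2]
  by_cases hl : n ≤ a + b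
  · have e3 : a + b + 1 - n = a + b - n + 1 := by omega
    have hk := B.k_mul n (a + b - n) a b hn (by omega)
    rw [e3, fm_succ, Nat.add_sub_cancel] at h
    rw [e3, ← hk, mul_inv]
    linear_combination r.k q c * χ (a + b - n + 1) c * h
  · have e3 : a + b + 1 - n = 0 := by omega
    -- Below level `n` the subtraction truncates to `0`. Entries with `a + b + 1 = n` can be nonzero
    -- on the left; they cancel because `ψ n 0` is singular.
    rw [B.ψ_apply_eq_zero (z := a) (w := b) (n := n) (by omega)]
    rw [e3, fm_zero] at h
    rw [e3]
    linear_combination r.k q c * χ 0 c * h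

lemma lower3_embL (B : CGBasis q s t) {n : ℕ} (hn : B.Ok n) (χ : ℕ → ℕ → ℂ) :
    lower3 q s t r (B.embL n χ) = B.embL n (lowerOp q (B.c n) r χ) := by
  ext a b c
  have h := B.lower_emb_aux hq hω hs ht hn a b
  have e1 : ∀ X : ℕ → ℂ, s.fm a * X (a - 1 + b - n) = s.fm a * X (a + b - 1 - n) := fun X => by
    cases a with
    | zero => simp
    | succ a => congr 2; omega
  have e2 : ∀ X : ℕ → ℂ, t.fm b * X (a + (b - 1) - n) = t.fm b * X (a + b - 1 - n) := fun X => by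
    cases b with
    | zero => simp
    | succ b => congr 2
  have e1' := e1 fun y => B.ψ n y (a - 1) b * χ y c
  have e2' := e2 fun y => B.ψ n y a (b - 1) * χ y c
  simp only [lower3, embL, lowerOp_apply]
  by_cases hl : n + 1 ≤ a + b
  · have e3 : a + b - n = a + b - 1 - n + 1 := by omega
    have hk := B.k_mul n (a + b - n) a b hn (by omega)
    rw [← hk, mul_inv, e3, fm_succ, Nat.add_sub_cancel]
    linear_combination r.k q c * χ (a + b - 1 - n) c * h + t.k q b * r.k q c * e1' +
      (s.k q a)⁻¹ * r.k q c * e2'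
  · have e3 : a + b - n = 0 := by omega
    rw [B.ψ_apply_eq_zero (k := a + b - 1 - n + 1) (z := a) (w := b) (n := n) (by omega)] at h
    rw [e3, fm_zero]
    by_cases hl' : a + b = n
    · have hk := B.k_mul n 0 a b hn (by omega)
      rw [← hk, mul_inv]
      linear_combination r.k q c * χ (a + b - 1 - n) c * h + t.k q b * r.k q c * e1' +
      (s.k q a)⁻¹ * r.k q c * e2'
    · rw [B.ψ_apply_eq_zero (z := a) (w := b) (n := n) (k := 0) (by omega)]
      linear_combination r.k q c * χ (a + b - 1 - n) c * h + t.k q b * r.k q c * e1' +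
      (s.k q a)⁻¹ * r.k q c * e2'

end

section
variable (hq : q ≠ 0) (hω : q - q⁻¹ ≠ 0) (ht : t.IsRep q) (hr : r.IsRep q)
include hq hω ht hr

lemma raise3_embR (B : CGBasis q t r) {n : ℕ} (hn : B.Ok n) (χ : ℕ → ℕ → ℂ) :
    raise3 q s t r (B.embR n χ) = B.embR n (raiseOp q s (B.c n) χ) := by
  ext a b c
  have h := B.raise_emb_aux hq hω ht hr hn b c
  have e1 : b + 1 + c - n = b + c + 1 - n := by omega
  have e2 : b + (c + 1) - n = b + c + 1 - n := by omega
  simp only [raise3, embR, raiseOp_apply]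
  rw [e1, e2]
  by_cases hl : n ≤ b + c
  · have e3 : b + c + 1 - n = b + c - n + 1 := by omega
    have hk := B.k_mul n (b + c - n) b c hn (by omega)
    rw [e3, fm_succ, Nat.add_sub_cancel] at h
    rw [e3, ← hk]
    linear_combination (s.k q a)⁻¹ * χ a (b + c - n + 1) * h
  · have e3 : b + c + 1 - n = 0 := by omega
    rw [B.ψ_apply_eq_zero (z := b) (w := c) (n := n) (by omega)]
    rw [e3, fm_zero] at h
    rw [e3]
    linear_combination (s.k q a)⁻¹ * χ a 0 * h

lemma lower3_embR (B : CGBasis q t r) {n : ℕ} (hn : B.Ok n) (χ : ℕ → ℕ → ℂ) :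
    lower3 q s t r (B.embR n χ) = B.embR n (lowerOp q s (B.c n) χ) := by
  ext a b c
  have h := B.lower_emb_aux hq hω ht hr hn b c
  have e1 : ∀ X : ℕ → ℂ, t.fm b * X (b - 1 + c - n) = t.fm b * X (b + c - 1 - n) := fun X => by
    cases b with
    | zero => simp
    | succ b => congr 2; omega
  have e2 : ∀ X : ℕ → ℂ, r.fm c * X (b + (c - 1) - n) = r.fm c * X (b + c - 1 - n) := fun X => by
    cases c with
    | zero => simp
    | succ c => congr 2
  have e1' := e1 fun y => B.ψ n y (b - 1) c * χ a y
  have e2' := e2 fun y => B.ψ n y b (c - 1) * χ a y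
  simp only [lower3, embR, lowerOp_apply]
  by_cases hl : n + 1 ≤ b + c
  · have e3 : b + c - n = b + c - 1 - n + 1 := by omega
    have hk := B.k_mul n (b + c - n) b c hn (by omega)
    rw [← hk, e3, fm_succ, Nat.add_sub_cancel]
    linear_combination (s.k q a)⁻¹ * χ a (b + c - 1 - n) * h + (s.k q a)⁻¹ * r.k q c * e1' +
      (s.k q a)⁻¹ * (t.k q b)⁻¹ * e2'
  · have e3 : b + c - n = 0 := by omega
    rw [B.ψ_apply_eq_zero (k := b + c - 1 - n + 1) (z := b) (w := c) (n := n) (by omega)] at h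
    rw [e3, fm_zero]
    by_cases hl' : b + c = n
    · have hk := B.k_mul n 0 b c hn (by omega)
      rw [← hk]
      linear_combination (s.k q a)⁻¹ * χ a (b + c - 1 - n) * h + (s.k q a)⁻¹ * r.k q c * e1' +
      (s.k q a)⁻¹ * (t.k q b)⁻¹ * e2'
    · rw [B.ψ_apply_eq_zero (z := b) (w := c) (n := n) (k := 0) (by omega)]
      linear_combination (s.k q a)⁻¹ * χ a (b + c - 1 - n) * h + (s.k q a)⁻¹ * r.k q c * e1' +
      (s.k q a)⁻¹ * (t.k q b)⁻¹ * e2'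

end

/-- The projection onto `s ⊗ c` for a summand `c` of `t ⊗ r`. -/
noncomputable def projR (B : CGBasis q t r) (n : ℕ) (φ : ℕ → ℕ → ℕ → ℂ) (a y : ℕ) : ℂ :=
  pair (n + y) (B.ψ n y) (φ a)

/-- The projection onto `c ⊗ r` for a summand `c` of `s ⊗ t`. -/
noncomputable def projL (B : CGBasis q s t) (n : ℕ) (φ : ℕ → ℕ → ℕ → ℂ) (y c : ℕ) : ℂ :=
  pair (n + y) (B.ψ n y) fun a b => φ a b c

lemma sum_antidiagonal_shift (f : ℕ → ℕ → ℂ) (n l : ℕ) (hf : ∀ a b, b < n → f a b = 0) :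
    ∑ p ∈ antidiagonal (n + l), f p.1 p.2 = ∑ p ∈ antidiagonal l, f p.1 (n + p.2) := by
  induction n generalizing f with
  | zero => simp
  | succ n ih =>
    have e : n + 1 + l = (n + l) + 1 := by omega
    rw [e, Nat.sum_antidiagonal_succ' (f := fun p => f p.1 p.2), hf _ _ n.succ_pos, zero_add]
    rw [ih (fun a b => f a (b + 1)) fun a b h => hf a (b + 1) (by omega)]
    exact sum_congr rfl fun p _ => by congr 1; omega

/-- `projR` is the transpose of `embR`, which reduces pairings with coupled vectors to two-site
pairings. -/
lemma pair3_embR (B : CGBasis q t r) (n l : ℕ) (χ : ℕ → ℕ → ℂ) (φ : ℕ → ℕ → ℕ → ℂ) :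
    pair3 (n + l) (B.embR n χ) φ = pair l χ (B.projR n φ) := by
  have e : ∀ a b, pair b (B.embR n χ a) (φ a) = χ a (b - n) * pair b (B.ψ n (b - n)) (φ a) :=
    fun a b => by
      rw [← pair_smul_left]
      refine pair_congr (fun z w h => ?_) fun _ _ _ => rfl
      rw [embR, h, Pi.smul_apply, Pi.smul_apply, smul_eq_mul, mul_comm]
  simp only [pair3, e]
  rw [sum_antidiagonal_shift (fun a b => χ a (b - n) * pair b (B.ψ n (b - n)) (φ a))]
  · refine sum_congr rfl fun p _ => ?_
    simp only [Nat.add_sub_cancel_left, projR]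
  · intro a b hb
    have : pair b (B.ψ n (b - n)) (φ a) = 0 := sum_eq_zero fun p hp => by
      have := mem_antidiagonal.mp hp
      rw [B.ψ_apply_eq_zero (by omega), zero_mul]
    simp only [this, mul_zero]

lemma pair3_embL (B : CGBasis q s t) (n l : ℕ) (χ : ℕ → ℕ → ℂ) (φ : ℕ → ℕ → ℕ → ℂ) :
    pair3 (n + l) (B.embL n χ) φ = pair l χ (B.projL n φ) := by
  have e : ∀ b c, pair b (fun x y => B.embL n χ x y c) (fun x y => φ x y c) =
      χ (b - n) c * pair b (B.ψ n (b - n)) (fun x y => φ x y c) :=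
    fun b c => by
      rw [← pair_smul_left]
      refine pair_congr (fun z w h => ?_) fun _ _ _ => rfl
      rw [embL, h, Pi.smul_apply, Pi.smul_apply, smul_eq_mul, mul_comm]
  rw [pair3_eq]
  simp only [e]
  rw [← Nat.sum_antidiagonal_swap]
  simp only [Prod.fst_swap, Prod.snd_swap]
  rw [sum_antidiagonal_shift (fun c b => χ (b - n) c * pair b (B.ψ n (b - n)) (fun x y => φ x y c)),
    pair, ← Nat.sum_antidiagonal_swap]
  · refine sum_congr rfl fun p _ => ?_
    simp only [Nat.add_sub_cancel_left, projL, Prod.fst_swap, Prod.snd_swap]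
  · intro c b hb
    have : pair b (B.ψ n (b - n)) (fun x y => φ x y c) = 0 := sum_eq_zero fun p hp => by
      have := mem_antidiagonal.mp hp
      rw [B.ψ_apply_eq_zero (by omega), zero_mul]
    simp only [this, mul_zero]

lemma supp_projR (B : CGBasis q t r) (n : ℕ) {φ : ℕ → ℕ → ℕ → ℂ} (hφ : Supp3 s t r φ) :
    Supp s (B.c n) (B.projR n φ) := fun a y h => by
  constructor
  · by_contra h'
    rw [projR, pair, ne_eq] at h
    refine h (sum_eq_zero fun p _ => ?_)
    by_contra h''
    exact h' (hφ a p.1 p.2 (right_ne_zero_of_mul h'')).1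
  · by_contra h'
    refine h ?_
    rw [projR, B.ψ_eq_zero fun h'' => h' h''.2, pair_zero_left]

lemma supp_projL (B : CGBasis q s t) (n : ℕ) {φ : ℕ → ℕ → ℕ → ℂ} (hφ : Supp3 s t r φ) :
    Supp (B.c n) r (B.projL n φ) := fun y c h => by
  constructor
  · by_contra h'
    refine h ?_
    rw [projL, B.ψ_eq_zero fun h'' => h' h''.2, pair_zero_left]
  · by_contra h'
    rw [projL, pair, ne_eq] at h
    refine h (sum_eq_zero fun p _ => ?_)
    by_contra h''
    exact h' (hφ p.1 p.2 c (right_ne_zero_of_mul h'')).2.2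

lemma supp3_embL (B : CGBasis q s t) (n : ℕ) {χ : ℕ → ℕ → ℂ} (hχ : Supp (B.c n) r χ) :
    Supp3 s t r (B.embL n χ) := fun a b c h =>
  ⟨(B.supp _ _ a b (left_ne_zero_of_mul h)).1, (B.supp _ _ a b (left_ne_zero_of_mul h)).2,
    (hχ _ c (right_ne_zero_of_mul h)).2⟩

lemma supp3_embR (B : CGBasis q t r) (n : ℕ) {χ : ℕ → ℕ → ℂ} (hχ : Supp s (B.c n) χ) :
    Supp3 s t r (B.embR n χ) := fun a b c h =>
  ⟨(hχ a _ (right_ne_zero_of_mul h)).1, B.supp _ _ b c (left_ne_zero_of_mul h)⟩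

end CGBasis

end ColoredIRF

/-! ### Coupled vectors and the recoupling transformation. -/

namespace ColoredIRF
open Site Setup

/-- The distinction between spins and colors. -/
def ColorRep.isSpin : ColorRep → Prop
  | color _ => False
  | spin _ => True

open ColorRep

lemma ColorRep.ext_val {x y : ColorRep} (hk : x.isSpin ↔ y.isSpin) (hv : x.val = y.val) : x = y := by
  cases x <;> cases y <;> simp_all [isSpin, val]

lemma ColorRep.isSpin_fuse (a b : ColorRep) (n : ℕ) : (a.fuse b n).isSpin ↔ a.isSpin ∧ b.isSpin := by
  cases a <;> cases b <;> simp [isSpin, fuse]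

variable {D : Setup} {a b c : ColorRep}

lemma regular_of_val {x y : ColorRep} (hx : D.Regular x) (hk : y.isSpin ↔ x.isSpin) (n : ℕ)
    (hv : y.val = x.val - n) : D.Regular y := by
  cases x with
  | color p =>
    cases y with
    | color p' =>
      intro m
      have := hx (m - 2 * n)
      simp only [ColorRep.val] at hv
      rw [hv]
      convert this using 2
      push_cast; ring
    | spin k => simp [isSpin] at hk
  | spin k =>
    cases y with
    | color p' => simp [isSpin] at hk
    | spin k' =>
      simp only [ColorRep.val] at hv
      have : (k' : ℂ) + 2 * n = k := by linear_combination 2 * hv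
      have : k' + 2 * n = k := by exact_mod_cast this
      exact le_trans (by exact_mod_cast (by omega : k' + 2 ≤ k + 2)) hx

namespace Setup

variable (D) in
/-- The triples of labels for which the tensor products in all orders are completely reducible. -/
def Good3 (a b c : ColorRep) : Prop :=
  D.Good a b ∧ D.Good b c ∧ D.Good a c ∧ D.Regular ((a.add b).add c)

lemma Good3.swap (h : D.Good3 a b c) : D.Good3 b a c :=
  ⟨h.1.symm, h.2.2.1, h.2.1, by
    have := h.2.2.2
    rwa [ColorRep.add, ColorRep.add, fuse_comm a b] at this⟩

lemma Good3.left (h : D.Good3 a b c) {n : ℕ} (h1 : (n : ℕ∞) < D.dim a) (h2 : (n : ℕ∞) < D.dim b) :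
    D.Good (a.fuse b n) c :=
  ⟨regular_fuse h.1 h1 h2, h.2.1.2.1, regular_of_val h.2.2.2
    (by simp only [ColorRep.add, isSpin_fuse]) n
    (by rw [val_add, val_add, val_add, val_fuse h1 h2]; ring)⟩

lemma Good3.right (h : D.Good3 a b c) {n : ℕ} (h1 : (n : ℕ∞) < D.dim b) (h2 : (n : ℕ∞) < D.dim c) :
    D.Good a (b.fuse c n) :=
  ⟨h.1.1, regular_fuse h.2.1 h1 h2, regular_of_val h.2.2.2
    (by simp only [ColorRep.add, isSpin_fuse, and_assoc]) n
    (by rw [val_add, val_add, val_add, val_fuse h1 h2]; ring)⟩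

/-- The channel `n` occurs in `a ⊗ b`. -/
def Chan (D : Setup) (a b : ColorRep) (n : ℕ) : Prop := (n : ℕ∞) < D.dim a ∧ (n : ℕ∞) < D.dim b

/-- A label is determined by its kind and its parameter, so the two bracketings agree as soon as the
levels add up to the same number. -/
lemma fuse_assoc {n j n' j' : ℕ} (hn : D.Chan a b n) (hj : D.Chan (a.fuse b n) c j)
    (hn' : D.Chan b c n') (hj' : D.Chan a (b.fuse c n') j') (h : n + j = n' + j') :
    (a.fuse b n).fuse c j = a.fuse (b.fuse c n') j' := by
  refine ext_val (by simp only [isSpin_fuse, and_assoc]) ?_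
  rw [val_fuse hj.1 hj.2, val_fuse hn.1 hn.2, val_fuse hj'.1 hj'.2, val_fuse hn'.1 hn'.2]
  have : (n : ℂ) + j = n' + j' := by exact_mod_cast h
  linear_combination -this

lemma cgPsi_eq_zero {n k z w : ℕ} (h : ¬(D.Chan a b n ∧ z + w = n + k ∧
    (z : ℕ∞) < D.dim a ∧ (w : ℕ∞) < D.dim b ∧ (k : ℕ∞) < D.dim (a.fuse b n))) :
    D.cgPsi a b n k z w = 0 := if_neg fun h' => h ⟨⟨h'.1, h'.2.1⟩, h'.2.2⟩

lemma cgPsi_eq_zero' {n : ℕ} (h : ¬D.Chan a b n) (k : ℕ) : D.cgPsi a b n k = 0 := by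
  ext z w; exact cgPsi_eq_zero fun h' => h h'.1

variable (D)

/-- The coupled vectors of `(a ⊗ b) ⊗ c`. -/
noncomputable def cpL (a b c : ColorRep) (n j z : ℕ) (x y w : ℕ) : ℂ :=
  D.cgPsi a b n (x + y - n) x y * D.cgPsi (a.fuse b n) c j z (x + y - n) w

/-- The coupled vectors of `a ⊗ (b ⊗ c)`. -/
noncomputable def cpR (a b c : ColorRep) (n j z : ℕ) (x y w : ℕ) : ℂ :=
  D.cgPsi b c n (y + w - n) y w * D.cgPsi a (b.fuse c n) j z x (y + w - n)

/-- The matrix elements of the recoupling transformation. -/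
noncomputable def overlap (a b c : ColorRep) (n j n' j' : ℕ) : ℂ :=
  pair3 (n + j) (D.cpL a b c n j 0) (D.cpR a b c n' j' 0)

variable {D} {n j n' j' z z' : ℕ}

lemma cpL_eq_zero (h : ¬(D.Chan a b n ∧ D.Chan (a.fuse b n) c j ∧
    (z : ℕ∞) < D.dim ((a.fuse b n).fuse c j))) : D.cpL a b c n j z = 0 := by
  ext x y w
  by_cases h1 : D.Chan a b n
  · by_cases h2 : D.Chan (a.fuse b n) c j
    · have h3 : D.cgPsi (a.fuse b n) c j z (x + y - n) w = 0 :=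
        cgPsi_eq_zero fun h' => h ⟨h1, h2, h'.2.2.2.2⟩
      rw [cpL, h3, mul_zero]; rfl
    · rw [cpL, cgPsi_eq_zero' h2]; simp
  · rw [cpL, cgPsi_eq_zero' h1]; simp

lemma cpR_eq_zero (h : ¬(D.Chan b c n ∧ D.Chan a (b.fuse c n) j ∧
    (z : ℕ∞) < D.dim (a.fuse (b.fuse c n) j))) : D.cpR a b c n j z = 0 := by
  ext x y w
  by_cases h1 : D.Chan b c n
  · by_cases h2 : D.Chan a (b.fuse c n) j
    · have h3 : D.cgPsi a (b.fuse c n) j z x (y + w - n) = 0 :=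
        cgPsi_eq_zero fun h' => h ⟨h1, h2, h'.2.2.2.2⟩
      rw [cpR, h3, mul_zero]; rfl
    · rw [cpR, cgPsi_eq_zero' h2]; simp
  · rw [cpR, cgPsi_eq_zero' h1]; simp

lemma cpL_level {x y w : ℕ} (h : D.cpL a b c n j z x y w ≠ 0) : x + y + w = n + j + z := by
  have h1 := of_not_not (mt cgPsi_eq_zero (left_ne_zero_of_mul h))
  have h2 := of_not_not (mt cgPsi_eq_zero (right_ne_zero_of_mul h))
  have := h1.2.1
  have := h2.2.1
  omega

lemma cpR_level {x y w : ℕ} (h : D.cpR a b c n j z x y w ≠ 0) : x + y + w = n + j + z := by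
  have h1 := of_not_not (mt cgPsi_eq_zero (left_ne_zero_of_mul h))
  have h2 := of_not_not (mt cgPsi_eq_zero (right_ne_zero_of_mul h))
  have := h1.2.1
  have := h2.2.1
  omega

lemma overlap_eq_zero (h : ¬(D.Chan a b n ∧ D.Chan (a.fuse b n) c j ∧
    D.Chan b c n' ∧ D.Chan a (b.fuse c n') j')) : D.overlap a b c n j n' j' = 0 := by
  by_cases h1 : D.Chan a b n ∧ D.Chan (a.fuse b n) c j
  · rw [overlap, cpR_eq_zero fun h2 => h ⟨h1.1, h1.2, h2.1, h2.2.1⟩, pair3_zero_right]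
  · rw [overlap, cpL_eq_zero fun h2 => h1 ⟨h2.1, h2.2.1⟩, pair3_zero_left]

variable (P : D.Proper) (h3 : D.Good3 a b c)
include P h3

lemma Proper.supp_cpL : Supp3 (D.site a) (D.site b) (D.site c) (D.cpL a b c n j z) := by
  by_cases hn : D.Chan a b n
  · by_cases hj : D.Chan (a.fuse b n) c j
    · exact (cgBasis P h3.1).supp3_embL n ((cgBasis P (h3.left hn.1 hn.2)).supp j z)
    · rw [cpL_eq_zero fun h => hj h.2.1]; intro _ _ _ h; exact absurd rfl h
  · rw [cpL_eq_zero fun h => hn h.1]; intro _ _ _ h; exact absurd rfl h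

lemma Proper.supp_cpR : Supp3 (D.site a) (D.site b) (D.site c) (D.cpR a b c n j z) := by
  by_cases hn : D.Chan b c n
  · by_cases hj : D.Chan a (b.fuse c n) j
    · exact (cgBasis P h3.2.1).supp3_embR n ((cgBasis P (h3.right hn.1 hn.2)).supp j z)
    · rw [cpR_eq_zero fun h => hj h.2.1]; intro _ _ _ h; exact absurd rfl h
  · rw [cpR_eq_zero fun h => hn h.1]; intro _ _ _ h; exact absurd rfl h

/-- The recoupling transformation is diagonal in, and independent of, the weight. -/
lemma Proper.pair3_cp (hz : (z : ℕ∞) < D.dim ((a.fuse b n).fuse c j))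
    (hl : n + j + z = n' + j' + z') :
    pair3 (n + j + z) (D.cpL a b c n j z) (D.cpR a b c n' j' z') =
      if z = z' then D.overlap a b c n j n' j' else 0 := by
  by_cases hv : D.Chan a b n ∧ D.Chan (a.fuse b n) c j ∧
    D.Chan b c n' ∧ D.Chan a (b.fuse c n') j'
  swap
  · rw [overlap_eq_zero hv, ite_self]
    by_cases h1 : D.Chan a b n ∧ D.Chan (a.fuse b n) c j
    · rw [cpR_eq_zero fun h2 => hv ⟨h1.1, h1.2, h2.1, h2.2.1⟩, pair3_zero_right]
    · rw [cpL_eq_zero fun h2 => h1 ⟨h2.1, h2.2.1⟩, pair3_zero_left]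
  obtain ⟨hn, hj, hn', hj'⟩ := hv
  have hm : n + j = n' + j' → (a.fuse b n).fuse c j = a.fuse (b.fuse c n') j' :=
    fuse_assoc hn hj hn' hj'
  by_cases hz' : (z' : ℕ∞) < D.dim (a.fuse (b.fuse c n') j')
  swap
  · rw [if_neg, cpR_eq_zero fun h => hz' h.2.2, pair3_zero_right]
    rintro rfl
    exact hz' (hm (by omega) ▸ hz)
  have hq := D.qpow_ne 1
  have ha := P.isRep h3.1.1
  have hb := P.isRep h3.1.2.1
  have hc := P.isRep h3.2.1.2.1
  have gL := h3.left hn.1 hn.2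
  have gR := h3.right hn'.1 hn'.2
  have hab := P.isRep gL.1
  have hbc := P.isRep gR.2.1
  refine pair3_ladder (s := D.site a) (t := D.site b) (r := D.site c) (P.isRep (regular_fuse gL hj.1 hj.2)) (P.isRep (regular_fuse gR hj'.1 hj'.2))
    (fun h => congrArg D.site (hm h)) (fun z => ?_) (fun z => ?_) (fun z => ?_) (fun z => ?_) z z'
    hz hz' hl
  · refine ((cgBasis P h3.1).raise3_embL hq P.ω_ne ha hb hn ((cgBasis P gL).ψ j z)).trans ?_
    refine (congrArg _ ((cgBasis P gL).raise_ψ hq P.ω_ne hab hc j z hj)).trans ?_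
    exact (cgBasis P h3.1).embL_smul _ _ _
  · refine ((cgBasis P h3.1).lower3_embL hq P.ω_ne ha hb hn ((cgBasis P gL).ψ j z)).trans ?_
    refine (congrArg _ ((cgBasis P gL).lower_ψ hq P.ω_ne hab hc j z hj)).trans ?_
    exact (cgBasis P h3.1).embL_smul _ _ _
  · refine ((cgBasis P h3.2.1).raise3_embR hq P.ω_ne hb hc hn' ((cgBasis P gR).ψ j' z)).trans ?_
    refine (congrArg _ ((cgBasis P gR).raise_ψ hq P.ω_ne ha hbc j' z hj')).trans ?_
    exact (cgBasis P h3.2.1).embR_smul _ _ _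
  · refine ((cgBasis P h3.2.1).lower3_embR hq P.ω_ne hb hc hn' ((cgBasis P gR).ψ j' z)).trans ?_
    refine (congrArg _ ((cgBasis P gR).lower_ψ hq P.ω_ne ha hbc j' z hj')).trans ?_
    exact (cgBasis P h3.2.1).embR_smul _ _ _

omit P h3 in
lemma sum_range_eq_of_le {M N : ℕ} {G : ℕ → ℂ} (hG : ∀ k, M ≤ k → G k = 0) :
    ∑ k ∈ range M, (if k < N then G k else 0) = ∑ k ∈ range N, G k := by
  rw [← sum_filter]
  refine sum_subset (fun k hk => by simp only [mem_filter] at hk; exact mem_range.mpr hk.2)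
    fun k hk hk' => hG k ?_
  simp only [mem_filter, mem_range, not_and_or] at hk hk'
  omega

/-- The recoupling transformation. -/
lemma Proper.cpL_expand (n j z x y w : ℕ) : D.cpL a b c n j z x y w =
    ∑ n' ∈ range (n + j + 1), D.overlap a b c n j n' (n + j - n') *
      D.cpR a b c n' (n + j - n') z x y w := by
  by_cases hl : x + y + w = n + j + z
  swap
  · rw [of_not_not (mt cpL_level hl)]
    refine (sum_eq_zero fun n' hn' => ?_).symm
    have := mem_range.mp hn'
    rw [of_not_not (mt cpR_level (by omega)), mul_zero]
  by_cases hz : (z : ℕ∞) < D.dim ((a.fuse b n).fuse c j)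
  swap
  · rw [cpL_eq_zero fun h => hz h.2.2]
    refine (sum_eq_zero fun n' hn' => ?_).symm
    have := mem_range.mp hn'
    by_cases hv : D.Chan a b n ∧ D.Chan (a.fuse b n) c j ∧
      D.Chan b c n' ∧ D.Chan a (b.fuse c n') (n + j - n')
    · rw [cpR_eq_zero, Pi.zero_apply, Pi.zero_apply, Pi.zero_apply, mul_zero]
      rintro ⟨-, -, h⟩
      rw [← fuse_assoc hv.1 hv.2.1 hv.2.2.1 hv.2.2.2 (by omega)] at h
      exact hz h
    · rw [overlap_eq_zero hv, zero_mul]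
  have hq := D.qpow_ne 1
  have ha := P.isRep h3.1.1
  have hb := P.isRep h3.1.2.1
  have hc := P.isRep h3.2.1.2.1
  have hsupp := P.supp_cpL h3 (n := n) (j := j) (z := z)
  -- Completeness is used twice: for `b ⊗ c` in the last two factors, then for `a ⊗ (bc)` on the
  -- projection to a channel of `b ⊗ c`.
  refine ((cgBasis P h3.2.1).expand hq P.ω_ne hb hc (hsupp.slice x) (y + w) y w rfl).trans ?_
  have key : ∀ p ∈ antidiagonal (y + w),
      pair (y + w) ((cgBasis P h3.2.1).ψ p.1 p.2) (D.cpL a b c n j z x) *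
        (cgBasis P h3.2.1).ψ p.1 p.2 y w = if p.1 < n + j + 1 then
      D.overlap a b c n j p.1 (n + j - p.1) * D.cpR a b c p.1 (n + j - p.1) z x y w else 0 := by
    intro p hp
    have hp := HasAntidiagonal.mem_antidiagonal.mp hp
    by_cases hn' : D.Chan b c p.1
    swap
    · rw [overlap_eq_zero fun h => hn' h.2.2.1, zero_mul, ite_self]
      rw [(cgBasis P h3.2.1).ψ_eq_zero_of_not_ok hn']; simp
    have gR := h3.right hn'.1 hn'.2
    have e := (cgBasis P gR).expand hq P.ω_ne ha (P.isRep gR.2.1)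
      ((cgBasis P h3.2.1).supp_projR p.1 hsupp) (x + p.2) x p.2 rfl
    rw [CGBasis.projR, hp] at e
    rw [e, sum_mul]
    have h2 : ∀ p' ∈ antidiagonal (x + p.2), pair (x + p.2) ((cgBasis P gR).ψ p'.1 p'.2)
        ((cgBasis P h3.2.1).projR p.1 (D.cpL a b c n j z)) =
        if z = p'.2 then D.overlap a b c n j p.1 p'.1 else 0 := fun p' hp' => by
      have hp' := HasAntidiagonal.mem_antidiagonal.mp hp'
      rw [← P.pair3_cp h3 hz (by omega), ← CGBasis.pair3_embR, pair3_comm]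
      congr 1
      omega
    have eR : D.cpR a b c p.1 (n + j - p.1) z x y w = (cgBasis P gR).ψ (n + j - p.1) z x p.2 *
        (cgBasis P h3.2.1).ψ p.1 p.2 y w := by
      have : y + w - p.1 = p.2 := by omega
      rw [cpR, this, mul_comm]; rfl
    split_ifs with hlt
    · rw [sum_eq_single (n + j - p.1, z)]
      · rw [h2 _ (by simp only [HasAntidiagonal.mem_antidiagonal]; omega), if_pos rfl, eR, mul_assoc]
      · intro p' hp' hne
        rw [h2 p' hp', if_neg, zero_mul, zero_mul]
        have hp' := HasAntidiagonal.mem_antidiagonal.mp hp'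
        intro h
        exact hne (Prod.ext (by simp only; omega) h.symm)
      · intro h
        exact absurd (HasAntidiagonal.mem_antidiagonal.mpr (by simp only; omega)) h
    · refine sum_eq_zero fun p' hp' => ?_
      rw [h2 p' hp', if_neg, zero_mul, zero_mul]
      have hp' := HasAntidiagonal.mem_antidiagonal.mp hp'
      omega
  rw [sum_congr rfl key, Nat.sum_antidiagonal_eq_sum_range_succ_mk]
  -- Channels `k > y + w` contribute nothing at this entry, so the range of summation can be made
  -- independent of the entry.
  refine sum_range_eq_of_le fun k hk => ?_
  have : D.cgPsi b c k (y + w - k) y w = 0 := cgPsi_eq_zero fun h => by have := h.2.1; omega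
  rw [cpR, this, zero_mul, mul_zero]

/-- The inverse of the recoupling transformation. -/
lemma Proper.cpR_expand (n j z x y w : ℕ) : D.cpR a b c n j z x y w =
    ∑ n' ∈ range (n + j + 1), D.overlap a b c n' (n + j - n') n j *
      D.cpL a b c n' (n + j - n') z x y w := by
  by_cases hl : x + y + w = n + j + z
  swap
  · rw [of_not_not (mt cpR_level hl)]
    refine (sum_eq_zero fun n' hn' => ?_).symm
    have := mem_range.mp hn'
    rw [of_not_not (mt cpL_level (by omega)), mul_zero]
  have hq := D.qpow_ne 1
  have ha := P.isRep h3.1.1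
  have hb := P.isRep h3.1.2.1
  have hc := P.isRep h3.2.1.2.1
  have hsupp := P.supp_cpR h3 (n := n) (j := j) (z := z)
  refine ((cgBasis P h3.1).expand hq P.ω_ne ha hb (hsupp.slice' w) (x + y) x y rfl).trans ?_
  have key : ∀ p ∈ antidiagonal (x + y),
      pair (x + y) ((cgBasis P h3.1).ψ p.1 p.2) (fun x y => D.cpR a b c n j z x y w) *
        (cgBasis P h3.1).ψ p.1 p.2 x y = if p.1 < n + j + 1 then
      D.overlap a b c p.1 (n + j - p.1) n j * D.cpL a b c p.1 (n + j - p.1) z x y w else 0 := by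
    intro p hp
    have hp := HasAntidiagonal.mem_antidiagonal.mp hp
    by_cases hn' : D.Chan a b p.1
    swap
    · rw [overlap_eq_zero fun h => hn' h.1, zero_mul, ite_self]
      rw [(cgBasis P h3.1).ψ_eq_zero_of_not_ok hn']; simp
    have gL := h3.left hn'.1 hn'.2
    have e := (cgBasis P gL).expand hq P.ω_ne (P.isRep gL.1) hc
      ((cgBasis P h3.1).supp_projL p.1 hsupp) (p.2 + w) p.2 w rfl
    rw [CGBasis.projL, hp] at e
    rw [e, sum_mul]
    have h2 : ∀ p' ∈ antidiagonal (p.2 + w), pair (p.2 + w) ((cgBasis P gL).ψ p'.1 p'.2)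
        ((cgBasis P h3.1).projL p.1 (D.cpR a b c n j z)) * (cgBasis P gL).ψ p'.1 p'.2 p.2 w =
        (if p'.2 = z then D.overlap a b c p.1 p'.1 n j else 0) * (cgBasis P gL).ψ p'.1 p'.2 p.2 w :=
      fun p' hp' => by
      have hp' := HasAntidiagonal.mem_antidiagonal.mp hp'
      -- `pair3_cp` asks for a weight that occurs in the left-coupled channel; for other weights the
      -- basis vector itself is zero.
      by_cases hz : (p'.2 : ℕ∞) < D.dim ((a.fuse b p.1).fuse c p'.1)
      · congr 1
        rw [← P.pair3_cp h3 hz (by omega), ← CGBasis.pair3_embL]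
        congr 1
        omega
      · rw [(cgBasis P gL).ψ_eq_zero fun h => hz h.2]; simp
    have eL : D.cpL a b c p.1 (n + j - p.1) z x y w = (cgBasis P gL).ψ (n + j - p.1) z p.2 w *
        (cgBasis P h3.1).ψ p.1 p.2 x y := by
      have : x + y - p.1 = p.2 := by omega
      rw [cpL, this, mul_comm]; rfl
    split_ifs with hlt
    · rw [sum_eq_single (n + j - p.1, z)]
      · rw [h2 _ (by simp only [HasAntidiagonal.mem_antidiagonal]; omega), if_pos rfl, eL, mul_assoc]
      · intro p' hp' hne
        rw [h2 p' hp', if_neg, zero_mul, zero_mul]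
        have hp' := HasAntidiagonal.mem_antidiagonal.mp hp'
        intro h
        exact hne (Prod.ext (by simp only; omega) h)
      · intro h
        exact absurd (HasAntidiagonal.mem_antidiagonal.mpr (by simp only; omega)) h
    · refine sum_eq_zero fun p' hp' => ?_
      rw [h2 p' hp', if_neg, zero_mul, zero_mul]
      have hp' := HasAntidiagonal.mem_antidiagonal.mp hp'
      omega
  rw [sum_congr rfl key, Nat.sum_antidiagonal_eq_sum_range_succ_mk]
  refine sum_range_eq_of_le fun k hk => ?_
  have : D.cgPsi a b k (x + y - k) x y = 0 := cgPsi_eq_zero fun h => by have := h.2.1; omega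
  rw [cpL, this, zero_mul, mul_zero]

end Setup
end ColoredIRF

/-! ### Racah coefficients and the vertex–IRF transformation. -/

namespace ColoredIRF
open Site Setup ColorRep

variable {D : Setup} {a b c : ColorRep} {n j n' j' : ℕ}

namespace Setup

lemma fuses_iff {x : ColorRep} : D.Fuses a b x ↔ ∃ n, D.Chan a b n ∧ x = a.fuse b n := by
  simp only [Fuses, FusesAt, Chan, and_assoc]

lemma Chan.fuses (h : D.Chan a b n) : D.Fuses a b (a.fuse b n) := fuses_iff.mpr ⟨n, h, rfl⟩

lemma Chan.level_fuse (h : D.Chan a b n) : D.level a b (a.fuse b n) = n := by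
  have : {m | D.FusesAt a b (a.fuse b n) m} = {n} := by
    ext m
    simp only [FusesAt, Set.mem_ofPred_eq, Set.mem_singleton_iff]
    constructor
    · rintro ⟨h1, h2, h3⟩
      exact (fuse_inj h.1 h.2 h1 h2 h3).symm
    · rintro rfl
      exact ⟨h.1, h.2, rfl⟩
  rw [level, this, csInf_singleton]

open Classical in
lemma Chan.cg_fuse (h : D.Chan a b n) (x y z : ℕ) :
    D.cg a b (a.fuse b n) x y z = D.cgPsi a b n z x y := by
  rw [cg, h.level_fuse, cgPsi]
  refine if_congr ?_ rfl rfl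
  rw [add_comm z n]
  exact ⟨fun h' => ⟨h.1, h.2, h'.2⟩, fun h' => ⟨h.fuses, h'.2.2⟩⟩

lemma cg_eq_zero {x : ColorRep} (h : ¬D.Fuses a b x) (z₁ z₂ z₃ : ℕ) : D.cg a b x z₁ z₂ z₃ = 0 :=
  if_neg fun h' => h h'.1

open Classical in
lemma cg_level {x : ColorRep} {z₁ z₂ z₃ : ℕ} (h : D.cg a b x z₁ z₂ z₃ ≠ 0) :
    z₁ + z₂ = z₃ + D.level a b x := by
  rw [cg, ne_eq, ite_eq_right_iff, not_forall] at h
  exact h.1.2.1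

/-- Conservation of the weight leaves one intermediate index. The inner coefficient fixes it here,
the outer one in `coupledRight_eq'`; both forms are needed to read a path vector in two ways. -/
lemma coupledRight_eq (a b c x m : ColorRep) (z w₁ w₂ w₃ : ℕ) :
    D.coupledRight a b c x m z w₁ w₂ w₃ = D.cg b c x w₂ w₃ (w₂ + w₃ - D.level b c x) *
      D.cg a x m w₁ (w₂ + w₃ - D.level b c x) z := by
  refine finsum_eq_single _ _ fun y hy => ?_
  rw [of_not_not (mt cg_level (a := D.cg b c x w₂ w₃ y ≠ 0) (by omega)), zero_mul]

lemma coupledRight_eq' (a b c x m : ColorRep) (z w₁ w₂ w₃ : ℕ) :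
    D.coupledRight a b c x m z w₁ w₂ w₃ = D.cg b c x w₂ w₃ (z + D.level a x m - w₁) *
      D.cg a x m w₁ (z + D.level a x m - w₁) z := by
  refine finsum_eq_single _ _ fun y hy => ?_
  rw [of_not_not (mt cg_level (a := D.cg a x m w₁ y z ≠ 0) (by omega)), mul_zero]

lemma coupledLeft_eq (a b c x m : ColorRep) (z w₁ w₂ w₃ : ℕ) :
    D.coupledLeft a b c x m z w₁ w₂ w₃ = D.cg a b x w₁ w₂ (w₁ + w₂ - D.level a b x) *
      D.cg x c m (w₁ + w₂ - D.level a b x) w₃ z := by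
  refine finsum_eq_single _ _ fun y hy => ?_
  rw [of_not_not (mt cg_level (a := D.cg a b x w₁ w₂ y ≠ 0) (by omega)), zero_mul]

lemma coupledRight_fuse (hn : D.Chan b c n) (hj : D.Chan a (b.fuse c n) j) (z w₁ w₂ w₃ : ℕ) :
    D.coupledRight a b c (b.fuse c n) (a.fuse (b.fuse c n) j) z w₁ w₂ w₃ =
      D.cpR a b c n j z w₁ w₂ w₃ := by
  rw [coupledRight_eq, hn.level_fuse, hn.cg_fuse, hj.cg_fuse]; rfl

lemma coupledLeft_fuse (hn : D.Chan a b n) (hj : D.Chan (a.fuse b n) c j) (z w₁ w₂ w₃ : ℕ) :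
    D.coupledLeft a b c (a.fuse b n) ((a.fuse b n).fuse c j) z w₁ w₂ w₃ =
      D.cpL a b c n j z w₁ w₂ w₃ := by
  rw [coupledLeft_eq, hn.level_fuse, hn.cg_fuse, hj.cg_fuse]; rfl

lemma coupledRight_eq_zero {x m : ColorRep} (h : ¬(D.Fuses b c x ∧ D.Fuses a x m)) (z w₁ w₂ w₃ : ℕ) :
    D.coupledRight a b c x m z w₁ w₂ w₃ = 0 := by
  rw [coupledRight_eq]
  by_cases h1 : D.Fuses b c x
  · rw [cg_eq_zero fun h2 => h ⟨h1, h2⟩, mul_zero]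
  · rw [cg_eq_zero h1, zero_mul]

lemma coupledLeft_eq_zero {x m : ColorRep} (h : ¬(D.Fuses a b x ∧ D.Fuses x c m)) (z w₁ w₂ w₃ : ℕ) :
    D.coupledLeft a b c x m z w₁ w₂ w₃ = 0 := by
  rw [coupledLeft_eq]
  by_cases h1 : D.Fuses a b x
  · rw [cg_eq_zero fun h2 => h ⟨h1, h2⟩, mul_zero]
  · rw [cg_eq_zero h1, zero_mul]

lemma racahMatrix_eq_zero {x y m : ColorRep} (h : ¬(D.Fuses a b x ∧ D.Fuses x c m) ∨
    ¬(D.Fuses b c y ∧ D.Fuses a y m)) : D.racahMatrix a b c m x y = 0 := by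
  rw [racahMatrix]
  rcases h with h | h
  · simp only [coupledLeft_eq_zero h, zero_mul, finsum_zero]
  · simp only [coupledRight_eq_zero h, mul_zero, finsum_zero]

lemma finsum_pair3 {l : ℕ} {φ χ : ℕ → ℕ → ℕ → ℂ} (hφ : ∀ x y w, φ x y w ≠ 0 → x + y + w = l) :
    ∑ᶠ w : ℕ × ℕ × ℕ, φ w.1 w.2.1 w.2.2 * χ w.1 w.2.1 w.2.2 = pair3 l φ χ := by
  classical
  rw [finsum_eq_sum_of_support_subset (s := ((antidiagonal l).sigma fun p => antidiagonal p.2).image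
    (fun x => (x.1.1, x.2.1, x.2.2)))]
  · rw [sum_image]
    · rw [sum_sigma]; rfl
    · rintro ⟨⟨x, y⟩, ⟨z, w⟩⟩ h ⟨⟨x', y'⟩, ⟨z', w'⟩⟩ h' he
      simp only [coe_sigma, Set.mem_sigma_iff, mem_coe, HasAntidiagonal.mem_antidiagonal] at h h'
      simp only [Prod.mk.injEq] at he
      obtain ⟨rfl, rfl, rfl⟩ := he
      obtain ⟨h1, rfl⟩ := h
      obtain ⟨h1, rfl⟩ := h'
      rfl
  · rintro ⟨x, y, w⟩ h
    have := hφ x y w (left_ne_zero_of_mul h)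
    rw [coe_image]
    refine ⟨⟨(x, y + w), (y, w)⟩, ?_, rfl⟩
    simp only [coe_sigma, Set.mem_sigma_iff, mem_coe, HasAntidiagonal.mem_antidiagonal]
    exact ⟨by omega, trivial⟩

lemma racahMatrix_fuse (hn : D.Chan a b n) (hj : D.Chan (a.fuse b n) c j)
    (hn' : D.Chan b c n') (hj' : D.Chan a (b.fuse c n') j') (h : n + j = n' + j') :
    D.racahMatrix a b c (a.fuse (b.fuse c n') j') (a.fuse b n) (b.fuse c n') =
      D.overlap a b c n j n' j' := by
  rw [racahMatrix, overlap, ← finsum_pair3 fun x y w h => by simpa using cpL_level h]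
  refine finsum_congr fun w => ?_
  rw [coupledRight_fuse hn' hj', ← fuse_assoc hn hj hn' hj' h, coupledLeft_fuse hn hj]

lemma add_eq_of_fuse_eq (hn : D.Chan a b n) (hj : D.Chan (a.fuse b n) c j)
    (hn' : D.Chan b c n') (hj' : D.Chan a (b.fuse c n') j')
    (h : (a.fuse b n).fuse c j = a.fuse (b.fuse c n') j') : n + j = n' + j' := by
  have h := congrArg ColorRep.val h
  rw [val_fuse hj.1 hj.2, val_fuse hn.1 hn.2, val_fuse hj'.1 hj'.2, val_fuse hn'.1 hn'.2] at h
  have : (n : ℂ) + j = n' + j' := by linear_combination -h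
  exact_mod_cast this

/-- The recoupling matrix for a given vector of `a ⊗ (b ⊗ c)`. -/
lemma racahMatrix_right (hn : D.Chan b c n) (hj : D.Chan a (b.fuse c n) j) {k : ℕ}
    (hk : D.Chan a b k) : D.racahMatrix a b c (a.fuse (b.fuse c n) j) (a.fuse b k) (b.fuse c n) =
      if k < n + j + 1 then D.overlap a b c k (n + j - k) n j else 0 := by
  by_cases h : D.Fuses (a.fuse b k) c (a.fuse (b.fuse c n) j)
  · obtain ⟨i, hi, he⟩ := fuses_iff.mp h
    have hs := add_eq_of_fuse_eq hk hi hn hj he.symm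
    obtain rfl : i = n + j - k := by omega
    rw [racahMatrix_fuse hk hi hn hj hs, if_pos (by omega)]
  · rw [racahMatrix_eq_zero (.inl fun h' => h h'.2)]
    split_ifs with hk'
    · rw [overlap_eq_zero]
      rintro ⟨-, h1, -⟩
      apply h
      rw [← fuse_assoc hk h1 hn hj (by omega)]
      exact h1.fuses
    · rfl

/-- The recoupling matrix for a given vector of `(a ⊗ b) ⊗ c`. -/
lemma racahMatrix_left (hn : D.Chan a b n) (hj : D.Chan (a.fuse b n) c j) {k : ℕ}
    (hk : D.Chan b c k) : D.racahMatrix a b c ((a.fuse b n).fuse c j) (a.fuse b n) (b.fuse c k) =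
      if k < n + j + 1 then D.overlap a b c n j k (n + j - k) else 0 := by
  by_cases h : D.Fuses a (b.fuse c k) ((a.fuse b n).fuse c j)
  · obtain ⟨i, hi, he⟩ := fuses_iff.mp h
    have hs := add_eq_of_fuse_eq hn hj hk hi he
    obtain rfl : i = n + j - k := by omega
    rw [he, racahMatrix_fuse hn hj hk hi hs, if_pos (by omega)]
  · rw [racahMatrix_eq_zero (.inr fun h' => h h'.2)]
    split_ifs with hk'
    · rw [overlap_eq_zero]
      rintro ⟨-, -, -, h1⟩
      apply h
      rw [fuse_assoc hn hj hk h1 (by omega)]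
      exact h1.fuses
    · rfl

open Classical in
lemma finsum_fuse (f : ColorRep → ℂ) (N : ℕ)
    (hf : ∀ x, f x ≠ 0 → ∃ n < N, D.Chan b c n ∧ x = b.fuse c n) :
    ∑ᶠ x, f x = ∑ n ∈ range N, if D.Chan b c n then f (b.fuse c n) else 0 := by
  rw [finsum_eq_sum_of_support_subset (s := ((range N).filter (D.Chan b c ·)).image (b.fuse c))]
  · rw [sum_image, sum_filter]
    intro n hn m hm h
    have hn := (mem_filter.mp hn).2
    have hm := (mem_filter.mp hm).2
    exact fuse_inj hn.1 hn.2 hm.1 hm.2 h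
  · intro x hx
    obtain ⟨n, hn, hc, rfl⟩ := hf x hx
    rw [coe_image]
    exact ⟨n, by simp [hn, hc], rfl⟩

lemma Proper.rt_val_ne (P : D.Proper) {x : ColorRep} (hx : D.Regular x) : D.rt (2 * x.val + 1) ≠ 0 := by
  apply P.rt_ne
  have := P.qnum_regular hx 1 fun k hk => by
    subst hk
    refine ⟨by omega, lt_of_lt_of_le ?_ (show ((k + 2 : ℕ) : ℕ∞) ≤ D.M from hx)⟩
    exact_mod_cast (by omega : ((k : ℤ) + 1).toNat < k + 2)
  exact_mod_cast this

/-- The Racah coefficients describe the recoupling. -/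
theorem Proper.racah (P : D.Proper) (h3 : D.Good3 a b c) (ab m : ColorRep) (z w₁ w₂ w₃ : ℕ) :
    D.coupledLeft a b c ab m z w₁ w₂ w₃ =
      ∑ᶠ bc : ColorRep, D.rt (2 * ab.val + 1) * D.rt (2 * bc.val + 1)
        * D.racahW a b m c ab bc * D.coupledRight a b c bc m z w₁ w₂ w₃ := by
  by_cases h : D.Fuses a b ab ∧ D.Fuses ab c m
  swap
  · simp only [coupledLeft_eq_zero h, racahW, racahMatrix_eq_zero (.inl h), zero_div, mul_zero,
      zero_mul, finsum_zero]
  obtain ⟨hab, hm⟩ := h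
  obtain ⟨n, hn, rfl⟩ := fuses_iff.mp hab
  obtain ⟨j, hj, rfl⟩ := fuses_iff.mp hm
  rw [coupledLeft_fuse hn hj, P.cpL_expand h3, finsum_fuse (D := D) (b := b) (c := c) _ (n + j + 1)]
  · refine sum_congr rfl fun k hk => ?_
    have hk := mem_range.mp hk
    split_ifs with hc
    · have h1 := P.rt_val_ne (regular_fuse h3.1 hn.1 hn.2)
      have h2 := P.rt_val_ne (regular_fuse h3.2.1 hc.1 hc.2)
      rw [racahW, mul_div_cancel₀ _ (mul_ne_zero h1 h2), racahMatrix_left hn hj hc, if_pos hk]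
      by_cases h0 : D.Chan a (b.fuse c k) (n + j - k)
      · rw [fuse_assoc hn hj hc h0 (by omega), coupledRight_fuse hc h0]
      · rw [overlap_eq_zero fun h' => h0 h'.2.2.2, zero_mul, zero_mul]
    · rw [overlap_eq_zero fun h' => hc h'.2.2.1, zero_mul]
  · intro x hx
    have hne := right_ne_zero_of_mul hx
    have hf : D.Fuses b c x ∧ D.Fuses a x ((a.fuse b n).fuse c j) := by
      by_contra h
      exact hne (coupledRight_eq_zero h z w₁ w₂ w₃)
    obtain ⟨k, hk, rfl⟩ := fuses_iff.mp hf.1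
    obtain ⟨i, hi, he⟩ := fuses_iff.mp hf.2
    have := add_eq_of_fuse_eq hn hj hk hi he
    exact ⟨k, by omega, hk, rfl⟩

/-- The operator on `a ⊗ b` underlying the vertex `R`-matrix. -/
noncomputable def rOp (P : D.Proper) (hab : D.Good a b) (u : ℂ) : (ℕ → ℕ → ℂ) →ₗ[ℂ] (ℕ → ℕ → ℂ) :=
  (cgBasis P hab).rCheck (cgBasis P hab.symm) fun n => D.gFun a b n u

lemma gFun_comm (a b : ColorRep) (n : ℕ) (u : ℂ) : D.gFun a b n u = D.gFun b a n u := by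
  simp only [gFun, sub_right_comm u a.val, add_right_comm u a.val]

lemma rOp_level (P : D.Proper) (hab : D.Good a b) (u : ℂ) {φ χ : ℕ → ℕ → ℂ} (x y : ℕ)
    (h : ∀ z w, z + w = x + y → φ z w = χ z w) : rOp P hab u φ x y = rOp P hab u χ x y := by
  rw [rOp, CGBasis.rCheck_apply, CGBasis.rCheck_apply]
  exact sum_congr rfl fun p _ => by rw [pair_congr (fun _ _ _ => rfl) h]

/-- A left-coupled vector lies in a single channel of `a ⊗ b`, on which the operator is
multiplication by `g` and the exchange of the factors. -/
lemma rOp_cpL (P : D.Proper) (hab : D.Good a b) (u : ℂ) (n j z x y w : ℕ) :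
    rOp P hab u (fun x y => D.cpL a b c n j z x y w) x y =
      D.gFun a b n u * D.cpL b a c n j z x y w := by
  rw [rOp_level P hab u x y (χ := D.cgPsi (a.fuse b n) c j z (x + y - n) w •
      (cgBasis P hab).ψ n (x + y - n)) fun z' w' h => by
    rw [cpL, h, Pi.smul_apply, Pi.smul_apply, smul_eq_mul, mul_comm]; rfl]
  rw [map_smul, rOp, (cgBasis P hab).rCheck_ψ _ _ (D.qpow_ne 1) P.ω_ne (P.isRep hab.1)
    (P.isRep hab.2.1) (compat_cgBasis P hab hab.symm), cpL, fuse_comm b a]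
  simp only [Pi.smul_apply, smul_eq_mul]
  change _ * (_ * D.cgPsi b a n (x + y - n) x y) = _
  ring

variable (D) in
/-- The matrix elements of the `R`-matrix in the basis of vectors of `a ⊗ (b ⊗ c)`. -/
noncomputable def wt (a b c : ColorRep) (u : ℂ) (n j n' : ℕ) : ℂ :=
  ∑ k ∈ range (n + j + 1), D.gFun a b k u * D.overlap a b c k (n + j - k) n j
    * D.overlap b a c k (n + j - k) n' (n + j - n')

/-- Recoupling to left-coupled vectors, multiplication by `g`, and recoupling back in the exchanged
order; `wt` is the resulting matrix. -/
lemma rOp_cpR (P : D.Proper) (h3 : D.Good3 a b c) (u : ℂ) (n j z x y w : ℕ) :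
    rOp P h3.1 u (fun x y => D.cpR a b c n j z x y w) x y =
      ∑ n' ∈ range (n + j + 1), D.wt a b c u n j n' * D.cpR b a c n' (n + j - n') z x y w := by
  have e : (fun x y => D.cpR a b c n j z x y w) = ∑ k ∈ range (n + j + 1),
      D.overlap a b c k (n + j - k) n j • (fun x y => D.cpL a b c k (n + j - k) z x y w) := by
    ext x y
    rw [P.cpR_expand h3]
    simp only [Finset.sum_apply, Pi.smul_apply, smul_eq_mul]
  rw [e, map_sum]
  simp only [map_smul, Finset.sum_apply, Pi.smul_apply, smul_eq_mul, rOp_cpL, wt, sum_mul]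
  rw [sum_comm]
  refine sum_congr rfl fun k hk => ?_
  rw [P.cpL_expand h3.swap, mul_sum, mul_sum]
  have hk := mem_range.mp hk
  have e2 : k + (n + j - k) = n + j := by omega
  rw [e2]
  exact sum_congr rfl fun n' _ => by ring

lemma vertexR_eq (a b : ColorRep) (u : ℂ) (x y z w : ℕ) : D.vertexR a b u y x z w =
    ∑ p ∈ antidiagonal (x + y),
      D.gFun a b p.1 u * (D.cgPsi a b p.1 p.2 z w * D.cgPsi b a p.1 p.2 x y) := by
  classical
  rw [vertexR, Nat.sum_antidiagonal_eq_sum_range_succ_mk,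
    finsum_eq_sum_of_support_subset (s := range (x + y + 1))]
  · refine sum_congr rfl fun n hn => ?_
    rw [finsum_eq_if]
    have hn := mem_range.mp hn
    split_ifs with h
    · congr 1
      have h : D.Chan a b n := h
      have h' : D.Chan b a n := h.symm
      have e := fuse_comm a b n
      rw [finsum_eq_single _ (x + y - n)]
      · rw [h.cg_fuse]; rw [e, h'.cg_fuse]
      · intro k hk
        rw [e, h'.cg_fuse, cgPsi_eq_zero (a := b) fun h => hk (by have := h.2.1; omega), mul_zero]
    · rw [cgPsi_eq_zero' h]; simp
  · intro n hn
    rw [Function.mem_support, finsum_eq_if] at hn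
    split_ifs at hn with h
    · rw [mem_coe, mem_range]
      by_contra hlt
      refine hn (mul_eq_zero_of_right _ ?_)
      have h : D.Chan a b n := h
      have h' : D.Chan b a n := h.symm
      refine (finsum_congr fun k => ?_).trans finsum_zero
      rw [fuse_comm a b, h'.cg_fuse, cgPsi_eq_zero (a := b) fun h => hlt (by have := h.2.1; omega),
        mul_zero]
    · exact absurd rfl hn

lemma finsum_vertexR (P : D.Proper) (hab : D.Good a b) (u : ℂ) (φ : ℕ → ℕ → ℂ) (x y : ℕ) :
    ∑ᶠ w : ℕ × ℕ, D.vertexR a b u y x w.2 w.1 * φ w.2 w.1 = rOp P hab u φ x y := by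
  rw [finsum_eq_sum_of_support_subset (s := antidiagonal (x + y))]
  · rw [rOp, CGBasis.rCheck_apply, ← Nat.sum_antidiagonal_swap]
    simp only [vertexR_eq, Prod.fst_swap, Prod.snd_swap, sum_mul, pair, mul_sum]
    rw [sum_comm]
    refine sum_congr rfl fun p _ => sum_congr rfl fun r _ => ?_
    change _ = _ * (D.cgPsi a b _ _ _ _ * _) * D.cgPsi b a _ _ _ _
    ring
  · rintro ⟨w, z⟩ h
    rw [Function.mem_support, vertexR_eq] at h
    obtain ⟨p, hp, hne⟩ := exists_ne_zero_of_sum_ne_zero (left_ne_zero_of_mul h)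
    have h1 := of_not_not (mt cgPsi_eq_zero (left_ne_zero_of_mul (right_ne_zero_of_mul hne)))
    have := h1.2.1
    have hp := HasAntidiagonal.mem_antidiagonal.mp hp
    rw [mem_coe, HasAntidiagonal.mem_antidiagonal]
    dsimp only at this ⊢
    omega

lemma fuse_left_comm (hn : D.Chan a c n) (hj : D.Chan b (a.fuse c n) j) (hn' : D.Chan b c n')
    (hj' : D.Chan a (b.fuse c n') j') :
    b.fuse (a.fuse c n) j = a.fuse (b.fuse c n') j' ↔ n + j = n' + j' := by
  constructor
  · intro h
    have h := congrArg ColorRep.val h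
    rw [val_fuse hj.1 hj.2, val_fuse hn.1 hn.2, val_fuse hj'.1 hj'.2, val_fuse hn'.1 hn'.2] at h
    have : (n : ℂ) + j = n' + j' := by linear_combination -h
    exact_mod_cast this
  · intro h
    refine ext_val (by simp only [isSpin_fuse]; tauto) ?_
    rw [val_fuse hj.1 hj.2, val_fuse hn.1 hn.2, val_fuse hj'.1 hj'.2, val_fuse hn'.1 hn'.2]
    have : (n : ℂ) + j = n' + j' := by exact_mod_cast h
    linear_combination -this

/-- The normalizing roots of the two `W` cancel against the prefactor of the weight: `[2p + 1]` is
the square of the root common to both, and each of the other roots occurs once. -/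
lemma weight_fuse (P : D.Proper) (h3 : D.Good3 b a c) (u : ℂ) (hn : D.Chan a c n)
    (hj : D.Chan b (a.fuse c n) j) (hn' : D.Chan b c n') (hj' : D.Chan a (b.fuse c n') j')
    (h : n + j = n' + j') :
    D.weight (a.fuse c n) (b.fuse (a.fuse c n) j) (b.fuse c n') c a b u = D.wt b a c u n j n' := by
  have hm : b.fuse (a.fuse c n) j = a.fuse (b.fuse c n') j' := (fuse_left_comm hn hj hn' hj').mpr h
  classical
  rw [weight, if_pos ⟨hn.fuses, hj.fuses, hn'.fuses, by rw [hm]; exact hj'.fuses⟩, wt,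
    finsum_eq_sum_of_support_subset (s := range (n + j + 1))]
  · refine sum_congr rfl fun k hk => ?_
    have hk := mem_range.mp hk
    rw [finsum_eq_if]
    split_ifs with hc
    · have hc : D.Chan a b k := hc
      have hc' : D.Chan b a k := hc.symm
      have r0 := P.rt_val_ne (regular_fuse h3.1.symm hc.1 hc.2)
      have r1 := P.rt_val_ne (regular_fuse h3.2.1 hn.1 hn.2)
      have r2 := P.rt_val_ne (regular_fuse h3.2.2.1 hn'.1 hn'.2)
      have e1 : D.racahMatrix b a c (b.fuse (a.fuse c n) j) (a.fuse b k) (a.fuse c n) =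
          D.overlap b a c k (n + j - k) n j := by
        rw [fuse_comm a b k, racahMatrix_right hn hj hc', if_pos hk]
      have e2 : D.racahMatrix a b c (b.fuse (a.fuse c n) j) (a.fuse b k) (b.fuse c n') =
          D.overlap a b c k (n + j - k) n' (n + j - n') := by
        obtain rfl : j' = n + j - n' := by omega
        rw [hm, racahMatrix_right hn' hj' hc, if_pos (by omega)]
        congr 1; all_goals omega
      rw [racahW, racahW, e1, e2, ← P.rt_sq, gFun_comm]
      field_simp
    · rw [overlap_eq_zero fun h => hc h.1.symm]; ring
  · intro k hk
    rw [Function.mem_support, finsum_eq_if] at hk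
    split_ifs at hk with hc
    · have hc : D.Chan a b k := hc
      have hc' : D.Chan b a k := hc.symm
      rw [mem_coe, mem_range]
      by_contra hlt
      refine hk (mul_eq_zero_of_left (mul_eq_zero_of_right _ ?_) _)
      rw [racahW, fuse_comm a b k, racahMatrix_right hn hj hc', if_neg hlt, zero_div]
    · exact absurd rfl hk

lemma weight_eq_zero {x y z c : ColorRep} {u : ℂ} (h : ¬D.Admissible x y z c a b) :
    D.weight x y z c a b u = 0 := if_neg h

lemma admissible_iff {x : ColorRep} (hn : D.Chan a c n) (hj : D.Chan b (a.fuse c n) j) :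
    D.Admissible (a.fuse c n) (b.fuse (a.fuse c n) j) x c a b ↔
      ∃ n' < n + j + 1, D.Chan b c n' ∧ x = b.fuse c n' ∧ D.Chan a (b.fuse c n') (n + j - n') := by
  constructor
  · rintro ⟨-, -, h1, h2⟩
    obtain ⟨n', hn', rfl⟩ := fuses_iff.mp h1
    obtain ⟨j', hj', he⟩ := fuses_iff.mp h2
    have := (fuse_left_comm hn hj hn' hj').mp he
    obtain rfl : j' = n + j - n' := by omega
    exact ⟨n', by omega, hn', rfl, hj'⟩
  · rintro ⟨n', hlt, hn', rfl, hj'⟩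
    refine ⟨hn.fuses, hj.fuses, hn'.fuses, ?_⟩
    rw [(fuse_left_comm hn hj hn' hj').mpr (by omega)]
    exact hj'.fuses

/-- The vertex–IRF transformation. -/
theorem Proper.rOp_coupledRight (P : D.Proper) (h3 : D.Good3 b a c) (u : ℂ) (g₁₂ g₁ : ColorRep)
    (z x y w : ℕ) :
    rOp P h3.1 u (fun x y => D.coupledRight b a c g₁₂ g₁ z x y w) x y =
      ∑ᶠ g₂₁ : ColorRep, D.weight g₁₂ g₁ g₂₁ c a b u * D.coupledRight a b c g₂₁ g₁ z x y w := by
  by_cases h : D.Fuses a c g₁₂ ∧ D.Fuses b g₁₂ g₁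
  swap
  · have e : (fun x y => D.coupledRight b a c g₁₂ g₁ z x y w) = 0 := by
      ext x y; exact coupledRight_eq_zero h _ _ _ _
    rw [e, map_zero]
    refine ((finsum_congr fun k => ?_).trans finsum_zero).symm
    rw [weight_eq_zero fun h' => h ⟨h'.1, h'.2.1⟩, zero_mul]
  obtain ⟨n, hn, rfl⟩ := fuses_iff.mp h.1
  obtain ⟨j, hj, rfl⟩ := fuses_iff.mp h.2
  simp only [coupledRight_fuse hn hj]
  rw [rOp_cpR P h3, finsum_fuse (D := D) (b := b) (c := c) _ (n + j + 1)]
  · refine sum_congr rfl fun k hk => ?_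
    have hk := mem_range.mp hk
    split_ifs with hc
    · by_cases hd : D.Chan a (b.fuse c k) (n + j - k)
      · rw [weight_fuse P h3 u hn hj hc hd (by omega), (fuse_left_comm hn hj hc hd).mpr (by omega),
          coupledRight_fuse hc hd]
      · rw [cpR_eq_zero fun h => hd h.2.1, weight_eq_zero, zero_mul, Pi.zero_apply, Pi.zero_apply,
          Pi.zero_apply, mul_zero]
        intro h
        obtain ⟨n', hlt, hn', he, hj'⟩ := (admissible_iff hn hj).mp h
        obtain rfl := fuse_inj hc.1 hc.2 hn'.1 hn'.2 he
        exact hd hj'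
    · rw [cpR_eq_zero fun h => hc h.1]; simp
  · intro x hx
    have h : D.Admissible _ _ x _ _ _ := of_not_not (mt weight_eq_zero (left_ne_zero_of_mul hx))
    obtain ⟨n', hlt, hn', rfl, -⟩ := (admissible_iff hn hj).mp h
    exact ⟨n', hlt, hn', rfl⟩

theorem Proper.vertexIRF (P : D.Proper) (h3 : D.Good3 b a c) (u : ℂ) (g₁₂ g₁ : ColorRep)
    (z z₁ z₂ z₀ : ℕ) :
    ∑ᶠ w : ℕ × ℕ, D.vertexR b a u z₂ z₁ w.2 w.1 * D.coupledRight b a c g₁₂ g₁ z w.2 w.1 z₀ =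
      ∑ᶠ g₂₁ : ColorRep, D.weight g₁₂ g₁ g₂₁ c a b u * D.coupledRight a b c g₂₁ g₁ z z₁ z₂ z₀ :=
  (finsum_vertexR P h3.1 u (fun x y => D.coupledRight b a c g₁₂ g₁ z x y z₀) z₁ z₂).trans
    (P.rOp_coupledRight h3 u g₁₂ g₁ z z₁ z₂ z₀)

end Setup
end ColoredIRF

/-! ### The vertex Yang–Baxter equation and linear independence of path vectors. -/

namespace ColoredIRF
open Site Setup ColorRep

variable {D : Setup} {a b c : ColorRep}

namespace Setup

lemma gFun_zero (a b : ColorRep) (u : ℂ) : D.gFun a b 0 u = 1 := by simp [gFun]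

lemma gFun_succ (a b : ColorRep) (n : ℕ) (u : ℂ) : D.gFun a b (n + 1) u =
    -(D.gFun a b n u * (D.qnum (u - a.val - b.val + n) / D.qnum (u + a.val + b.val - n))) := by
  rw [gFun, gFun, prod_range_succ, pow_succ]; ring

/-- The quotient of consecutive values of `g` is the one demanded by `CGBasis.intertwiner`: with `κ
= q ^ (a + b - n)`, the two brackets there are `κ (q - q⁻¹)` times the denominator and the numerator
of `g`, up to a sign. -/
lemma rOp_intertwiner (P : D.Proper) (hab : D.Good a b) (X Y : ℂ)
    (h : ∀ n : ℕ, D.qnum (X - Y + a.val + b.val - n) ≠ 0) :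
    Intertwiner (D.qpow 1) (D.site a) (D.site b) (D.qpow X) (D.qpow Y) (rOp P hab (X - Y)) := by
  refine CGBasis.intertwiner _ _ _ (D.qpow_ne 1) P.ω_ne (P.isRep hab.1) (P.isRep hab.2.1)
    (D.qpow_ne X) (D.qpow_ne Y) (compat_cgBasis P hab hab.symm) ?_ fun n hn => ?_
  · change _ * D.cgPsi a b 0 0 0 0 * D.cgPsi b a 0 0 0 0 = 1
    rw [cgPsi_zero_zero P hab, cgPsi_zero_zero P hab.symm, gFun_zero]; ring
  · have hn' := CGBasis.ok_of_succ hn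
    change _ * (_ - _ * D.qpow (a.fuse b n).val ^ 2) = _ * (_ - _ * D.qpow (a.fuse b n).val ^ 2)
    rw [val_fuse hn'.1 hn'.2]
    have e1 := P.mul_qnum (X - Y + a.val + b.val - n)
    have e2 := P.mul_qnum (X - Y - a.val - b.val + n)
    have q1 : D.qpow (X - Y + a.val + b.val - n) =
        D.qpow X * (D.qpow Y)⁻¹ * D.qpow (a.val + b.val - n) := by
      rw [← qpow_neg, ← qpow_add, ← qpow_add]; congr 1; ring
    have q2 : D.qpow (X - Y - a.val - b.val + n) =
        D.qpow X * (D.qpow Y)⁻¹ * (D.qpow (a.val + b.val - n))⁻¹ := by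
      rw [← qpow_neg, ← qpow_neg, ← qpow_add, ← qpow_add]; congr 1; ring
    rw [q1] at e1
    rw [q2] at e2
    rw [gFun_succ]
    have hX := D.qpow_ne X
    have hY := D.qpow_ne Y
    have hZ := D.qpow_ne (a.val + b.val - n)
    generalize D.qpow (a.val + b.val - n) = Z at *
    have d1 : D.qpow Y / D.qpow X - D.qpow X / D.qpow Y * Z ^ 2 =
        -(Z * ((D.qpow 1 - (D.qpow 1)⁻¹) * D.qnum (X - Y + a.val + b.val - n))) := by
      rw [e1]; field_simp; ring
    have d2 : D.qpow X / D.qpow Y - D.qpow Y / D.qpow X * Z ^ 2 =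
        Z * ((D.qpow 1 - (D.qpow 1)⁻¹) * D.qnum (X - Y - a.val - b.val + n)) := by
      rw [e2]; field_simp
    have h0 := div_mul_cancel₀ (D.qnum (X - Y - a.val - b.val + n)) (h n)
    rw [d1, d2]
    linear_combination D.gFun a b n (X - Y) * Z * (D.qpow 1 - (D.qpow 1)⁻¹) * h0

/-- The genericity needed for trivial kernels is the nonvanishing of the same `q`-numbers that occur
in the denominators of `g`, here for all `n`. -/
lemma laxA_ne (P : D.Proper) (X Y : ℂ) (n : ℕ) (h : D.qnum (Y - X + b.val + a.val - n) ≠ 0) :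
    laxA (D.qpow 1) (D.site b) (D.qpow Y) ((D.site a).k (D.qpow 1) n / D.qpow X) 0 ≠ 0 := by
  have e := mul_ne_zero P.ω_ne h
  rw [P.mul_qnum] at e
  convert e using 1
  have q1 : D.qpow (Y - X + b.val + a.val - n) =
      D.qpow (a.val - n) / D.qpow X * D.qpow Y * D.qpow b.val := by
    rw [div_eq_mul_inv, ← qpow_neg, ← qpow_add, ← qpow_add, ← qpow_add]; congr 1; ring
  rw [laxA, k_site, k_site, q1, mul_inv, mul_inv]
  simp

/-- The Yang–Baxter equation of the vertex model for generic spectral parameters. -/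
theorem Proper.yangBaxter (P : D.Proper) {p₁ p₂ p₃ : ColorRep} (h₂₁ : D.Good p₂ p₁)
    (h₃₁ : D.Good p₃ p₁) (h₃₂ : D.Good p₃ p₂) {u v : ℂ}
    (g₂₁ : ∀ n : ℕ, D.qnum (u + p₂.val + p₁.val - n) ≠ 0)
    (g₃₁ : ∀ n : ℕ, D.qnum (u + v + p₃.val + p₁.val - n) ≠ 0)
    (g₃₂ : ∀ n : ℕ, D.qnum (v + p₃.val + p₂.val - n) ≠ 0) {φ : ℕ → ℕ → ℕ → ℂ}
    (hφ : Supp3 (D.site p₃) (D.site p₂) (D.site p₁) φ) :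
    lift12 (rOp P h₂₁ u) (lift23 (rOp P h₃₁ (u + v)) (lift12 (rOp P h₃₂ v) φ)) =
      lift23 (rOp P h₃₂ v) (lift12 (rOp P h₃₁ (u + v)) (lift23 (rOp P h₂₁ u) φ)) := by
  -- The sites `p₁`, `p₂`, `p₃` carry the parameters `0`, `u`, `u + v`; each exchange involves the
  -- difference of two of them.
  have e₂₁ : u - 0 = u := by ring
  have e₃₁ : u + v - 0 = u + v := by ring
  have e₃₂ : u + v - u = v := by ring
  have i₂₁ := rOp_intertwiner P h₂₁ u 0 (by rwa [e₂₁])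
  have i₃₁ := rOp_intertwiner P h₃₁ (u + v) 0 (by rwa [e₃₁])
  have i₃₂ := rOp_intertwiner P h₃₂ (u + v) u (by rwa [e₃₂])
  rw [e₂₁] at i₂₁
  rw [e₃₁] at i₃₁
  rw [e₃₂] at i₃₂
  exact yangBaxter_of_intertwiners (D.qpow_ne 1) (P.isRep h₂₁.2.1) (P.isRep h₂₁.1)
    (P.isRep h₃₁.1) (D.qpow_ne _) (D.qpow_ne _) (D.qpow_ne _) i₃₂ i₃₁ i₂₁
    (fun n => laxA_ne P _ _ n (by rw [e₂₁]; exact g₂₁ n))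
    (fun n => laxA_ne P _ _ n (by rw [e₃₁]; exact g₃₁ n))
    (fun n => laxA_ne P _ _ n (by rw [e₃₂]; exact g₃₂ n)) hφ

variable (D) in
/-- The vectors of `c ⊗ (b ⊗ (a ⊗ g))` of highest weight in a summand `x₃`, for the path
`g, x₁, x₂, x₃`. -/
noncomputable def pathVec (c b a g x₁ x₂ x₃ : ColorRep) (w₀ w₃ w₂ w₁ : ℕ) : ℂ :=
  D.cg a g x₁ w₁ w₀ (w₁ + w₀ - D.level a g x₁) *
    D.coupledRight c b x₁ x₂ x₃ 0 w₃ w₂ (w₁ + w₀ - D.level a g x₁)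

/-- The definition displays the coupling of `c` and `b` to `x₁`, this form that of `b` and `a` to
`g`. Which one is needed depends on the pair of factors being exchanged. -/
lemma pathVec_eq (c b a g x₁ x₂ x₃ : ColorRep) (w₀ w₃ w₂ w₁ : ℕ) :
    D.pathVec c b a g x₁ x₂ x₃ w₀ w₃ w₂ w₁ =
      D.cg c x₂ x₃ w₃ (D.level c x₂ x₃ - w₃) 0 *
        D.coupledRight b a g x₁ x₂ (D.level c x₂ x₃ - w₃) w₂ w₁ w₀ := by
  rw [pathVec, coupledRight_eq', coupledRight_eq b a, zero_add]
  ring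

variable (P : D.Proper) {g x₁ x₂ x₃ : ColorRep} {S : Finset ColorRep} {u : ℂ}

/-- The exchange of `c` and `b` changes only the height `x₂`, by the vertex–IRF transformation over
`x₁`. The finite set `S` merely bounds the heights that can occur. -/
lemma lift12_pathVec (hcb : D.Good c b) (h3 : D.Fuses a g x₁ → D.Good3 c b x₁)
    (hS : ∀ x, D.Fuses a g x₁ → D.Admissible x₂ x₃ x x₁ b c → x ∈ S) (w₀ : ℕ) :
    lift12 (rOp P hcb u) (D.pathVec c b a g x₁ x₂ x₃ w₀) =
      ∑ x ∈ S, D.weight x₂ x₃ x x₁ b c u • D.pathVec b c a g x₁ x x₃ w₀ := by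
  ext w₃ w₂ w₁
  simp only [Finset.sum_apply, Pi.smul_apply, smul_eq_mul, lift12]
  by_cases hf : D.Fuses a g x₁
  swap
  · have e : (fun w₃ w₂ => D.pathVec c b a g x₁ x₂ x₃ w₀ w₃ w₂ w₁) = 0 := by
      ext w₃ w₂; rw [pathVec, cg_eq_zero hf, zero_mul]; rfl
    rw [e, map_zero]
    exact (sum_eq_zero fun x _ => by rw [pathVec, cg_eq_zero hf, zero_mul, mul_zero]).symm
  have e : (fun w₃ w₂ => D.pathVec c b a g x₁ x₂ x₃ w₀ w₃ w₂ w₁) =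
      D.cg a g x₁ w₁ w₀ (w₁ + w₀ - D.level a g x₁) •
      (fun w₃ w₂ => D.coupledRight c b x₁ x₂ x₃ 0 w₃ w₂ (w₁ + w₀ - D.level a g x₁)) := rfl
  rw [e, map_smul, Pi.smul_apply, Pi.smul_apply, P.rOp_coupledRight (h3 hf), smul_eq_mul,
    finsum_eq_sum_of_support_subset (s := S), mul_sum]
  · exact sum_congr rfl fun x _ => by rw [pathVec]; ring
  · intro x hx
    exact hS x hf (of_not_not (mt weight_eq_zero (left_ne_zero_of_mul hx)))

/-- Exchange of `b` and `a`: the transformation over `g` changes only `x₁`, while the outermost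
coupling stays a common factor. -/
lemma lift23_pathVec (h3 : D.Good3 b a g)
    (hS : ∀ x, D.Fuses c x₂ x₃ → D.Admissible x₁ x₂ x g a b → x ∈ S) (w₀ : ℕ) :
    lift23 (rOp P h3.1 u) (D.pathVec c b a g x₁ x₂ x₃ w₀) =
      ∑ x ∈ S, D.weight x₁ x₂ x g a b u • D.pathVec c a b g x x₂ x₃ w₀ := by
  ext w₃ w₂ w₁
  simp only [Finset.sum_apply, Pi.smul_apply, smul_eq_mul, lift23]
  have e : D.pathVec c b a g x₁ x₂ x₃ w₀ w₃ = D.cg c x₂ x₃ w₃ (D.level c x₂ x₃ - w₃) 0 •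
      (fun w₂ w₁ => D.coupledRight b a g x₁ x₂ (D.level c x₂ x₃ - w₃) w₂ w₁ w₀) := by
    ext w₂ w₁
    rw [pathVec_eq]; rfl
  rw [e, map_smul, Pi.smul_apply, Pi.smul_apply, P.rOp_coupledRight h3, smul_eq_mul]
  by_cases hf : D.Fuses c x₂ x₃
  · rw [finsum_eq_sum_of_support_subset (s := S), mul_sum]
    · exact sum_congr rfl fun x _ => by rw [pathVec_eq]; ring
    · intro x hx
      exact hS x hf (of_not_not (mt weight_eq_zero (left_ne_zero_of_mul hx)))
  · rw [cg_eq_zero hf, zero_mul]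
    exact (sum_eq_zero fun x _ => by rw [pathVec_eq, cg_eq_zero hf, zero_mul, mul_zero]).symm

lemma lift12_sum {ι : Type*} (R : (ℕ → ℕ → ℂ) →ₗ[ℂ] (ℕ → ℕ → ℂ)) (A : Finset ι) (f : ι → ℂ)
    (φ : ι → ℕ → ℕ → ℕ → ℂ) :
    lift12 R (∑ i ∈ A, f i • φ i) = ∑ i ∈ A, f i • lift12 R (φ i) := by
  ext x y z
  have e : (fun x y => (∑ i ∈ A, f i • φ i) x y z) = ∑ i ∈ A, f i • (fun x y => φ i x y z) := by
    ext x y; simp only [Finset.sum_apply, Pi.smul_apply]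
  rw [lift12, e, map_sum]
  simp only [Finset.sum_apply, Pi.smul_apply, lift12, map_smul]

lemma lift23_sum {ι : Type*} (R : (ℕ → ℕ → ℂ) →ₗ[ℂ] (ℕ → ℕ → ℂ)) (A : Finset ι) (f : ι → ℂ)
    (φ : ι → ℕ → ℕ → ℕ → ℂ) :
    lift23 R (∑ i ∈ A, f i • φ i) = ∑ i ∈ A, f i • lift23 R (φ i) := by
  ext x y z
  rw [lift23, Finset.sum_apply, map_sum]
  simp only [Finset.sum_apply, Pi.smul_apply, lift23, map_smul]

include P

/-- Linear independence of the coupled vectors. -/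
lemma eq_zero_of_sum_cg (hb : D.Good b g) (f : ColorRep → ℕ → ℂ)
    (h : ∀ w y, ∑ x ∈ S, f x (w + y - D.level b g x) * D.cg b g x w y (w + y - D.level b g x) = 0)
    {x : ColorRep} (hx : x ∈ S) (hf : D.Fuses b g x) {k : ℕ} (hk : (k : ℕ∞) < D.dim x) :
    f x k = 0 := by
  obtain ⟨n, hn, rfl⟩ := fuses_iff.mp hf
  have key : ∑ y ∈ S, ∑ p ∈ antidiagonal (n + k), D.cgPsi b g n k p.1 p.2 *
      (f y (p.1 + p.2 - D.level b g y) * D.cg b g y p.1 p.2 (p.1 + p.2 - D.level b g y)) = 0 := by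
    rw [sum_comm]
    exact sum_eq_zero fun p _ => by rw [← mul_sum, h, mul_zero]
  rw [sum_eq_single (b.fuse g n)] at key
  · rw [← key, ← mul_one (f _ k)]
    have e := (cgBasis P hb).pair_ψ (D.qpow_ne 1) P.ω_ne (P.isRep hb.1) (P.isRep hb.2.1)
      (n := n) (k := k) rfl hn hk
    rw [if_pos rfl] at e
    rw [← e, pair, mul_sum]
    refine sum_congr rfl fun p hp => ?_
    have hp := HasAntidiagonal.mem_antidiagonal.mp hp
    rw [hn.level_fuse, hn.cg_fuse, hp, Nat.add_sub_cancel_left]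
    change _ * (D.cgPsi b g n k _ _ * D.cgPsi b g n k _ _) = _
    ring
  · intro y _ hne
    by_cases hy : D.Fuses b g y
    · obtain ⟨m, hm, rfl⟩ := fuses_iff.mp hy
      by_cases hmn : m ≤ n + k
      · have e := (cgBasis P hb).pair_ψ (D.qpow_ne 1) P.ω_ne (P.isRep hb.1) (P.isRep hb.2.1)
          (n := n) (k := k) (n' := m) (k' := n + k - m) (by omega) hn hk
        rw [if_neg (by rintro rfl; exact hne rfl)] at e
        rw [← mul_zero (f (b.fuse g m) (n + k - m)), ← e, pair, mul_sum]
        refine sum_congr rfl fun p hp => ?_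
        have hp := HasAntidiagonal.mem_antidiagonal.mp hp
        rw [hm.level_fuse, hm.cg_fuse, hp]
        change _ = _ * (D.cgPsi b g n k _ _ * D.cgPsi b g m _ _ _)
        ring
      · refine sum_eq_zero fun p hp => ?_
        have hp := HasAntidiagonal.mem_antidiagonal.mp hp
        rw [hm.level_fuse, hm.cg_fuse, cgPsi_eq_zero (n := m) fun h => hmn (by have := h.2.1; omega)]
        ring
    · exact sum_eq_zero fun p _ => by rw [cg_eq_zero hy]; ring
  · exact fun h => absurd hx h

lemma exists_cg_ne (hb : D.Good b g) {x : ColorRep} (hf : D.Fuses b g x) :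
    ∃ w k : ℕ, (k : ℕ∞) < D.dim g ∧ D.cg b g x w k 0 ≠ 0 := by
  obtain ⟨n, hn, rfl⟩ := fuses_iff.mp hf
  have e := P.norm_cgPsi hb hn.1 hn.2
  obtain ⟨p, hp, hne⟩ := exists_ne_zero_of_sum_ne_zero (e.trans_ne one_ne_zero)
  have hne := left_ne_zero_of_mul hne
  refine ⟨p.1, p.2, (of_not_not (mt cgPsi_eq_zero hne)).2.2.2.1, ?_⟩
  rwa [hn.cg_fuse]

/-- Linear independence of the path vectors. -/
lemma eq_zero_of_sum_pathVec (ha : D.Good a g) (hb : D.Fuses a g x₁ → D.Good b x₁)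
    (hc : D.Fuses a g x₁ → D.Fuses b x₁ x₂ → D.Good c x₂) (f : ColorRep → ColorRep → ℂ)
    (h : ∀ w₀, ∑ x ∈ S, ∑ y ∈ S, f x y • D.pathVec c b a g x y x₃ w₀ = 0)
    (h1 : x₁ ∈ S) (h2 : x₂ ∈ S) (f1 : D.Fuses a g x₁) (f2 : D.Fuses b x₁ x₂)
    (f3 : D.Fuses c x₂ x₃) : f x₁ x₂ = 0 := by
  obtain ⟨w₃, k, hk, hne⟩ := exists_cg_ne P (hc f1 f2) f3
  refine (mul_eq_zero.mp ?_).resolve_right hne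
  refine eq_zero_of_sum_cg P (hb f1) (S := S) (fun y k => f x₁ y * D.cg c y x₃ w₃ k 0)
    (fun w₂ y₁ => ?_) h2 f2 hk
  -- Independence of the channels of `a ⊗ g` isolates the height `x₁`; the same argument for `b ⊗
  -- x₁` then isolates `x₂`.
  have e : ∀ k : ℕ, (k : ℕ∞) < D.dim x₁ →
      ∑ y ∈ S, f x₁ y * D.coupledRight c b x₁ y x₃ 0 w₃ w₂ k = 0 := fun k hk => by
    refine eq_zero_of_sum_cg P ha (S := S)
      (fun x k => ∑ y ∈ S, f x y * D.coupledRight c b x y x₃ 0 w₃ w₂ k)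
      (fun w₁ w₀ => ?_) h1 f1 hk
    have := congrFun (congrFun (congrFun (h w₀) w₃) w₂) w₁
    simp only [Finset.sum_apply, Pi.smul_apply, smul_eq_mul, Pi.zero_apply] at this
    rw [← this]
    refine sum_congr rfl fun x _ => ?_
    rw [sum_mul]
    exact sum_congr rfl fun y _ => by rw [pathVec]; ring
  by_cases hy : (y₁ : ℕ∞) < D.dim x₁
  · rw [← e y₁ hy]
    exact sum_congr rfl fun y _ => by rw [coupledRight_eq]; ring
  · refine sum_eq_zero fun y _ => ?_
    have : D.cg b x₁ y w₂ y₁ (w₂ + y₁ - D.level b x₁ y) = 0 := if_neg fun h => hy h.2.2.2.1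
    rw [this, mul_zero]

end Setup
end ColoredIRF

/-! ### The Yang–Baxter relation of the IRF weights. -/

namespace ColoredIRF
open Site ColorRep

variable {D : Setup} {a b c g : ColorRep}

namespace Setup

/-- With both ends fixed, comparing parameters fixes the sum of the three levels, so each level is
bounded and finitely many heights occur. -/
lemma exists_heights_of_path (a b c g m : ColorRep) : ∃ S : Finset ColorRep, ∀ x y,
    D.Fuses a g x → D.Fuses b x y → D.Fuses c y m → x ∈ S ∧ y ∈ S := by
  classical
  by_cases h : ∃ x y, D.Fuses a g x ∧ D.Fuses b x y ∧ D.Fuses c y m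
  · obtain ⟨x, y, hx, hy, hm⟩ := h
    obtain ⟨n, hn, rfl⟩ := fuses_iff.mp hx
    obtain ⟨j, hj, rfl⟩ := fuses_iff.mp hy
    obtain ⟨i, hi, rfl⟩ := fuses_iff.mp hm
    refine ⟨(range (n + j + i + 1)).image (a.fuse g) ∪
      ((range (n + j + i + 1)).image (a.fuse g)).biUnion
        (fun x => (range (n + j + i + 1)).image (b.fuse x)), fun x y hx' hy' hm' => ?_⟩
    obtain ⟨n', hn', rfl⟩ := fuses_iff.mp hx'
    obtain ⟨j', hj', rfl⟩ := fuses_iff.mp hy'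
    obtain ⟨i', hi', he⟩ := fuses_iff.mp hm'
    have he := congrArg ColorRep.val he
    rw [val_fuse hi.1 hi.2, val_fuse hj.1 hj.2, val_fuse hn.1 hn.2, val_fuse hi'.1 hi'.2,
      val_fuse hj'.1 hj'.2, val_fuse hn'.1 hn'.2] at he
    have he : (n : ℂ) + j + i = n' + j' + i' := by linear_combination -he
    have he : n + j + i = n' + j' + i' := by exact_mod_cast he
    have hx : a.fuse g n' ∈ (range (n + j + i + 1)).image (a.fuse g) :=
      mem_image_of_mem _ (mem_range.mpr (by omega))
    exact ⟨mem_union_left _ hx, mem_union_right _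
      (mem_biUnion.mpr ⟨_, hx, mem_image_of_mem _ (mem_range.mpr (by omega))⟩)⟩
  · exact ⟨∅, fun x y hx hy hm => (h ⟨x, y, hx, hy, hm⟩).elim⟩

lemma exists_heights (T : Finset ColorRep) (g m : ColorRep) : ∃ S : Finset ColorRep,
    ∀ a ∈ T, ∀ b ∈ T, ∀ c ∈ T, ∀ x y, D.Fuses a g x → D.Fuses b x y → D.Fuses c y m →
      x ∈ S ∧ y ∈ S := by
  classical
  choose F hF using fun a b c => exists_heights_of_path (D := D) a b c g m
  refine ⟨T.biUnion fun a => T.biUnion fun b => T.biUnion fun c => F a b c,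
    fun a ha b hb c hc x y hx hy hm => ?_⟩
  simp only [mem_biUnion]
  have := hF a b c x y hx hy hm
  exact ⟨⟨a, ha, b, hb, c, hc, this.1⟩, ⟨a, ha, b, hb, c, hc, this.2⟩⟩

/-- After a step from `g` along `a`, the remaining two labels over the new height are again generic,
because the sum of all four labels is regular. -/
lemma good3_of_fuses {x y : ColorRep} (hbc : D.Good b c) (hb : D.Good3 b a g) (hc : D.Good3 c a g)
    (hy : D.Regular y) (hk : y.isSpin ↔ b.isSpin ∧ c.isSpin ∧ a.isSpin ∧ g.isSpin)
    (hv : y.val = b.val + c.val + a.val + g.val) (hx : D.Fuses a g x) : D.Good3 b c x := by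
  obtain ⟨n, hn, rfl⟩ := fuses_iff.mp hx
  refine ⟨hbc, hc.right hn.1 hn.2, hb.right hn.1 hn.2, regular_of_val hy ?_ n ?_⟩
  · simp only [ColorRep.add, isSpin_fuse, hk, and_assoc]
  · rw [val_add, val_add, val_fuse hn.1 hn.2, hv]; ring

lemma supp3_pathVec (x₁ x₂ x₃ : ColorRep) (w₀ : ℕ) :
    Supp3 (D.site c) (D.site b) (D.site a) (D.pathVec c b a g x₁ x₂ x₃ w₀) := by
  classical
  have key : ∀ {a b c : ColorRep} {x y z : ℕ}, D.cg a b c x y z ≠ 0 → (x : ℕ∞) < D.dim a := by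
    intro a b c x y z h
    by_contra h'
    exact h (if_neg fun h'' => h' h''.2.2.1)
  intro w₃ w₂ w₁ h
  have h1 := left_ne_zero_of_mul h
  have h2 := right_ne_zero_of_mul h
  rw [coupledRight_eq] at h2
  exact ⟨key (right_ne_zero_of_mul h2), key (left_ne_zero_of_mul h2), key h1⟩

section YangBaxter

variable (P : D.Proper) {p₁ p₂ p₃ g₀ : ColorRep} (hgen : D.GenericColors p₁ p₂ p₃ g₀)

include hgen in
lemma GenericColors.good3 : D.Good3 p₁ p₂ g₀ ∧ D.Good3 p₁ p₃ g₀ ∧ D.Good3 p₂ p₃ g₀ := by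
  obtain ⟨⟨h1, h2, h3⟩, ⟨h12, h13, h23⟩, h0, ⟨h10, h20, h30⟩, ⟨h120, h130, h230⟩, -⟩ := hgen
  exact ⟨⟨⟨h1, h2, h12⟩, ⟨h2, h0, h20⟩, ⟨h1, h0, h10⟩, h120⟩,
    ⟨⟨h1, h3, h13⟩, ⟨h3, h0, h30⟩, ⟨h1, h0, h10⟩, h130⟩,
    ⟨⟨h2, h3, h23⟩, ⟨h3, h0, h30⟩, ⟨h2, h0, h20⟩, h230⟩⟩

include hgen in
lemma GenericColors.good3_of_fuses {x : ColorRep} :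
    (D.Fuses p₁ g₀ x → D.Good3 p₂ p₃ x) ∧ (D.Fuses p₂ g₀ x → D.Good3 p₁ p₃ x) ∧
      (D.Fuses p₃ g₀ x → D.Good3 p₁ p₂ x) := by
  obtain ⟨h12, h13, h23⟩ := hgen.good3
  have hy := hgen.2.2.2.2.2
  refine ⟨Setup.good3_of_fuses h23.1 h12.swap h13.swap hy ?_ ?_,
    Setup.good3_of_fuses h13.1 h12 h23.swap hy ?_ ?_,
    Setup.good3_of_fuses h12.1 h13 h23 hy ?_ ?_⟩
  all_goals first
    | (simp only [ColorRep.add, isSpin_fuse]; tauto)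
    | (simp only [val_add]; done)
    | (simp only [val_add]; ring)

include P hgen

/-- The Yang–Baxter relation for generic spectral parameters. -/
lemma sum_weight_of_generic {u v : ℂ}
    (g₂₁ : ∀ n : ℕ, D.qnum (u + p₂.val + p₁.val - n) ≠ 0)
    (g₃₁ : ∀ n : ℕ, D.qnum (u + v + p₃.val + p₁.val - n) ≠ 0)
    (g₃₂ : ∀ n : ℕ, D.qnum (v + p₃.val + p₂.val - n) ≠ 0)
    {S : Finset ColorRep} {g₃ : ColorRep}
    (hS : ∀ {a b c}, a = p₁ ∨ a = p₂ ∨ a = p₃ → b = p₁ ∨ b = p₂ ∨ b = p₃ → c = p₁ ∨ c = p₂ ∨ c = p₃ →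
      ∀ {x y}, D.Fuses a g₀ x → D.Fuses b x y → D.Fuses c y g₃ → x ∈ S ∧ y ∈ S)
    (g₁ g₂ g₁' g₂' : ColorRep) :
    ∑ g ∈ S, D.weight g₁ g₂ g g₀ p₁ p₂ u * D.weight g₂ g₃ g₂' g p₁ p₃ (u + v)
        * D.weight g g₂' g₁' g₀ p₂ p₃ v =
      ∑ g ∈ S, D.weight g₂ g₃ g g₁ p₂ p₃ v * D.weight g₁ g g₁' g₀ p₁ p₃ (u + v)
        * D.weight g g₃ g₂' g₁' p₁ p₂ u := by
  have t1 : p₁ = p₁ ∨ p₁ = p₂ ∨ p₁ = p₃ := by simp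
  have t2 : p₂ = p₁ ∨ p₂ = p₂ ∨ p₂ = p₃ := by simp
  have t3 : p₃ = p₁ ∨ p₃ = p₂ ∨ p₃ = p₃ := by simp
  -- For an inadmissible final path every summand on both sides vanishes; independence of path
  -- vectors gives information only about admissible paths.
  by_cases hadm : D.Fuses p₃ g₀ g₁' ∧ D.Fuses p₂ g₁' g₂' ∧ D.Fuses p₁ g₂' g₃
  swap
  · have h1 : ∀ g, D.weight g₁ g₂ g g₀ p₁ p₂ u * D.weight g₂ g₃ g₂' g p₁ p₃ (u + v)
        * D.weight g g₂' g₁' g₀ p₂ p₃ v = 0 := fun g => by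
      by_contra h
      have ha := of_not_not (mt weight_eq_zero (right_ne_zero_of_mul (left_ne_zero_of_mul h)))
      have hb := of_not_not (mt weight_eq_zero (right_ne_zero_of_mul h))
      exact hadm ⟨hb.2.2.1, hb.2.2.2, ha.2.2.2⟩
    have h2 : ∀ g, D.weight g₂ g₃ g g₁ p₂ p₃ v * D.weight g₁ g g₁' g₀ p₁ p₃ (u + v)
        * D.weight g g₃ g₂' g₁' p₁ p₂ u = 0 := fun g => by
      by_contra h
      have ha := of_not_not (mt weight_eq_zero (right_ne_zero_of_mul (left_ne_zero_of_mul h)))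
      have hb := of_not_not (mt weight_eq_zero (right_ne_zero_of_mul h))
      exact hadm ⟨ha.2.2.1, hb.2.2.1, hb.2.2.2⟩
    rw [sum_eq_zero fun g _ => h1 g, sum_eq_zero fun g _ => h2 g]
  obtain ⟨f1, f2, f3⟩ := hadm
  obtain ⟨h12, h13, h23⟩ := hgen.good3
  have hx : ∀ x, _ := fun x => hgen.good3_of_fuses (x := x)
  obtain ⟨m1, m2⟩ := hS t3 t2 t1 f1 f2 f3
  have key := eq_zero_of_sum_pathVec P (S := S) (c := p₁) (b := p₂) (a := p₃) (g := g₀) (x₃ := g₃)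
    h13.2.1 (fun h => ((hx _).2.2 h).2.1)
    (fun h h' => by
      obtain ⟨n, hn, rfl⟩ := fuses_iff.mp h'
      exact ((hx _).2.2 h).right hn.1 hn.2)
    (fun x y => ∑ g ∈ S, D.weight g₁ g₂ g g₀ p₁ p₂ u * D.weight g₂ g₃ y g p₁ p₃ (u + v)
        * D.weight g y x g₀ p₂ p₃ v -
      ∑ g ∈ S, D.weight g₂ g₃ g g₁ p₂ p₃ v * D.weight g₁ g x g₀ p₁ p₃ (u + v)
        * D.weight g g₃ y x p₁ p₂ u) (fun w₀ => ?_) m1 m2 f1 f2 f3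
  · exact sub_eq_zero.mp key
  -- Both sides reverse the order `p₃, p₂, p₁` by three exchanges. Expanding each exchange in path
  -- vectors yields two combinations of the vectors for `p₁, p₂, p₃`, whose coefficients at `(g₁',
  -- g₂')` are the two sides.
  have yb := P.yangBaxter h12.1.symm h13.1.symm h23.1.symm g₂₁ g₃₁ g₃₂
    (supp3_pathVec (g := g₀) g₁ g₂ g₃ w₀)
  have e1 := lift12_pathVec P (u := v) (a := p₁) (g := g₀) (x₁ := g₁) (x₂ := g₂) (x₃ := g₃) (S := S)
    h23.1.symm (fun h => ((hx _).1 h).swap) (fun x h h' => (hS t1 t3 t2 h h'.2.2.1 h'.2.2.2).2) w₀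
  have e2 : ∀ g, _ := fun g => lift23_pathVec P (u := u + v) (c := p₂) (x₁ := g₁) (x₂ := g)
    (x₃ := g₃) (S := S) h13.swap (fun x h h' => (hS t3 t1 t2 h'.2.2.1 h'.2.2.2 h).1) w₀
  have e3 : ∀ g x, _ := fun g x => lift12_pathVec P (u := u) (a := p₃) (g := g₀) (x₁ := x) (x₂ := g)
    (x₃ := g₃) (S := S) h12.1.symm (fun h => ((hx _).2.2 h).swap)
    (fun y h h' => (hS t3 t2 t1 h h'.2.2.1 h'.2.2.2).2) w₀
  have d1 := lift23_pathVec P (u := u) (c := p₃) (x₁ := g₁) (x₂ := g₂)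
    (x₃ := g₃) (S := S) h12.swap (fun x h h' => (hS t2 t1 t3 h'.2.2.1 h'.2.2.2 h).1) w₀
  have d2 : ∀ g, _ := fun g => lift12_pathVec P (u := u + v) (a := p₂) (g := g₀) (x₁ := g) (x₂ := g₂)
    (x₃ := g₃) (S := S) h13.1.symm (fun h => ((hx _).2.1 h).swap)
    (fun y h h' => (hS t2 t3 t1 h h'.2.2.1 h'.2.2.2).2) w₀
  have d3 : ∀ g y, _ := fun g y => lift23_pathVec P (u := v) (c := p₁) (x₁ := g) (x₂ := y)
    (x₃ := g₃) (S := S) h23.swap (fun x h h' => (hS t3 t2 t1 h'.2.2.1 h'.2.2.2 h).1) w₀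
  simp only [e1, d1, lift12_sum, lift23_sum] at yb
  simp only [e2, d2, lift12_sum, lift23_sum] at yb
  simp only [e3, d3, smul_sum, smul_smul, ← mul_assoc] at yb
  simp only [sub_smul, sum_sub_distrib, sum_smul]
  rw [sub_eq_zero]
  calc _ = ∑ x ∈ S, ∑ g ∈ S, ∑ y ∈ S, _ := sum_congr rfl fun x _ => sum_comm
    _ = ∑ g ∈ S, ∑ x ∈ S, ∑ y ∈ S, _ := sum_comm
    _ = ∑ g ∈ S, ∑ y ∈ S, ∑ x ∈ S, _ := sum_congr rfl fun x _ => sum_comm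
    _ = _ := yb.symm
    _ = ∑ x ∈ S, ∑ g ∈ S, ∑ y ∈ S, _ := sum_comm
    _ = _ := sum_congr rfl fun x _ => sum_comm

end YangBaxter

section Continuity

lemma continuous_qnum : Continuous D.qnum := by
  unfold qnum qpow
  fun_prop

lemma continuousAt_gFun {k : ℕ} {u : ℂ} (hk : D.Chan a b k) (hu : D.NoPole a b u) :
    ContinuousAt (D.gFun a b k) u := by
  unfold gFun
  refine continuousAt_const.mul (tendsto_finsetProd _ fun i hi => ?_)
  have hi := mem_range.mp hi
  have hle : ((i + 1 : ℕ) : ℕ∞) ≤ k := by exact_mod_cast hi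
  refine Filter.Tendsto.div ?_ ?_ (hu i (hle.trans_lt hk.1) (hle.trans_lt hk.2))
  · exact (continuous_qnum.comp (by fun_prop : Continuous fun u : ℂ => u - a.val - b.val + i)).continuousAt
  · exact (continuous_qnum.comp (by fun_prop : Continuous fun u : ℂ => u + a.val + b.val - i)).continuousAt

/-- Only the factors `g` depend on `u`, and channels outside the range of `NoPole` have zero
overlap, so their possible poles do no harm. -/
lemma continuousAt_weight (P : D.Proper) (h3 : D.Good3 a b c) {u : ℂ} (hu : D.NoPole a b u)
    (x y z : ColorRep) : ContinuousAt (D.weight x y z c a b) u := by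
  by_cases h : D.Admissible x y z c a b
  · obtain ⟨n, hn, rfl⟩ := fuses_iff.mp h.1
    obtain ⟨j, hj, rfl⟩ := fuses_iff.mp h.2.1
    obtain ⟨n', hlt, hn', rfl, hj'⟩ := (admissible_iff hn hj).mp h
    have e : D.weight (a.fuse c n) (b.fuse (a.fuse c n) j) (b.fuse c n') c a b =
        fun u => D.wt b a c u n j n' := by
      ext u
      exact weight_fuse P h3.swap u hn hj hn' hj' (by omega)
    rw [e]
    refine tendsto_finsetSum _ fun k _ => ?_
    by_cases hk : D.Chan b a k
    · have hg : ContinuousAt (D.gFun b a k) u := by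
        rw [show D.gFun b a k = D.gFun a b k from funext fun u => gFun_comm _ _ _ _]
        exact continuousAt_gFun hk.symm hu
      exact (hg.mul continuousAt_const).mul continuousAt_const
    · rw [overlap_eq_zero fun h => hk h.1]
      simp only [mul_zero, zero_mul]
      exact tendsto_const_nhds
  · have e : D.weight x y z c a b = fun _ => 0 := funext fun u => weight_eq_zero h
    rw [e]
    exact continuousAt_const

lemma Proper.countable_zeros (P : D.Proper) (s : ℂ) {k : ℂ} (hk : k ≠ 0) :
    {t : ℂ | ∃ n : ℕ, D.qnum (s + k * t - n) = 0}.Countable := by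
  have hh : D.h ≠ 0 := fun h => P.ω_ne (by simp [qpow, h])
  refine (Set.countable_range fun p : ℕ × ℤ =>
    (Real.pi * Complex.I * p.2 / D.h - s + p.1) / k).mono ?_
  rintro t ⟨n, hn⟩
  have e := P.mul_qnum (s + k * t - n)
  rw [hn, mul_zero, ← qpow_neg, eq_comm, sub_eq_zero] at e
  obtain ⟨m, hm⟩ := Complex.exp_eq_exp_iff_exists_int.mp e
  refine ⟨(n, m), ?_⟩
  simp only
  field_simp
  linear_combination (-1 / 2 : ℂ) * hm

end Continuity

variable {p₁ p₂ p₃ g₀ : ColorRep}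

/-- The Yang–Baxter relation of the colored IRF model. -/
theorem Proper.weight_yangBaxter (P : D.Proper) (hgen : D.GenericColors p₁ p₂ p₃ g₀) {u v : ℂ}
    (h₁₂ : D.NoPole p₁ p₂ u) (h₁₃ : D.NoPole p₁ p₃ (u + v)) (h₂₃ : D.NoPole p₂ p₃ v)
    (g₁ g₂ g₃ g₁' g₂' : ColorRep) :
    ∑ᶠ g : ColorRep, D.weight g₁ g₂ g g₀ p₁ p₂ u * D.weight g₂ g₃ g₂' g p₁ p₃ (u + v)
        * D.weight g g₂' g₁' g₀ p₂ p₃ v =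
      ∑ᶠ g : ColorRep, D.weight g₂ g₃ g g₁ p₂ p₃ v * D.weight g₁ g g₁' g₀ p₁ p₃ (u + v)
        * D.weight g g₃ g₂' g₁' p₁ p₂ u := by
  classical
  obtain ⟨S, hS⟩ := exists_heights (D := D) {p₁, p₂, p₃} g₀ g₃
  simp only [mem_insert, mem_singleton] at hS
  rw [finsum_eq_sum_of_support_subset (s := S), finsum_eq_sum_of_support_subset (s := S)]
  rotate_left
  · intro g hg
    have ha := of_not_not (mt weight_eq_zero (left_ne_zero_of_mul (left_ne_zero_of_mul hg)))
    have hb := of_not_not (mt weight_eq_zero (right_ne_zero_of_mul (left_ne_zero_of_mul hg)))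
    exact (hS p₁ (by simp) p₃ (by simp) p₂ (by simp) _ _ hb.1 ha.2.2.1 ha.2.2.2).2
  · intro g hg
    have ha := of_not_not (mt weight_eq_zero (left_ne_zero_of_mul (left_ne_zero_of_mul hg)))
    have hb := of_not_not (mt weight_eq_zero (right_ne_zero_of_mul (left_ne_zero_of_mul hg)))
    exact (hS p₂ (by simp) p₁ (by simp) p₃ (by simp) _ _ ha.2.2.1 hb.1 hb.2.1).1
  obtain ⟨h12, h13, h23⟩ := hgen.good3
  -- The parameters move along `(u + t, v + t)`, so that `u + v` moves by `2 t`. Every excluded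
  -- condition then depends on `t` nontrivially and fails for countably many `t` only, which leaves
  -- a dense set.
  set G : Set ℂ := ({t | ∃ n : ℕ, D.qnum (u + p₂.val + p₁.val + 1 * t - n) = 0} ∪
    {t | ∃ n : ℕ, D.qnum (u + v + p₃.val + p₁.val + 2 * t - n) = 0} ∪
    {t | ∃ n : ℕ, D.qnum (v + p₃.val + p₂.val + 1 * t - n) = 0})ᶜ with hG
  have hd : Dense G := (((P.countable_zeros _ one_ne_zero).union
    (P.countable_zeros _ two_ne_zero)).union (P.countable_zeros _ one_ne_zero)).dense_compl ℂ
  have hne : (nhdsWithin 0 G).NeBot := mem_closure_iff_nhdsWithin_neBot.mp (hd 0)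
  set A : ℂ → ℂ := fun t => ∑ g ∈ S, D.weight g₁ g₂ g g₀ p₁ p₂ (u + 1 * t)
    * D.weight g₂ g₃ g₂' g p₁ p₃ (u + v + 2 * t) * D.weight g g₂' g₁' g₀ p₂ p₃ (v + 1 * t) with hA
  set B : ℂ → ℂ := fun t => ∑ g ∈ S, D.weight g₂ g₃ g g₁ p₂ p₃ (v + 1 * t)
    * D.weight g₁ g g₁' g₀ p₁ p₃ (u + v + 2 * t) * D.weight g g₃ g₂' g₁' p₁ p₂ (u + 1 * t) with hB
  have hAB : Set.EqOn A B G := by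
    intro t ht
    simp only [hG, Set.mem_compl_iff, Set.mem_union, Set.mem_ofPred_eq, not_or, not_exists] at ht
    have e : u + v + 2 * t = u + 1 * t + (v + 1 * t) := by ring
    rw [hA, hB]
    simp only [e]
    refine sum_weight_of_generic P hgen (fun n => ?_) (fun n => ?_) (fun n => ?_)
      (fun ha hb hc => hS _ ha _ hb _ hc _ _) g₁ g₂ g₁' g₂'
    · convert ht.1.1 n using 2; ring
    · convert ht.1.2 n using 2; ring
    · convert ht.2 n using 2; ring
  have cont : ∀ {f : ℂ → ℂ} (s k : ℂ), ContinuousAt f s → ContinuousAt (fun t => f (s + k * t)) 0 := by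
    intro f s k hf
    refine ContinuousAt.comp (f := fun t => s + k * t) (by simpa using hf) (by fun_prop)
  have c12 : ∀ x y z w, D.Good3 p₁ p₂ w →
      ContinuousAt (fun t => D.weight x y z w p₁ p₂ (u + 1 * t)) 0 :=
    fun x y z w h => cont u 1 (continuousAt_weight P h h₁₂ x y z)
  have c13 : ∀ x y z w, D.Good3 p₁ p₃ w →
      ContinuousAt (fun t => D.weight x y z w p₁ p₃ (u + v + 2 * t)) 0 :=
    fun x y z w h => cont (u + v) 2 (continuousAt_weight P h h₁₃ x y z)
  have c23 : ∀ x y z w, D.Good3 p₂ p₃ w →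
      ContinuousAt (fun t => D.weight x y z w p₂ p₃ (v + 1 * t)) 0 :=
    fun x y z w h => cont v 1 (continuousAt_weight P h h₂₃ x y z)
  have cA : ContinuousAt A 0 := by
    refine tendsto_finsetSum _ fun g _ => ?_
    -- Continuity of the middle weight needs genericity over the height `g`, which is known only if
    -- `g` is reached from `g₀`; otherwise the summand is identically zero.
    by_cases hg : D.Fuses p₂ g₀ g
    · exact ((c12 _ _ _ _ h12).mul (c13 _ _ _ _ (hgen.good3_of_fuses.2.1 hg))).mul
        (c23 _ _ _ _ h23)
    · simp only [weight_eq_zero fun h : D.Admissible g₁ g₂ g g₀ p₁ p₂ => hg h.2.2.1, zero_mul]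
      exact tendsto_const_nhds
  have cB : ContinuousAt B 0 := by
    refine tendsto_finsetSum _ fun g _ => ?_
    by_cases hg : D.Fuses p₁ g₀ g₁ ∧ D.Fuses p₃ g₀ g₁'
    · exact ((c23 _ _ _ _ (hgen.good3_of_fuses.1 hg.1)).mul (c13 _ _ _ _ h13)).mul
        (c12 _ _ _ _ (hgen.good3_of_fuses.2.2 hg.2))
    · simp only [weight_eq_zero fun h : D.Admissible g₁ g g₁' g₀ p₁ p₃ => hg ⟨h.1, h.2.2.1⟩,
        zero_mul, mul_zero]
      exact tendsto_const_nhds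
  have := tendsto_nhds_unique_of_eventuallyEq (cA.mono_left nhdsWithin_le_nhds)
    (cB.mono_left nhdsWithin_le_nhds) (hAB.eventuallyEq_nhdsWithin)
  simpa [hA, hB] using this

end Setup
end ColoredIRF

end

theorem mainTheorem6 (D : ColoredIRF.Setup)
    (hq : D.IsGenericCase ∨ D.IsRootCase)
    (hrt : ∀ x : ℂ, D.rt x ^ 2 = D.qnum x)
    (p₁ p₂ p₃ g₀ : ColoredIRF.ColorRep) (hgen : D.GenericColors p₁ p₂ p₃ g₀)
    (u v : ℂ) (h₁₂ : D.NoPole p₁ p₂ u) (h₁₃ : D.NoPole p₁ p₃ (u + v))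
    (h₂₃ : D.NoPole p₂ p₃ v) :
    -- the coefficients `W` are the Racah coefficients
    (∀ (ab m : ColoredIRF.ColorRep) (z w₁ w₂ w₃ : ℕ),
      D.coupledLeft p₁ p₂ g₀ ab m z w₁ w₂ w₃ =
        ∑ᶠ bc : ColoredIRF.ColorRep, D.rt (2 * ab.val + 1) * D.rt (2 * bc.val + 1)
          * D.racahW p₁ p₂ m g₀ ab bc * D.coupledRight p₁ p₂ g₀ bc m z w₁ w₂ w₃) ∧
    -- the vertex-IRF transformation
    (∀ (g₁₂ g₁ : ColoredIRF.ColorRep) (z z₁ z₂ z₀ : ℕ),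
      ∑ᶠ w : ℕ × ℕ, D.vertexR p₂ p₁ u z₂ z₁ w.2 w.1
          * D.coupledRight p₂ p₁ g₀ g₁₂ g₁ z w.2 w.1 z₀ =
        ∑ᶠ g₂₁ : ColoredIRF.ColorRep, D.weight g₁₂ g₁ g₂₁ g₀ p₁ p₂ u
          * D.coupledRight p₁ p₂ g₀ g₂₁ g₁ z z₁ z₂ z₀) ∧
    -- the Yang-Baxter relation for the IRF model
    (∀ g₁ g₂ g₃ g₁' g₂' : ColoredIRF.ColorRep,
      ∑ᶠ g : ColoredIRF.ColorRep, D.weight g₁ g₂ g g₀ p₁ p₂ u * D.weight g₂ g₃ g₂' g p₁ p₃ (u + v)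
          * D.weight g g₂' g₁' g₀ p₂ p₃ v =
        ∑ᶠ g : ColoredIRF.ColorRep, D.weight g₂ g₃ g g₁ p₂ p₃ v * D.weight g₁ g g₁' g₀ p₁ p₃ (u + v)
          * D.weight g g₃ g₂' g₁' p₁ p₂ u) := by
  have P := ColoredIRF.Setup.proper_of hq hrt
  have h3 := hgen.good3.1
  exact ⟨P.racah h3, P.vertexIRF h3.swap u, P.weight_yangBaxter hgen h₁₂ h₁₃ h₂₃⟩
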